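/- Let $E_j=i\lambda_j/\sqrt2$ ($\lambda_1,\dots,\lambda_8$ the Gell-Mann matrices) be the orthonormal basis of $\mathfrak{su}(3)$ for $\langle X,Y\rangle=\operatorname{tr}(X^\dagger Y)$, with coordinates $x_1,\dots,x_8$, and let $\{F,G\}=\sum_{j,k,l}c^l_{kj}\,x_l\,\partial_jF\,\partial_kG$ be the Lie–Poisson bracket of complex polynomials on $\mathfrak{su}(3)$, where $[E_k,E_j]=\sum_l c^l_{kj}E_l$. Let $\varpi_1=\frac1{\sqrt2}E_3+\frac1{\sqrt6}E_8$ and $\varpi_2=\sqrt{2/3}\,E_8$ be the fundamental weights, $\omega_{(p,q)}=p\varpi_1+q\varpi_2$ ($p,q\in\mathbb N_0$) the dominant weights, and $$\mathcal F=\Big\{\sqrt{3/2}\,(x\varpi_1+y\varpi_2): x,y>0,\ x^2+xy+y^2=1\Big\}$$ the open arc in which the unit sphere $\mathcal S^7\subset\mathfrak{su}(3)$ meets the open principal Weyl chamber; it parametrizes the regular adjoint orbits $\mathcal O_\xi=\{g\xi g^{-1}:g\in SU(3)\}$, $\xi\in\mathcal F$, in $\mathcal S^7$. Let $\mathcal Q\subset\mathcal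 F$ be the set of those $\xi$ some positive multiple of which is a dominant weight, let $r(\xi)$ be the least $R>0$ such that $R\xi$ is a dominant weight, and $\omega_\xi=r(\xi)\xi$. For $\xi\in\mathcal Q$ and $s\in\mathbb N$, $s\ge1$, let $\rho$ be the irreducible representation of $SU(3)$, and of the enveloping algebra $U(\mathfrak{sl}(3))$, on the space $\mathcal H_{s\omega_\xi}$ of highest weight $s\omega_\xi$, let $\Pi_>$ be the orthogonal projection onto its highest weight line, and let the Berezin correspondence $b^s_\xi$ take $u\in U(\mathfrak{sl}(3))$ to the function $$b^s_\xi[u](g\xi g^{-1})=\operatorname{tr}\big(\rho(u)\,\rho(g)\Pi_>\rho(g)^{-1}\big),\qquad g\in SU(3),$$ on $\mathcal O_\xi$. Let $\star^s_\xi$ be the twisted product on the image of $b^s_\xi$, given by $b^s_\xi[u]\star^s_\xi b^s_\xi[v]=b^s_\xi[uv]$, let $[f,g]_{\star^s_\xi}=f\star^s_\xi g-g\star^s_\xi f$, and let $\|\cdot\|_\xi$ be the supremum norm on $\mathcal O_\xi$. **Theorem.** The product $\star^s_\xi$ is well defined for all $\xi\in\mathcal Q$ and $s\ge1$. Let $\mathcal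 K\subset\mathcal F$ be compact and $\mathcal Q_{\mathcal K}=\mathcal Q\cap\mathcal K$. Let $f_1,f_2\in Poly(\mathcal S^7)$ be the restrictions to $\mathcal S^7$ of complex polynomials $F_1,F_2$ on $\mathfrak{su}(3)$, and let $\{f_1,f_2\}$ be the restriction of $\{F_1,F_2\}$. Then there is $s_0$ such that $f_1|_{\mathcal O_\xi}$ and $f_2|_{\mathcal O_\xi}$ lie in the image of $b^s_\xi$ for all $s\ge s_0$ and all $\xi\in\mathcal Q_{\mathcal K}$, and $$\big\|f_1|_{\mathcal O_\xi}\star^s_\xi f_2|_{\mathcal O_\xi}-f_1f_2|_{\mathcal O_\xi}\big\|_\xi\quad\text{and}\quad\big\|s\,r(\xi)\,[f_1|_{\mathcal O_\xi},f_2|_{\mathcal O_\xi}]_{\star^s_\xi}-i\{f_1,f_2\}|_{\mathcal O_\xi}\big\|_\xi$$ converge to $0$ as $s\to\infty$, uniformly over $\xi\in\mathcal Q_{\mathcal K}$. -/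

import Mathlib

attribute [local instance] LieRing.ofAssociativeRing

namespace QuarkSU3

open MvPolynomial

noncomputable section

/-! ### The Lie algebra `su(3)`: orthonormal basis, coordinates, Poisson bracket -/

/-- Complex `3 × 3` matrices; `su(3)` is the real subspace of traceless skew-Hermitian ones. -/
abbrev Mat3 : Type := Matrix (Fin 3) (Fin 3) ℂ

/-- The compact group `SU(3)`. -/
abbrev SU3 : Type := Matrix.specialUnitaryGroup (Fin 3) ℂ

/-- The complex Lie algebra `sl(3)`, the complexification of `su(3)`. -/
abbrev sl3 : Type := LieAlgebra.SpecialLinear.sl (Fin 3) ℂ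

/-- The universal enveloping algebra `U(sl(3))`. -/
abbrev Usl3 : Type := UniversalEnvelopingAlgebra ℂ sl3

/-- The Gell-Mann matrices `λ₁, …, λ₈` (indexed from `0`). -/
def gellMann : Fin 8 → Mat3 :=
  ![!![0, 1, 0; 1, 0, 0; 0, 0, 0],
    !![0, -Complex.I, 0; Complex.I, 0, 0; 0, 0, 0],
    !![1, 0, 0; 0, -1, 0; 0, 0, 0],
    !![0, 0, 1; 0, 0, 0; 1, 0, 0],
    !![0, 0, -Complex.I; 0, 0, 0; Complex.I, 0, 0],
    !![0, 0, 0; 0, 0, 1; 0, 1, 0],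
    !![0, 0, 0; 0, 0, -Complex.I; 0, Complex.I, 0],
    ((1 / Real.sqrt 3 : ℝ) : ℂ) • !![1, 0, 0; 0, 1, 0; 0, 0, -2]]

/-- `E_j = i λ_j / √2`, an orthonormal basis of `su(3)` for `⟨X, Y⟩ = tr (X† Y)`. -/
def E (j : Fin 8) : Mat3 := (Complex.I / ((Real.sqrt 2 : ℝ) : ℂ)) • gellMann j

/-- The inner product `⟨X, Y⟩ = tr (X† Y)`. -/
def trInner (X Y : Mat3) : ℂ := Matrix.trace (X.conjTranspose * Y)

/-- The coordinates `(x₁, …, x₈)` of a matrix in the basis `E`. -/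
def coord (X : Mat3) (j : Fin 8) : ℂ := trInner (E j) X

/-- Complex polynomials on `su(3)`, as polynomials in the coordinates `x₁, …, x₈`. -/
abbrev PolySU3 : Type := MvPolynomial (Fin 8) ℂ

/-- The value of a polynomial on `su(3)` at a point. -/
def evalAt (F : PolySU3) (X : Mat3) : ℂ := MvPolynomial.eval (coord X) F

/-- Structure constants: `[E_k, E_j] = ∑ l, structConst k j l • E_l`. -/
def structConst (k j l : Fin 8) : ℂ := trInner (E l) (E k * E j - E j * E k)

/-- The bracket of the Poisson bivector `Π = ∑ c^l_{kj} x_l ∂_j ⊗ ∂_k` on `su(3)`. -/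
def poisson (F G : PolySU3) : PolySU3 :=
  ∑ j, ∑ k, ∑ l, C (structConst k j l) * X l * pderiv j F * pderiv k G

/-! ### Weights, orbits, rational orbits and the integral radius -/

/-- The fundamental weight `ϖ₁ = E₃ / √2 + E₈ / √6`. -/
def fundWeight₁ : Mat3 :=
  ((1 / Real.sqrt 2 : ℝ) : ℂ) • E 2 + ((1 / Real.sqrt 6 : ℝ) : ℂ) • E 7

/-- The fundamental weight `ϖ₂ = √(2/3) E₈`. -/
def fundWeight₂ : Mat3 := ((Real.sqrt (2 / 3) : ℝ) : ℂ) • E 7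

/-- The dominant weight `ω_(p,q) = p ϖ₁ + q ϖ₂`. -/
def domWeight (p q : ℕ) : Mat3 := (p : ℂ) • fundWeight₁ + (q : ℂ) • fundWeight₂

/-- The point `ξ_(x,y) = √(3/2) (x ϖ₁ + y ϖ₂)`. -/
def xiPt (x y : ℝ) : Mat3 :=
  ((Real.sqrt (3 / 2) : ℝ) : ℂ) • ((x : ℂ) • fundWeight₁ + (y : ℂ) • fundWeight₂)

/-- The open arc `F` of the unit sphere in the open principal Weyl chamber; it parametrizes the
regular orbits in the unit sphere. -/
def openArc : Set Mat3 :=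
  {ξ | ∃ x y : ℝ, 0 < x ∧ 0 < y ∧ x ^ 2 + x * y + y ^ 2 = 1 ∧ ξ = xiPt x y}

/-- The adjoint orbit `O_ξ` of `ξ` under `SU(3)`. -/
def orbit (ξ : Mat3) : Set Mat3 :=
  {Y | ∃ g : SU3, Y = (g : Mat3) * ξ * ((g⁻¹ : SU3) : Mat3)}

/-- The positive multiples of `ξ` that are dominant weights, through their factors. -/
def weightFactors (ξ : Mat3) : Set ℝ :=
  {R | 0 < R ∧ ∃ p q : ℕ, (R : ℂ) • ξ = domWeight p q}

/-- The set `Q` of the points `ξ` of the open arc whose orbit is rational, that is, a positive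
multiple of `ξ` is a dominant weight. -/
def ratArc : Set Mat3 := {ξ | ξ ∈ openArc ∧ (weightFactors ξ).Nonempty}

/-- The integral radius `r(ξ)`, the least `R > 0` such that `R ξ` is a dominant weight. -/
def intRadius (ξ : Mat3) : ℝ := sInf (weightFactors ξ)

open Classical in
/-- The labels `(p₁, q₁)` of the first dominant weight `ω_ξ = r(ξ) ξ = ω_(p₁,q₁)`. -/
def firstWeight (ξ : Mat3) : ℕ × ℕ :=
  if h : ∃ w : ℕ × ℕ, (intRadius ξ : ℂ) • ξ = domWeight w.1 w.2 then h.choose else 0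

/-! ### Quark systems: the irreducible representations of highest weight `ω_(p,q)` -/

/-- Polynomials in `x₁, x₂, x₃` (the variables `inl j`) and `y₁, y₂, y₃` (the variables `inr j`).
The `x_j` span the defining representation of `SU(3)`, the `y_j` its dual. -/
abbrev Pol : Type := MvPolynomial (Fin 3 ⊕ Fin 3) ℂ

/-- The action of `g ∈ SU(3)` on polynomials, by the algebra automorphism with
`g x_j = ∑ i, g_ij x_i` and `g y_j = ∑ i, conj g_ij y_i`. -/
def grpAct (g : SU3) : Pol →ₐ[ℂ] Pol :=
  aeval (Sum.elim (fun j => ∑ i, C ((g : Mat3) i j) * X (Sum.inl i))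
    (fun j => ∑ i, C (star ((g : Mat3) i j)) * X (Sum.inr i)))

/-- The action of a matrix `A` on polynomials, by the derivation with
`A x_j = ∑ i, A_ij x_i` and `A y_j = - ∑ i, A_ji y_i`. -/
def lieAct (A : Mat3) : Derivation ℂ Pol Pol :=
  mkDerivation ℂ (Sum.elim (fun j => ∑ i, C (A i j) * X (Sum.inl i))
    (fun j => -∑ i, C (A j i) * X (Sum.inr i)))

/-- The exponent of the monomial `x₁^p y₃^q`. -/
def hwExp (p q : ℕ) : (Fin 3 ⊕ Fin 3) →₀ ℕ :=
  Finsupp.single (Sum.inl 0) p + Finsupp.single (Sum.inr 2) q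

/-- The highest weight vector `x₁^p y₃^q`, of weight `ω_(p,q)`. -/
def hwPol (p q : ℕ) : Pol := monomial (hwExp p q) 1

/-- A space of polynomials is invariant if both `SU(3)` and `sl(3)` map it to itself. -/
def IsInvariant (N : Submodule ℂ Pol) : Prop :=
  (∀ g : SU3, ∀ v ∈ N, grpAct g v ∈ N) ∧ (∀ A : sl3, ∀ v ∈ N, lieAct (A : Mat3) v ∈ N)

/-- The quark system `H_(p,q)`: the subrepresentation generated by the highest weight vector
`x₁^p y₃^q`. It lies in the finite-dimensional space of polynomials of bidegree `(p, q)`, so it is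
the irreducible representation of highest weight `ω_(p,q)`. -/
def quarkSpace (p q : ℕ) : Submodule ℂ Pol :=
  sInf {N | hwPol p q ∈ N ∧ IsInvariant N}

lemma hwPol_mem (p q : ℕ) : hwPol p q ∈ quarkSpace p q := by
  simp only [quarkSpace, Submodule.mem_sInf]
  exact fun N hN => hN.1

lemma grpAct_mem (p q : ℕ) (g : SU3) : ∀ v ∈ quarkSpace p q, grpAct g v ∈ quarkSpace p q := by
  intro v hv
  simp only [quarkSpace, Submodule.mem_sInf] at hv ⊢
  exact fun N hN => hN.2.1 g v (hv N hN)

lemma lieAct_mem (p q : ℕ) (A : sl3) :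
    ∀ v ∈ quarkSpace p q, lieAct (A : Mat3) v ∈ quarkSpace p q := by
  intro v hv
  simp only [quarkSpace, Submodule.mem_sInf] at hv ⊢
  exact fun N hN => hN.2.2 A v (hv N hN)

lemma grpAct_one (v : Pol) : grpAct 1 v = v := by
  have h : grpAct 1 = AlgHom.id ℂ Pol := by
    apply MvPolynomial.algHom_ext
    rintro (j | j) <;>
      simp [grpAct, Matrix.one_apply, apply_ite (C : ℂ → Pol), apply_ite (star : ℂ → ℂ)]
  rw [h]; rfl

lemma grpAct_mul (g h : SU3) (v : Pol) : grpAct (g * h) v = grpAct g (grpAct h v) := by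
  have H : grpAct (g * h) = (grpAct g).comp (grpAct h) := by
    apply MvPolynomial.algHom_ext
    rintro (j | j)
    · simp only [grpAct, aeval_X, Sum.elim_inl, AlgHom.comp_apply, map_sum, map_mul,
        Submonoid.coe_mul, Matrix.mul_apply, Finset.sum_mul, Finset.mul_sum, algHom_C,
        algebraMap_eq]
      rw [Finset.sum_comm]
      refine Finset.sum_congr rfl fun k _ => Finset.sum_congr rfl fun i _ => ?_
      ring
    · simp only [grpAct, aeval_X, Sum.elim_inr, AlgHom.comp_apply, map_sum, map_mul, star_sum,
        star_mul', Submonoid.coe_mul, Matrix.mul_apply, Finset.sum_mul, Finset.mul_sum, algHom_C,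
        algebraMap_eq]
      rw [Finset.sum_comm]
      refine Finset.sum_congr rfl fun k _ => Finset.sum_congr rfl fun i _ => ?_
      ring
  rw [H]; rfl

lemma lieAct_inl (A : Mat3) (j : Fin 3) :
    lieAct A (X (Sum.inl j)) = ∑ i, C (A i j) * X (Sum.inl i) := by
  simp [lieAct, mkDerivation_X]

lemma lieAct_inr (A : Mat3) (j : Fin 3) :
    lieAct A (X (Sum.inr j)) = -∑ i, C (A j i) * X (Sum.inr i) := by
  simp [lieAct, mkDerivation_X]

lemma lieAct_add (A B : Mat3) : lieAct (A + B) = lieAct A + lieAct B := by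
  apply MvPolynomial.derivation_ext
  rintro (j | j)
  · simp only [Derivation.add_apply, lieAct_inl, Matrix.add_apply, map_add, add_mul,
      Finset.sum_add_distrib]
  · simp only [Derivation.add_apply, lieAct_inr, Matrix.add_apply, map_add, add_mul,
      Finset.sum_add_distrib, neg_add]

lemma lieAct_smul (c : ℂ) (A : Mat3) : lieAct (c • A) = c • lieAct A := by
  apply MvPolynomial.derivation_ext
  rintro (j | j) <;>
    simp [lieAct, mkDerivation_X, Finset.smul_sum, MvPolynomial.smul_eq_C_mul, mul_assoc]

lemma lieAct_C_mul (A : Mat3) (c : ℂ) (v : Pol) : lieAct A (C c * v) = C c * lieAct A v := by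
  rw [← MvPolynomial.smul_eq_C_mul, Derivation.map_smul, MvPolynomial.smul_eq_C_mul]

lemma lieAct_comm (A B : Mat3) :
    lieAct (A * B - B * A) = ⁅lieAct A, lieAct B⁆ := by
  apply MvPolynomial.derivation_ext
  rintro (j | j)
  · simp only [Derivation.commutator_apply, lieAct_inl, lieAct_C_mul, Matrix.sub_apply,
      Matrix.mul_apply, Fin.sum_univ_three, map_sub, map_add, map_mul]
    ring
  · simp only [Derivation.commutator_apply, lieAct_inr, map_neg, lieAct_C_mul,
      Matrix.sub_apply, Matrix.mul_apply, Fin.sum_univ_three, map_sub, map_add, map_mul]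
    ring

/-- The representation of `SU(3)` on `H_(p,q)`. -/
def grpRep (p q : ℕ) : Representation ℂ SU3 (quarkSpace p q) where
  toFun g := (grpAct g).toLinearMap.restrict (grpAct_mem p q g)
  map_one' := by ext v : 2; exact grpAct_one _
  map_mul' g h := by ext v : 2; exact grpAct_mul _ _ _

/-- The representation of the Lie algebra `sl(3)` on `H_(p,q)`. -/
def lieRep (p q : ℕ) : sl3 →ₗ⁅ℂ⁆ Module.End ℂ (quarkSpace p q) where
  toFun A := (lieAct (A : Mat3)).toLinearMap.restrict (lieAct_mem p q A)
  map_add' A B := by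
    ext v : 2
    exact congrArg (fun D : Derivation ℂ Pol Pol => D v) (lieAct_add A B)
  map_smul' c A := by
    ext v : 2
    exact congrArg (fun D : Derivation ℂ Pol Pol => D v) (lieAct_smul c A)
  map_lie' {A B} := by
    ext v : 2
    have h := congrArg (fun D : Derivation ℂ Pol Pol => D v) (lieAct_comm A B)
    simp only [Derivation.commutator_apply] at h
    exact h

/-- The irreducible representation `ρ_ω` of `U(sl(3))` on `H_(p,q)`. -/
def envRep (p q : ℕ) : Usl3 →ₐ[ℂ] Module.End ℂ (quarkSpace p q) :=
  UniversalEnvelopingAlgebra.lift ℂ (lieRep p q)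

/-- The highest weight vector as an element of `H_(p,q)`. -/
def hwVec (p q : ℕ) : quarkSpace p q := ⟨hwPol p q, hwPol_mem p q⟩

/-- The projection `Π_>` of `H_(p,q)` onto the highest weight line, along the other weight spaces.
Distinct monomials are orthogonal for the `SU(3)`-invariant inner product
`⟨z^a, z^b⟩ = a! δ_ab`, so it takes a polynomial to its `x₁^p y₃^q` term. -/
def hwProj (p q : ℕ) : Module.End ℂ (quarkSpace p q) :=
  ((MvPolynomial.lcoeff ℂ (hwExp p q)).comp (quarkSpace p q).subtype).smulRight (hwVec p q)

/-! The polynomials in `H_(p,q)` have bidegree `(p, q)`. -/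

/-- The bidegrees of the variables. -/
def biWt : Fin 3 ⊕ Fin 3 → ℕ × ℕ := Sum.elim (fun _ => (1, 0)) (fun _ => (0, 1))

lemma biWt_weight (d : (Fin 3 ⊕ Fin 3) →₀ ℕ) :
    Finsupp.weight biWt d = (∑ i, d (Sum.inl i), ∑ i, d (Sum.inr i)) := by
  simp [Finsupp.weight_apply, Finsupp.sum_fintype, biWt, Fin.sum_univ_three, Prod.ext_iff]

lemma grpAct_bihom (g : SU3) {n : ℕ × ℕ} {v : Pol} (hv : v.IsWeightedHomogeneous biWt n) :
    (grpAct g v).IsWeightedHomogeneous biWt n := by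
  have hX : ∀ i, (grpAct g (X i)).IsWeightedHomogeneous biWt (biWt i) := by
    rintro (j | j) <;> simp only [grpAct, aeval_X, Sum.elim_inl, Sum.elim_inr]
    · refine IsWeightedHomogeneous.sum _ _ _ fun i _ => ?_
      exact (isWeightedHomogeneous_X ℂ biWt (Sum.inl i)).C_mul _
    · refine IsWeightedHomogeneous.sum _ _ _ fun i _ => ?_
      exact (isWeightedHomogeneous_X ℂ biWt (Sum.inr i)).C_mul _
  induction hv using IsWeightedHomogeneous.induction_on with
  | zero => rw [map_zero]; exact isWeightedHomogeneous_zero ℂ biWt n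
  | add p q _ _ hp hq => rw [map_add]; exact hp.add hq
  | monomial d r hr =>
    have : grpAct g (monomial d r) = C r * ∏ i, grpAct g (X i) ^ d i := by
      rw [MvPolynomial.monomial_eq, map_mul, algHom_C, algebraMap_eq,
        Finsupp.prod_fintype _ _ (fun i => pow_zero _), map_prod]
      simp only [map_pow]
    rw [this]
    refine IsWeightedHomogeneous.C_mul ?_ _
    have h2 := IsWeightedHomogeneous.prod Finset.univ (fun i => grpAct g (X i) ^ d i)
      (fun i => d i • biWt i) (w := biWt) (fun i _ => (hX i).pow _)
    rwa [← Finsupp.weight_eq_sum, hr] at h2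

lemma lieAct_bihom (A : Mat3) {n : ℕ × ℕ} {v : Pol} (hv : v.IsWeightedHomogeneous biWt n) :
    (lieAct A v).IsWeightedHomogeneous biWt n := by
  have hX : ∀ i, (lieAct A (X i)).IsWeightedHomogeneous biWt (biWt i) := by
    rintro (j | j)
    · rw [lieAct_inl]
      refine IsWeightedHomogeneous.sum _ _ _ fun i _ => ?_
      exact (isWeightedHomogeneous_X ℂ biWt (Sum.inl i)).C_mul _
    · rw [lieAct_inr]
      refine (IsWeightedHomogeneous.sum _ _ _ fun i _ => ?_).neg
      exact (isWeightedHomogeneous_X ℂ biWt (Sum.inr i)).C_mul _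
  induction hv using IsWeightedHomogeneous.induction_on with
  | zero => rw [map_zero]; exact isWeightedHomogeneous_zero ℂ biWt n
  | add p q _ _ hp hq => rw [map_add]; exact hp.add hq
  | monomial d r hr =>
    rw [lieAct, mkDerivation_monomial, MvPolynomial.smul_eq_C_mul]
    refine IsWeightedHomogeneous.C_mul (IsWeightedHomogeneous.sum _ _ _ fun i hi => ?_) _
    have h1 := hX i
    rw [lieAct, mkDerivation_X] at h1
    have h2 := (isWeightedHomogeneous_monomial (R := ℂ) biWt (d - Finsupp.single i 1)
      ((d i : ℕ) : ℂ) rfl).mul h1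
    rwa [Finsupp.weight_sub_single_add (Finsupp.mem_support_iff.1 hi), hr] at h2

lemma hwExp_weight (p q : ℕ) : Finsupp.weight biWt (hwExp p q) = (p, q) := by
  rw [biWt_weight]
  simp [hwExp, Finsupp.single_apply]

lemma quarkSpace_le (p q : ℕ) :
    quarkSpace p q ≤ weightedHomogeneousSubmodule ℂ biWt (p, q) := by
  refine sInf_le ⟨?_, ?_, ?_⟩
  · exact isWeightedHomogeneous_monomial biWt _ _ (hwExp_weight p q)
  · exact fun g v hv => grpAct_bihom g hv
  · exact fun A v hv => lieAct_bihom _ hv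

instance quarkSpace_finite (p q : ℕ) : FiniteDimensional ℂ (quarkSpace p q) := by
  have h : quarkSpace p q ≤ restrictTotalDegree (Fin 3 ⊕ Fin 3) ℂ (p + q) := by
    intro v hv
    rw [mem_restrictTotalDegree, totalDegree]
    refine Finset.sup_le fun d hd => ?_
    have h1 := quarkSpace_le p q hv (mem_support_iff.1 hd)
    rw [biWt_weight, Prod.ext_iff] at h1
    simp only at h1
    rw [Finsupp.sum_fintype _ _ (fun _ => rfl), Fintype.sum_sum_type]
    omega
  exact Submodule.finiteDimensional_of_le h

/-! ### Diagonal form of the weights -/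

lemma fundWeight₁_eq :
    fundWeight₁ = Matrix.diagonal ![2 * Complex.I / 3, -Complex.I / 3, -Complex.I / 3] := by
  have h2 : ((Real.sqrt 2 : ℝ) : ℂ) * ((Real.sqrt 2 : ℝ) : ℂ) = 2 := by
    rw [← Complex.ofReal_mul, Real.mul_self_sqrt (by norm_num)]; norm_num
  have h3 : ((Real.sqrt 3 : ℝ) : ℂ) * ((Real.sqrt 3 : ℝ) : ℂ) = 3 := by
    rw [← Complex.ofReal_mul, Real.mul_self_sqrt (by norm_num)]; norm_num
  have h6 : ((Real.sqrt 6 : ℝ) : ℂ) = ((Real.sqrt 2 : ℝ) : ℂ) * ((Real.sqrt 3 : ℝ) : ℂ) := by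
    rw [← Complex.ofReal_mul, ← Real.sqrt_mul (by norm_num)]; norm_num
  have n2 : ((Real.sqrt 2 : ℝ) : ℂ) ≠ 0 := fun h => by simp [h] at h2
  have n3 : ((Real.sqrt 3 : ℝ) : ℂ) ≠ 0 := fun h => by simp [h] at h3
  have a : (1 / ((Real.sqrt 2 : ℝ) : ℂ)) * (Complex.I / ((Real.sqrt 2 : ℝ) : ℂ)) =
      Complex.I / 2 := by
    rw [div_mul_div_comm, h2, one_mul]
  have b : (1 / ((Real.sqrt 6 : ℝ) : ℂ)) * ((Complex.I / ((Real.sqrt 2 : ℝ) : ℂ)) *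
      (1 / ((Real.sqrt 3 : ℝ) : ℂ))) = Complex.I / 6 := by
    rw [h6, div_mul_div_comm, div_mul_div_comm]
    congr 1
    · ring
    · linear_combination (((Real.sqrt 3 : ℝ) : ℂ) ^ 2) * h2 + 2 * h3
  simp only [fundWeight₁, E, gellMann, smul_smul, Complex.ofReal_div, Complex.ofReal_one]
  ext i j
  fin_cases i <;> fin_cases j <;>
    simp [-one_div] <;>
    first
      | linear_combination a + b
      | linear_combination -a + b
      | linear_combination -2 * b

lemma fundWeight₂_eq :
    fundWeight₂ = Matrix.diagonal ![Complex.I / 3, Complex.I / 3, -2 * Complex.I / 3] := by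
  have h2 : ((Real.sqrt 2 : ℝ) : ℂ) * ((Real.sqrt 2 : ℝ) : ℂ) = 2 := by
    rw [← Complex.ofReal_mul, Real.mul_self_sqrt (by norm_num)]; norm_num
  have h3 : ((Real.sqrt 3 : ℝ) : ℂ) * ((Real.sqrt 3 : ℝ) : ℂ) = 3 := by
    rw [← Complex.ofReal_mul, Real.mul_self_sqrt (by norm_num)]; norm_num
  have n2 : ((Real.sqrt 2 : ℝ) : ℂ) ≠ 0 := fun h => by simp [h] at h2
  have n3 : ((Real.sqrt 3 : ℝ) : ℂ) ≠ 0 := fun h => by simp [h] at h3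
  have b : (((Real.sqrt 2 : ℝ) : ℂ) / ((Real.sqrt 3 : ℝ) : ℂ)) *
      ((Complex.I / ((Real.sqrt 2 : ℝ) : ℂ)) * (1 / ((Real.sqrt 3 : ℝ) : ℂ))) =
      Complex.I / 3 := by
    rw [← h3]
    field_simp
  rw [fundWeight₂, Real.sqrt_div (by norm_num), Complex.ofReal_div]
  simp only [E, gellMann, Complex.ofReal_div, Complex.ofReal_one]
  ext i j
  fin_cases i <;> fin_cases j <;>
    simp [-one_div] <;>
    first
      | linear_combination b
      | linear_combination -2 * b

lemma domWeight_eq (p q : ℕ) :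
    domWeight p q = Matrix.diagonal ![(2 * p + q) * Complex.I / 3, (q - p) * Complex.I / 3,
      -(p + 2 * q) * Complex.I / 3] := by
  rw [domWeight, fundWeight₁_eq, fundWeight₂_eq]
  ext i j
  fin_cases i <;> fin_cases j <;> simp <;> ring

lemma exists_isLeast_weightFactors {ξ : Mat3} (hξ : ξ ∈ ratArc) :
    ∃ R, IsLeast (weightFactors ξ) R := by
  obtain ⟨⟨x, y, hx, hy, -, rfl⟩, hne⟩ := hξ
  set t : ℝ := Real.sqrt (3 / 2) * (x + y) with ht
  have ht0 : 0 < t := mul_pos (Real.sqrt_pos.2 (by norm_num)) (add_pos hx hy)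
  have key : ∀ R ∈ weightFactors (xiPt x y), ∃ n : ℕ, R = n / t := by
    rintro R ⟨-, p, q, h⟩
    refine ⟨p + q, ?_⟩
    have h0 := congrFun (congrFun h 0) 0
    have h2 := congrFun (congrFun h 2) 2
    rw [domWeight_eq] at h0 h2
    simp only [xiPt, fundWeight₁_eq, fundWeight₂_eq, Matrix.smul_apply, Matrix.add_apply,
      Matrix.diagonal_apply_eq, smul_eq_mul] at h0 h2
    simp at h0 h2
    have h3 : ((R * t : ℝ) : ℂ) = ((p + q : ℕ) : ℝ) := by
      have : (((R * t : ℝ) : ℂ) - (((p + q : ℕ) : ℝ) : ℂ)) * Complex.I = 0 := by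
        rw [ht, Real.sqrt_div (by norm_num)]; push_cast
        linear_combination h0 - h2
      have := (mul_eq_zero.1 this).resolve_right Complex.I_ne_zero
      exact sub_eq_zero.1 this
    rw [eq_div_iff ht0.ne']
    exact_mod_cast h3
  have hex : ∃ n : ℕ, (n : ℝ) / t ∈ weightFactors (xiPt x y) := by
    obtain ⟨R, hR⟩ := hne
    obtain ⟨n, rfl⟩ := key R hR
    exact ⟨n, hR⟩
  classical
  refine ⟨(Nat.find hex : ℝ) / t, Nat.find_spec hex, fun R hR => ?_⟩
  obtain ⟨n, rfl⟩ := key R hR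
  have := Nat.find_min' hex hR
  gcongr

/-- The minimum that defines the integral radius is attained. -/
lemma isLeast_intRadius {ξ : Mat3} (hξ : ξ ∈ ratArc) :
    IsLeast (weightFactors ξ) (intRadius ξ) := by
  obtain ⟨R, hR⟩ := exists_isLeast_weightFactors hξ
  rw [intRadius, hR.csInf_eq]
  exact hR

lemma firstWeight_spec {ξ : Mat3} (hξ : ξ ∈ ratArc) :
    (intRadius ξ : ℂ) • ξ = domWeight (firstWeight ξ).1 (firstWeight ξ).2 := by
  have h : ∃ w : ℕ × ℕ, (intRadius ξ : ℂ) • ξ = domWeight w.1 w.2 := by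
    obtain ⟨-, p, q, h⟩ := (isLeast_intRadius hξ).1
    exact ⟨(p, q), h⟩
  rw [firstWeight, dif_pos h]
  exact h.choose_spec

/-! ### Berezin symbols -/

/-- `Π_>^g = g Π_> g⁻¹`. -/
def hwProjConj (p q : ℕ) (g : SU3) : Module.End ℂ (quarkSpace p q) :=
  grpRep p q g * hwProj p q * grpRep p q g⁻¹

/-- The Berezin symbol on the orbit `O_ξ` of an operator `A` on `H_(p,q)`, where `ω_(p,q)` is a
positive multiple of `ξ`: its value at `g ξ g⁻¹` is `tr (A Π_>^g)`, which does not depend on the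
choice of `g`, see `berezinSymbol_apply`. -/
def berezinSymbol (p q : ℕ) (ξ : Mat3) (A : Module.End ℂ (quarkSpace p q)) (Y : orbit ξ) : ℂ :=
  LinearMap.trace ℂ (quarkSpace p q) (A * hwProjConj p q Y.2.choose)

lemma eval_of_bihom {p q : ℕ} (z : Fin 3 ⊕ Fin 3 → ℂ)
    (hp : 0 < p → ∀ j, j ≠ 0 → z (Sum.inl j) = 0)
    (hq : 0 < q → ∀ j, j ≠ 2 → z (Sum.inr j) = 0)
    {v : Pol} (hv : v.IsWeightedHomogeneous biWt (p, q)) :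
    eval z v = z (Sum.inl 0) ^ p * z (Sum.inr 2) ^ q * coeff (hwExp p q) v := by
  induction hv using IsWeightedHomogeneous.induction_on with
  | zero => simp
  | add v w _ _ hv hw => rw [map_add, coeff_add, hv, hw]; ring
  | monomial d r hr =>
    rw [eval_monomial, coeff_monomial, Finsupp.prod_fintype _ _ (fun i => pow_zero _),
      Fintype.prod_sum_type, Fin.prod_univ_three, Fin.prod_univ_three]
    rw [biWt_weight, Prod.ext_iff] at hr
    simp only [Fin.sum_univ_three] at hr
    by_cases hd : d = hwExp p q
    · subst hd
      simp [hwExp]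
      ring
    · rw [if_neg hd, mul_zero]
      have hj : d (Sum.inl 1) ≠ 0 ∨ d (Sum.inl 2) ≠ 0 ∨ d (Sum.inr 0) ≠ 0 ∨
          d (Sum.inr 1) ≠ 0 := by
        by_contra hcon
        push Not at hcon
        apply hd
        ext (i | i) <;> fin_cases i <;> simp [hwExp] <;> omega
      rcases hj with h | h | h | h
      · rw [hp (by omega) 1 (by decide), zero_pow h]; ring
      · rw [hp (by omega) 2 (by decide), zero_pow h]; ring
      · rw [hq (by omega) 0 (by decide), zero_pow h]; ring
      · rw [hq (by omega) 1 (by decide), zero_pow h]; ring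

lemma coeff_hw_of_stab {p q : ℕ} (h : SU3)
    (hp : 0 < p → ∀ j, j ≠ 0 → (h : Mat3) 0 j = 0)
    (hq : 0 < q → ∀ j, j ≠ 2 → (h : Mat3) 2 j = 0)
    {v : Pol} (hv : v.IsWeightedHomogeneous biWt (p, q)) :
    coeff (hwExp p q) (grpAct h v) =
      ((h : Mat3) 0 0) ^ p * (star ((h : Mat3) 2 2)) ^ q * coeff (hwExp p q) v := by
  set z : Fin 3 ⊕ Fin 3 → ℂ := Sum.elim (Pi.single 0 1) (Pi.single 2 1) with hz
  have h1 := eval_of_bihom z (by intro _ j hj; simp [hz, hj]) (by intro _ j hj; simp [hz, hj])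
    (grpAct_bihom h hv)
  have h2 : eval z (grpAct h v) =
      eval (Sum.elim (fun j => (h : Mat3) 0 j) (fun j => star ((h : Mat3) 2 j))) v := by
    have : (aeval z : Pol →ₐ[ℂ] ℂ).comp (grpAct h) =
        aeval (Sum.elim (fun j => (h : Mat3) 0 j) (fun j => star ((h : Mat3) 2 j))) := by
      apply MvPolynomial.algHom_ext
      rintro (j | j) <;> simp [grpAct, hz, Pi.single_apply]
    have := congrArg (fun f : Pol →ₐ[ℂ] ℂ => f v) this
    rw [AlgHom.comp_apply] at this
    exact this
  have h3 := eval_of_bihom (Sum.elim (fun j => (h : Mat3) 0 j) (fun j => star ((h : Mat3) 2 j)))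
    (by simpa using hp) (by intro h0 j hj; simp [hq h0 j hj]) hv
  rw [h2, h3] at h1
  simpa [hz] using h1.symm

lemma grpAct_hwPol_of_stab {p q : ℕ} (h : SU3)
    (hp : 0 < p → ∀ i, i ≠ 0 → (h : Mat3) i 0 = 0)
    (hq : 0 < q → ∀ i, i ≠ 2 → (h : Mat3) i 2 = 0) :
    grpAct h (hwPol p q) = (((h : Mat3) 0 0) ^ p * (star ((h : Mat3) 2 2)) ^ q) • hwPol p q := by
  have e : ∀ p q : ℕ, hwPol p q = (X (Sum.inl 0)) ^ p * (X (Sum.inr 2)) ^ q := by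
    intro p q
    rw [hwPol, hwExp, X_pow_eq_monomial, X_pow_eq_monomial, monomial_mul, one_mul]
  rw [e, map_mul, map_pow, map_pow, MvPolynomial.smul_eq_C_mul, map_mul, map_pow, map_pow]
  have a : (grpAct h (X (Sum.inl 0))) ^ p = (C ((h : Mat3) 0 0) * X (Sum.inl 0)) ^ p := by
    rcases Nat.eq_zero_or_pos p with rfl | h0
    · simp
    · rw [grpAct, aeval_X, Sum.elim_inl, Fin.sum_univ_three, hp h0 1 (by decide),
        hp h0 2 (by decide)]
      simp
  have b : (grpAct h (X (Sum.inr 2))) ^ q =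
      (C (star ((h : Mat3) 2 2)) * X (Sum.inr 2)) ^ q := by
    rcases Nat.eq_zero_or_pos q with rfl | h0
    · simp
    · rw [grpAct, aeval_X, Sum.elim_inr, Fin.sum_univ_three, hq h0 0 (by decide),
        hq h0 1 (by decide)]
      simp
  rw [a, b, mul_pow, mul_pow]
  ring

lemma stab_entries {p q : ℕ} {h : Mat3} (hc : h * domWeight p q = domWeight p q * h) :
    ((0 < p → ∀ i, i ≠ 0 → h i 0 = 0 ∧ h 0 i = 0) ∧
      (0 < q → ∀ i, i ≠ 2 → h i 2 = 0 ∧ h 2 i = 0)) := by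
  have I0 := Complex.I_ne_zero
  have key : ∀ i j, h i j * (domWeight p q j j - domWeight p q i i) = 0 := by
    intro i j
    have := congrFun (congrFun hc i) j
    rw [domWeight_eq, Matrix.mul_diagonal, Matrix.diagonal_mul] at this
    rw [domWeight_eq, Matrix.diagonal_apply_eq, Matrix.diagonal_apply_eq]
    linear_combination this
  have d01 : domWeight p q 0 0 - domWeight p q 1 1 = p * Complex.I := by
    rw [domWeight_eq]; simp; ring
  have d02 : domWeight p q 0 0 - domWeight p q 2 2 = ((p + q : ℕ) : ℂ) * Complex.I := by
    rw [domWeight_eq]; simp; ring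
  have d12 : domWeight p q 1 1 - domWeight p q 2 2 = q * Complex.I := by
    rw [domWeight_eq]; simp; ring
  have z : ∀ i j, domWeight p q i i - domWeight p q j j ≠ 0 → h i j = 0 ∧ h j i = 0 := by
    intro i j hij
    refine ⟨(mul_eq_zero.1 (key i j)).resolve_right fun h0 => hij ?_,
      (mul_eq_zero.1 (key j i)).resolve_right hij⟩
    linear_combination -h0
  have c02 : 0 < p + q → h 0 2 = 0 ∧ h 2 0 = 0 := fun h0 => z 0 2 (by
    rw [d02]; exact mul_ne_zero (Nat.cast_ne_zero.2 (by omega)) I0)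
  refine ⟨fun h0 i hi => ?_, fun h0 i hi => ?_⟩
  · have c01 := z 0 1 (by rw [d01]; exact mul_ne_zero (Nat.cast_ne_zero.2 (by omega)) I0)
    fin_cases i
    · exact absurd rfl hi
    · exact ⟨c01.2, c01.1⟩
    · exact ⟨(c02 (by omega)).2, (c02 (by omega)).1⟩
  · have c12 := z 1 2 (by rw [d12]; exact mul_ne_zero (Nat.cast_ne_zero.2 (by omega)) I0)
    fin_cases i
    · exact c02 (by omega)
    · exact c12
    · exact absurd rfl hi

lemma hwProj_comm {p q : ℕ} (h : SU3)
    (hc : (h : Mat3) * domWeight p q = domWeight p q * (h : Mat3)) :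
    grpRep p q h * hwProj p q = hwProj p q * grpRep p q h := by
  obtain ⟨hp, hq⟩ := stab_entries hc
  ext v : 2
  change grpAct h (coeff (hwExp p q) (v : Pol) • hwPol p q) =
    coeff (hwExp p q) (grpAct h (v : Pol)) • hwPol p q
  rw [map_smul, grpAct_hwPol_of_stab h (fun h0 i hi => (hp h0 i hi).1)
    (fun h0 i hi => (hq h0 i hi).1), coeff_hw_of_stab h (fun h0 i hi => (hp h0 i hi).2)
    (fun h0 i hi => (hq h0 i hi).2) (quarkSpace_le p q v.2), smul_smul, mul_comm]

lemma conj_mem_orbit (ξ : Mat3) (g : SU3) :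
    (g : Mat3) * ξ * ((g⁻¹ : SU3) : Mat3) ∈ orbit ξ := ⟨g, rfl⟩

/-- `B_A (g ξ g⁻¹) = tr (A Π_>^g)` for every `g ∈ SU(3)`. -/
lemma berezinSymbol_apply {p q : ℕ} {ξ : Mat3} {R : ℝ} (hR : (R : ℂ) • ξ = domWeight p q)
    (A : Module.End ℂ (quarkSpace p q)) (g : SU3) :
    berezinSymbol p q ξ A ⟨_, conj_mem_orbit ξ g⟩ =
      LinearMap.trace ℂ (quarkSpace p q) (A * hwProjConj p q g) := by
  suffices H : ∀ k : SU3, (g : Mat3) * ξ * ((g⁻¹ : SU3) : Mat3) =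
      (k : Mat3) * ξ * ((k⁻¹ : SU3) : Mat3) → hwProjConj p q k = hwProjConj p q g by
    rw [berezinSymbol, H _ (conj_mem_orbit ξ g).choose_spec]
  intro k hg
  have inv1 : ∀ a : SU3, (a : Mat3) * ((a⁻¹ : SU3) : Mat3) = 1 := fun a => by
    rw [← Submonoid.coe_mul, mul_inv_cancel, Submonoid.coe_one]
  have inv2 : ∀ a : SU3, ((a⁻¹ : SU3) : Mat3) * (a : Mat3) = 1 := fun a => by
    rw [← Submonoid.coe_mul, inv_mul_cancel, Submonoid.coe_one]
  have hst : ((g⁻¹ * k : SU3) : Mat3) * ξ = ξ * ((g⁻¹ * k : SU3) : Mat3) := by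
    have h1 := congrArg (fun M => ((g⁻¹ : SU3) : Mat3) * M * (k : Mat3)) hg
    simp only [Matrix.mul_assoc, inv2, Matrix.mul_one] at h1
    rw [← Matrix.mul_assoc, inv2, Matrix.one_mul] at h1
    rw [Submonoid.coe_mul, h1, Matrix.mul_assoc]
  have hcomm := hwProj_comm (p := p) (q := q) (g⁻¹ * k) (by
    rw [← hR, Matrix.mul_smul, Matrix.smul_mul, hst])
  have hkg : k = g * (g⁻¹ * k) := by group
  rw [hkg]
  generalize g⁻¹ * k = h at hcomm
  rw [hwProjConj, hwProjConj, mul_inv_rev, map_mul, map_mul]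
  calc grpRep p q g * grpRep p q h * hwProj p q * (grpRep p q h⁻¹ * grpRep p q g⁻¹)
      = grpRep p q g * (grpRep p q h * hwProj p q) * grpRep p q h⁻¹ * grpRep p q g⁻¹ := by
        simp only [mul_assoc]
    _ = grpRep p q g * hwProj p q * (grpRep p q h * grpRep p q h⁻¹) * grpRep p q g⁻¹ := by
        rw [hcomm]; simp only [mul_assoc]
    _ = grpRep p q g * hwProj p q * grpRep p q g⁻¹ := by
        rw [← map_mul, mul_inv_cancel, map_one, mul_one]

/-! ### Berezin rays, their twisted products, and norms -/

/-- The `s`-th universal Berezin correspondence `b^s_ξ` of the ray of the rational point `ξ`: the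
Berezin symbol of the action of `u` on the quark system of highest weight `s ω_ξ`. -/
def berezinRay (s : ℕ) (ξ : Mat3) (u : Usl3) : orbit ξ → ℂ :=
  berezinSymbol (s * (firstWeight ξ).1) (s * (firstWeight ξ).2) ξ (envRep _ _ u)

open Classical in
/-- The twisted product `⋆^s_ξ` on the image of `b^s_ξ`, given by `b[u] ⋆ b[v] = b[u v]`; it is set
to `0` outside of the image. -/
def berezinStar (s : ℕ) (ξ : Mat3) (f g : orbit ξ → ℂ) : orbit ξ → ℂ :=
  if h : (∃ u, berezinRay s ξ u = f) ∧ (∃ v, berezinRay s ξ v = g) then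
    berezinRay s ξ (h.1.choose * h.2.choose) else 0

/-- The restriction of a polynomial to the orbit `O_ξ`. -/
def restr (F : PolySU3) (ξ : Mat3) (Y : orbit ξ) : ℂ := evalAt F Y

/-- The supremum norm `‖f‖_ξ` of a function on `O_ξ`, as an extended real. -/
def supNorm {ξ : Mat3} (f : orbit ξ → ℂ) : ENNReal := ⨆ Y, ‖f Y‖ₑ

end

end QuarkSU3

open QuarkSU3

namespace QuarkSU3

open MvPolynomial

noncomputable section

/-! ### The Fischer inner product on polynomials -/

/-! The representation of highest weight `(p, q)` sits inside the polynomials of bidegree `(p, q)`.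
For the Fischer inner product, multiplication by a variable is adjoint to the corresponding
derivative. Hence `SU(3)` acts unitarily (`inner_grpAct_grpAct`), opposite root vectors are adjoint
to each other (`inner_rootOp`), and the Berezin symbol is the expectation value in the coherent
state `g e`, where `e = x₁^p y₃^q` (`trace_hwProjConj`).

Two facts turn the twisted product into operator multiplication. An operator is determined by its
symbol (`symbolKer_eq_bot`), so the product is well defined. The enveloping algebra acts by all
operators (`envRep_surjective`), so a function lies in the image of the Berezin correspondence as
soon as it is the symbol of some operator.

Operators with prescribed symbols are built from normalized Wick ordered monomials: variables on the
left, derivatives on the right, divided by the falling factorials of `p` and `q`. A derivative maps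
a coherent state to a multiple of the coherent state of lower degree, with an entry of `g` as a
factor. The symbol of such a monomial is therefore exactly a product of entries of `g` and their
conjugates once the degrees are large, and its norm is at most one (`BoundedBy.wick`). Put `T = s
r(ξ)`. For a noncommutative lift `w` of a polynomial `F`, combinations with coefficients in `p / T`
and `q / T` give an operator `Scaling.op` whose symbol is exactly `F` on the orbit
(`Scaling.eventually_opSymbol_op`, `coord_conj`).

Compare this with the representation in which `x_j` acts by `E_j / (i T)`. It differs from
`Scaling.op` by `T⁻¹` times a bounded combination of Wick ordered operators
(`Scaling.exists_rep_eq`). The representation is multiplicative, so products of `Scaling.op` agree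
with the operator of the product up to `O(1 / T)`. For commutators, `T [rep v, rep w]` is exactly
`rep u` for a lift `u` of `i {F, G}` (`exists_isBracket`). The corrections enter through `T [rep v,
R]`, with `R` Wick ordered. This stays bounded because commuting a Lie algebra element with a Wick
ordered operator changes indices of letters but adds no letter (`Nice.lieComm_wick`,
`Scaling.bounded_commutator`). The commutator error is again `O(1 / T)`.

Symbols are bounded by operator norms (`norm_opSymbol_le`). The constants depend only on the lifts:
for all rational points `p` and `q` are at least `s`, the ratios `p / T` and `q / T` are at most 2,
and `1 / T ≤ 2 / s`. This makes both limits uniform. -/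

/-- The squared Fischer norm `m!` of the monomial with exponent `m`. -/
def multiFactorial (m : (Fin 3 ⊕ Fin 3) →₀ ℕ) : ℂ := ∏ i, ((m i).factorial : ℂ)

/-- The Fischer inner product, for which `⟨z^a, z^b⟩ = a! δ_ab`. -/
def fischer (v w : Pol) : ℂ := ∑ m ∈ v.support, multiFactorial m * (star (coeff m v) * coeff m w)

lemma fischer_eq_sum {v w : Pol} {s : Finset ((Fin 3 ⊕ Fin 3) →₀ ℕ)} (h : v.support ⊆ s) :
    fischer v w = ∑ m ∈ s, multiFactorial m * (star (coeff m v) * coeff m w) :=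
  Finset.sum_subset h fun m _ hm => by simp [notMem_support_iff.1 hm]

lemma star_multiFactorial (m : (Fin 3 ⊕ Fin 3) →₀ ℕ) :
    star (multiFactorial m) = multiFactorial m := by
  simp [multiFactorial]

lemma fischer_self (v : Pol) : fischer v v =
    ((∑ m ∈ v.support, (∏ i, ((m i).factorial : ℝ)) * ‖coeff m v‖ ^ 2 : ℝ) : ℂ) := by
  rw [fischer]
  push_cast
  refine Finset.sum_congr rfl fun m _ => ?_
  rw [multiFactorial, ← Complex.conj_mul']
  rfl

/-- The Fischer inner product as an inner product space core. -/
@[reducible]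
def fischerCore : InnerProductSpace.Core ℂ Pol where
  inner := fischer
  conj_inner_symm v w := by
    change star (fischer w v) = fischer v w
    classical
    rw [fischer_eq_sum (Finset.subset_union_left (s₂ := v.support)),
      fischer_eq_sum (Finset.subset_union_right (s₁ := w.support)), star_sum]
    refine Finset.sum_congr rfl fun m _ => ?_
    rw [star_mul', star_mul', star_star, star_multiFactorial]
    ring
  re_inner_nonneg v := by
    change 0 ≤ (fischer v v).re
    rw [fischer_self, Complex.ofReal_re]
    positivity
  add_left u v w := by
    change fischer (u + v) w = fischer u w + fischer v w
    classical
    rw [fischer_eq_sum (support_add (p := u) (q := v)),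
      fischer_eq_sum (Finset.subset_union_left (s₂ := v.support)),
      fischer_eq_sum (Finset.subset_union_right (s₁ := u.support)), ← Finset.sum_add_distrib]
    refine Finset.sum_congr rfl fun m _ => ?_
    rw [coeff_add, star_add]
    ring
  smul_left v w c := by
    change fischer (c • v) w = star c * fischer v w
    rw [fischer_eq_sum (support_smul (f := v) (a := c)), fischer, Finset.mul_sum]
    refine Finset.sum_congr rfl fun m _ => ?_
    rw [coeff_smul, smul_eq_mul, star_mul']
    ring
  definite v h := by
    change fischer v v = 0 at h
    rw [fischer_self, Complex.ofReal_eq_zero, Finset.sum_eq_zero_iff_of_nonneg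
      (fun m _ => by positivity)] at h
    ext m
    by_contra hm
    have h1 := h m (mem_support_iff.2 hm)
    have h2 : (∏ i, ((m i).factorial : ℝ)) ≠ 0 :=
      Finset.prod_ne_zero_iff.2 fun i _ => Nat.cast_ne_zero.2 (Nat.factorial_ne_zero _)
    have h3 := (mul_eq_zero.1 h1).resolve_left h2
    exact hm (norm_eq_zero.1 (pow_eq_zero_iff two_ne_zero |>.1 h3))

/-- The group and module structures are the given ones of the polynomial ring; only norm, metric and
inner product are taken from the core. -/
instance fischerNormedAddCommGroup : NormedAddCommGroup Pol where
  toNorm := fischerCore.toNormedAddCommGroup.toNorm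
  toAddCommGroup := AddMonoidAlgebra.addCommGroup
  toMetricSpace := fischerCore.toNormedAddCommGroup.toMetricSpace
  dist_eq := fischerCore.toNormedAddCommGroup.dist_eq

instance fischerNormedSpace : NormedSpace ℂ Pol where
  toModule := instModuleSelf
  norm_smul_le := (InnerProductSpace.ofCore fischerCore.toCore).norm_smul_le

instance fischerUniformSpace : UniformSpace Pol :=
  fischerNormedAddCommGroup.toMetricSpace.toPseudoMetricSpace.toUniformSpace

instance fischerTopologicalSpace : TopologicalSpace Pol :=
  fischerUniformSpace.toTopologicalSpace

instance fischerInnerProductSpace : InnerProductSpace ℂ Pol where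
  inner := fischer
  norm_sq_eq_re_inner := (InnerProductSpace.ofCore fischerCore.toCore).norm_sq_eq_re_inner
  conj_inner_symm := fischerCore.conj_inner_symm
  add_left := fischerCore.add_left
  smul_left := fischerCore.smul_left

instance fischerInner : Inner ℂ Pol := fischerInnerProductSpace.toInner

instance fischerInnerSubmodule (S : Submodule ℂ Pol) : Inner ℂ S :=
  S.innerProductSpace.toInner

lemma inner_def (v w : Pol) : inner ℂ v w = fischer v w := rfl

lemma inner_monomial_left (m : (Fin 3 ⊕ Fin 3) →₀ ℕ) (w : Pol) :
    inner ℂ (monomial m (1 : ℂ) : Pol) w = multiFactorial m * coeff m w := by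
  rw [inner_def, fischer_eq_sum (support_monomial_subset)]
  simp

lemma multiFactorial_add_single (m : (Fin 3 ⊕ Fin 3) →₀ ℕ) (i : Fin 3 ⊕ Fin 3) :
    multiFactorial (m + Finsupp.single i 1) = ((m i : ℂ) + 1) * multiFactorial m := by
  classical
  rw [multiFactorial, multiFactorial, ← Finset.mul_prod_erase _ _ (Finset.mem_univ i),
    ← Finset.mul_prod_erase _ (fun j => ((m j).factorial : ℂ)) (Finset.mem_univ i)]
  have : ∀ j ∈ Finset.univ.erase i, (((m + Finsupp.single i 1 : (Fin 3 ⊕ Fin 3) →₀ ℕ) j).factorial : ℂ) =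
      ((m j).factorial : ℂ) := by
    intro j hj
    rw [Finsupp.add_apply, Finsupp.single_eq_of_ne (Finset.ne_of_mem_erase hj), add_zero]
  rw [Finset.prod_congr rfl this, Finsupp.add_apply, Finsupp.single_eq_same, Nat.factorial_succ]
  push_cast
  ring

/-- Induction for statements that are conjugate linear in a polynomial. -/
lemma pol_induction {P : Pol → Prop} (hm : ∀ m, P (monomial m 1))
    (ha : ∀ v w, P v → P w → P (v + w)) (hs : ∀ (c : ℂ) v, P v → P (c • v)) (v : Pol) : P v := by
  induction v using MvPolynomial.induction_on' with
  | monomial m a => simpa [smul_monomial] using hs a _ (hm m)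
  | add v w hv hw => exact ha v w hv hw

/-- Multiplication by a variable is adjoint to the partial derivative. -/
lemma inner_X_mul (i : Fin 3 ⊕ Fin 3) (v w : Pol) :
    inner ℂ (X i * v) w = inner ℂ v (pderiv i w) := by
  induction v using pol_induction with
  | hm m =>
    have : (X i * monomial m 1 : Pol) = monomial (m + Finsupp.single i 1) 1 := by
      rw [X, monomial_mul, one_mul, add_comm]
    rw [this, inner_monomial_left, inner_monomial_left, coeff_pderiv, multiFactorial_add_single]
    ring
  | ha v w hv hw => rw [mul_add, inner_add_left, inner_add_left, hv, hw]
  | hs c v hv => rw [mul_smul_comm, inner_smul_left, inner_smul_left, hv]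

lemma inner_pderiv (i : Fin 3 ⊕ Fin 3) (v w : Pol) :
    inner ℂ (pderiv i v) w = inner ℂ v (X i * w) := by
  rw [← inner_conj_symm, ← inner_X_mul, inner_conj_symm]

/-! ### The group and the Lie algebra act by unitary and adjoint operators -/

lemma lieAct_apply (A : Mat3) (v : Pol) :
    lieAct A v = (∑ i, ∑ j, A i j • (X (Sum.inl i) * pderiv (Sum.inl j) v)) -
      ∑ i, ∑ j, A i j • (X (Sum.inr j) * pderiv (Sum.inr i) v) := by
  have h : lieAct A = (∑ i, ∑ j, A i j • ((X (Sum.inl i) : Pol) • pderiv (R := ℂ) (Sum.inl j))) -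
      ∑ i, ∑ j, A i j • ((X (Sum.inr j) : Pol) • pderiv (R := ℂ) (Sum.inr i)) := by
    apply MvPolynomial.derivation_ext
    rintro (k | k)
    · fin_cases k <;> simp [lieAct_inl, Fin.sum_univ_three, pderiv_X,
        MvPolynomial.smul_eq_C_mul]
    · fin_cases k <;> simp [lieAct_inr, Fin.sum_univ_three, pderiv_X,
        MvPolynomial.smul_eq_C_mul]
  rw [h]
  simp [Fin.sum_univ_three]

/-- The adjoint of `z_a ∂_b` is `z_b ∂_a`, so taking adjoints transposes the indices and conjugates
the coefficients. -/
lemma inner_lieAct (A : Mat3) (v w : Pol) :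
    inner ℂ (lieAct A v) w = inner ℂ v (lieAct A.conjTranspose w) := by
  have h : ∀ (a b : Fin 3 ⊕ Fin 3), inner ℂ (X a * pderiv b v) w =
      inner ℂ v (X b * pderiv a w) := fun a b => by rw [inner_X_mul, inner_pderiv]
  rw [lieAct_apply, lieAct_apply, inner_sub_left, inner_sub_right]
  simp only [sum_inner, inner_sum, inner_smul_left, inner_smul_right, h]
  congr 1 <;> rw [Finset.sum_comm] <;>
    exact Finset.sum_congr rfl fun i _ => Finset.sum_congr rfl fun j _ => by
      simp [Matrix.conjTranspose_apply]

lemma pderiv_grpAct_inl (g : SU3) (k : Fin 3) (v : Pol) :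
    pderiv (Sum.inl k) (grpAct g v) = ∑ i, (g : Mat3) k i • grpAct g (pderiv (Sum.inl i) v) := by
  induction v using MvPolynomial.induction_on with
  | C a => simp
  | add v w hv hw => simp only [map_add, hv, hw, smul_add, Finset.sum_add_distrib]
  | mul_X v j hv =>
    rw [map_mul, pderiv_mul, hv]
    rcases j with j | j
    · simp only [pderiv_mul, map_add, map_mul, smul_add, Finset.sum_add_distrib, Finset.sum_mul,
        smul_mul_assoc]
      congr 1
      simp [grpAct, pderiv_X, Pi.single_apply, MvPolynomial.smul_eq_C_mul, mul_comm]
    · simp only [pderiv_mul, map_add, map_mul, smul_add, Finset.sum_add_distrib, Finset.sum_mul,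
        smul_mul_assoc]
      congr 1
      simp [grpAct, pderiv_X]

lemma pderiv_grpAct_inr (g : SU3) (k : Fin 3) (v : Pol) :
    pderiv (Sum.inr k) (grpAct g v) =
      ∑ i, star ((g : Mat3) k i) • grpAct g (pderiv (Sum.inr i) v) := by
  induction v using MvPolynomial.induction_on with
  | C a => simp
  | add v w hv hw => simp only [map_add, hv, hw, smul_add, Finset.sum_add_distrib]
  | mul_X v j hv =>
    rw [map_mul, pderiv_mul, hv]
    rcases j with j | j
    · simp only [pderiv_mul, map_add, map_mul, smul_add, Finset.sum_add_distrib, Finset.sum_mul,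
        smul_mul_assoc]
      congr 1
      simp [grpAct, pderiv_X]
    · simp only [pderiv_mul, map_add, map_mul, smul_add, Finset.sum_add_distrib, Finset.sum_mul,
        smul_mul_assoc]
      congr 1
      simp [grpAct, pderiv_X, Pi.single_apply, MvPolynomial.smul_eq_C_mul, mul_comm]

lemma star_mul_self_apply (g : SU3) (i j : Fin 3) :
    ∑ k, star ((g : Mat3) k i) * (g : Mat3) k j = if i = j then 1 else 0 := by
  have h := Matrix.mem_unitaryGroup_iff'.1 g.2.1
  have := congrFun (congrFun h i) j
  rw [Matrix.mul_apply, Matrix.one_apply] at this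
  simpa [Matrix.star_apply] using this

/-- Induction on the left argument: a variable there becomes a derivative on the right, the chain
rule moves it through `g`, and `g† g = 1` collapses the sums. -/
lemma inner_grpAct_grpAct (g : SU3) (v w : Pol) :
    inner ℂ (grpAct g v) (grpAct g w) = inner ℂ v w := by
  induction v using MvPolynomial.induction_on generalizing w with
  | C a =>
    have h0 : ∀ w : Pol, inner ℂ (C a : Pol) w = star a * coeff 0 w := by
      intro w
      have : (C a : Pol) = a • monomial 0 1 := by
        rw [smul_monomial, smul_eq_mul, mul_one]; rfl
      rw [this, inner_smul_left, inner_monomial_left]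
      simp [multiFactorial]
    rw [algHom_C, algebraMap_eq, h0, h0]
    congr 1
    -- The inner product with a constant sees only the constant term, which a linear substitution
    -- preserves.
    have : (constantCoeff : Pol →+* ℂ).comp (grpAct g : Pol →+* Pol) = constantCoeff := by
      apply MvPolynomial.ringHom_ext
      · intro r; simp
      · rintro (j | j) <;> simp [grpAct]
    exact congrArg (fun f : Pol →+* ℂ => f w) this
  | add v v' hv hv' => rw [map_add, inner_add_left, inner_add_left, hv, hv']
  | mul_X v j hv =>
    rw [map_mul, mul_comm v, inner_X_mul, mul_comm (grpAct g v)]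
    rcases j with j | j
    · have e : grpAct g (X (Sum.inl j)) = ∑ i, (g : Mat3) i j • (X (Sum.inl i) : Pol) := by
        simp [grpAct, MvPolynomial.smul_eq_C_mul]
      rw [e, Finset.sum_mul, sum_inner]
      simp only [smul_mul_assoc, inner_smul_left, inner_X_mul, pderiv_grpAct_inl, inner_sum,
        inner_smul_right, hv, Finset.mul_sum]
      rw [Finset.sum_comm]
      simp only [← mul_assoc, ← Finset.sum_mul]
      have := star_mul_self_apply g j
      simp only [← starRingEnd_apply] at this
      simp [this]
    · have e : grpAct g (X (Sum.inr j)) = ∑ i, star ((g : Mat3) i j) • (X (Sum.inr i) : Pol) := by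
        simp [grpAct, MvPolynomial.smul_eq_C_mul]
      rw [e, Finset.sum_mul, sum_inner]
      simp only [smul_mul_assoc, inner_smul_left, inner_X_mul, pderiv_grpAct_inr, inner_sum,
        inner_smul_right, hv, Finset.mul_sum]
      rw [Finset.sum_comm]
      simp only [← mul_assoc, ← Finset.sum_mul]
      have := fun i => star_mul_self_apply g i j
      simp only [← starRingEnd_apply, mul_comm] at this
      simp [this]

lemma inner_grpAct_inv (g : SU3) (v w : Pol) :
    inner ℂ (grpAct g⁻¹ v) w = inner ℂ v (grpAct g w) := by
  rw [← inner_grpAct_grpAct g, ← grpAct_mul, mul_inv_cancel, grpAct_one]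

/-! ### Bidegrees and norm bounds -/

/-- The polynomials of bidegree `(p, q)`. -/
abbrev Bideg (p q : ℕ) : Submodule ℂ Pol := weightedHomogeneousSubmodule ℂ biWt (p, q)

lemma monomial_mem_bideg {p q : ℕ} {m : (Fin 3 ⊕ Fin 3) →₀ ℕ} {c : ℂ}
    (h : (∑ i, m (Sum.inl i), ∑ i, m (Sum.inr i)) = (p, q)) : monomial m c ∈ Bideg p q :=
  isWeightedHomogeneous_monomial biWt _ _ (by rw [biWt_weight, h])

lemma bideg_induction {p q : ℕ} {P : Pol → Prop} (h0 : P 0)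
    (hm : ∀ m : (Fin 3 ⊕ Fin 3) →₀ ℕ, ∑ i, m (Sum.inl i) = p → ∑ i, m (Sum.inr i) = q →
      ∀ c, P (monomial m c))
    (ha : ∀ v w, P v → P w → P (v + w)) {v : Pol} (hv : v ∈ Bideg p q) : P v := by
  rw [mem_weightedHomogeneousSubmodule] at hv
  induction hv using IsWeightedHomogeneous.induction_on with
  | zero => exact h0
  | add v w _ _ hv hw => exact ha v w hv hw
  | monomial m r hr =>
    rw [biWt_weight, Prod.ext_iff] at hr
    exact hm m hr.1 hr.2 r

lemma euler_inl {p q : ℕ} {v : Pol} (hv : v ∈ Bideg p q) :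
    ∑ i, X (Sum.inl i) * pderiv (Sum.inl i) v = (p : ℂ) • v := by
  refine bideg_induction (P := fun v => ∑ i, X (Sum.inl i) * pderiv (Sum.inl i) v = (p : ℂ) • v) ?_ ?_ ?_ hv
  · simp
  · intro m h1 h2 c
    simp only [X_mul_pderiv_monomial, ← Finset.sum_smul, h1]
    exact (Nat.cast_smul_eq_nsmul ℂ p _).symm
  · intro v w hv hw
    simp only [map_add, mul_add, Finset.sum_add_distrib, hv, hw, smul_add]

lemma euler_inr {p q : ℕ} {v : Pol} (hv : v ∈ Bideg p q) :
    ∑ i, X (Sum.inr i) * pderiv (Sum.inr i) v = (q : ℂ) • v := by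
  refine bideg_induction (P := fun v => ∑ i, X (Sum.inr i) * pderiv (Sum.inr i) v = (q : ℂ) • v) ?_ ?_ ?_ hv
  · simp
  · intro m h1 h2 c
    simp only [X_mul_pderiv_monomial, ← Finset.sum_smul, h2]
    exact (Nat.cast_smul_eq_nsmul ℂ q _).symm
  · intro v w hv hw
    simp only [map_add, mul_add, Finset.sum_add_distrib, hv, hw, smul_add]

lemma X_inl_mul_mem {p q : ℕ} {v : Pol} (hv : v ∈ Bideg p q) (i : Fin 3) :
    X (Sum.inl i) * v ∈ Bideg (p + 1) q := by
  have := (isWeightedHomogeneous_X ℂ biWt (Sum.inl i)).mul hv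
  rw [mem_weightedHomogeneousSubmodule]
  convert this using 1
  simp [biWt, add_comm]

lemma X_inr_mul_mem {p q : ℕ} {v : Pol} (hv : v ∈ Bideg p q) (i : Fin 3) :
    X (Sum.inr i) * v ∈ Bideg p (q + 1) := by
  have := (isWeightedHomogeneous_X ℂ biWt (Sum.inr i)).mul hv
  rw [mem_weightedHomogeneousSubmodule]
  convert this using 1
  simp [biWt, add_comm]

lemma pderiv_inl_mem {p q : ℕ} {v : Pol} (hv : v ∈ Bideg p q) (i : Fin 3) :
    pderiv (Sum.inl i) v ∈ Bideg (p - 1) q := by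
  refine bideg_induction (P := fun v => pderiv (Sum.inl i) v ∈ Bideg (p - 1) q) ?_ ?_ ?_ hv
  · simp
  · intro m h1 h2 c
    rw [pderiv_monomial]
    rcases Nat.eq_zero_or_pos (m (Sum.inl i)) with h | h
    -- The derivative vanishes if the variable is absent, so the truncation of `p - 1` at `p = 0` is
    -- harmless.
    · rw [h, Nat.cast_zero, mul_zero, monomial_zero]; exact Submodule.zero_mem _
    · refine monomial_mem_bideg (Prod.ext ?_ ?_)
      · rw [← h1]
        fin_cases i <;> simp [Fin.sum_univ_three, Finsupp.single_apply] at h ⊢ <;> omega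
      · simp [← h2]
  · intro v w hv hw
    rw [map_add]; exact Submodule.add_mem _ hv hw

lemma pderiv_inr_mem {p q : ℕ} {v : Pol} (hv : v ∈ Bideg p q) (i : Fin 3) :
    pderiv (Sum.inr i) v ∈ Bideg p (q - 1) := by
  refine bideg_induction (P := fun v => pderiv (Sum.inr i) v ∈ Bideg p (q - 1)) ?_ ?_ ?_ hv
  · simp
  · intro m h1 h2 c
    rw [pderiv_monomial]
    rcases Nat.eq_zero_or_pos (m (Sum.inr i)) with h | h
    · rw [h, Nat.cast_zero, mul_zero, monomial_zero]; exact Submodule.zero_mem _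
    · refine monomial_mem_bideg (Prod.ext ?_ ?_)
      · simp [← h1]
      · rw [← h2]
        fin_cases i <;> simp [Fin.sum_univ_three, Finsupp.single_apply] at h ⊢ <;> omega
  · intro v w hv hw
    rw [map_add]; exact Submodule.add_mem _ hv hw

/-- Pairing Euler's identity with `v` gives `∑ ‖∂_i v‖² = p ‖v‖²`; each summand is at most the sum.
-/
lemma norm_pderiv_inl_sq_le {p q : ℕ} {v : Pol} (hv : v ∈ Bideg p q) (i : Fin 3) :
    ‖pderiv (Sum.inl i) v‖ ^ 2 ≤ p * ‖v‖ ^ 2 := by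
  have h : ((∑ i, ‖pderiv (Sum.inl i) v‖ ^ 2 : ℝ) : ℂ) = ((p * ‖v‖ ^ 2 : ℝ) : ℂ) := by
    have := congrArg (inner ℂ v) (euler_inl hv)
    simp only [inner_sum, ← inner_pderiv, inner_smul_right, inner_self_eq_norm_sq_to_K] at this
    push_cast
    exact this
  rw [← Complex.ofReal_inj.1 h]
  exact Finset.single_le_sum (f := fun i => ‖pderiv (Sum.inl i) v‖ ^ 2)
    (fun i _ => by positivity) (Finset.mem_univ i)

lemma norm_pderiv_inr_sq_le {p q : ℕ} {v : Pol} (hv : v ∈ Bideg p q) (i : Fin 3) :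
    ‖pderiv (Sum.inr i) v‖ ^ 2 ≤ q * ‖v‖ ^ 2 := by
  have h : ((∑ i, ‖pderiv (Sum.inr i) v‖ ^ 2 : ℝ) : ℂ) = ((q * ‖v‖ ^ 2 : ℝ) : ℂ) := by
    have := congrArg (inner ℂ v) (euler_inr hv)
    simp only [inner_sum, ← inner_pderiv, inner_smul_right, inner_self_eq_norm_sq_to_K] at this
    push_cast
    exact this
  rw [← Complex.ofReal_inj.1 h]
  exact Finset.single_le_sum (f := fun i => ‖pderiv (Sum.inr i) v‖ ^ 2)
    (fun i _ => by positivity) (Finset.mem_univ i)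

/-- This is the canonical commutation relation `∂_i x_i = 1 + x_i ∂_i`, paired with `v`. -/
lemma norm_X_mul_sq (i : Fin 3 ⊕ Fin 3) (v : Pol) :
    ‖X i * v‖ ^ 2 = ‖v‖ ^ 2 + ‖pderiv i v‖ ^ 2 := by
  have h : inner ℂ (X i * v) (X i * v) = inner ℂ v v + inner ℂ (pderiv i v) (pderiv i v) := by
    rw [inner_X_mul, pderiv_mul, pderiv_X_self, one_mul, inner_add_right, ← inner_pderiv]
  simp only [inner_self_eq_norm_sq_to_K] at h
  exact_mod_cast h

lemma norm_X_inl_mul_sq_le {p q : ℕ} {v : Pol} (hv : v ∈ Bideg p q) (i : Fin 3) :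
    ‖X (Sum.inl i) * v‖ ^ 2 ≤ (p + 1) * ‖v‖ ^ 2 := by
  rw [norm_X_mul_sq]
  linarith [norm_pderiv_inl_sq_le hv i]

lemma norm_X_inr_mul_sq_le {p q : ℕ} {v : Pol} (hv : v ∈ Bideg p q) (i : Fin 3) :
    ‖X (Sum.inr i) * v‖ ^ 2 ≤ (q + 1) * ‖v‖ ^ 2 := by
  rw [norm_X_mul_sq]
  linarith [norm_pderiv_inr_sq_le hv i]

end

end QuarkSU3

namespace QuarkSU3

open MvPolynomial

noncomputable section

/-! ### Subspaces invariant under `sl(3)` are invariant under `SU(3)` -/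

/-- The simultaneous substitution `x_j ↦ ∑ i, g_ij x_i`, `y_j ↦ ∑ i, h_ij y_i`. -/
def pairAct (g h : Mat3) : Pol →ₐ[ℂ] Pol :=
  aeval (Sum.elim (fun j => ∑ i, C (g i j) * X (Sum.inl i)) (fun j => ∑ i, C (h i j) * X (Sum.inr i)))

lemma pairAct_mul (g g' h h' : Mat3) (v : Pol) :
    pairAct (g * g') (h * h') v = pairAct g h (pairAct g' h' v) := by
  have H : pairAct (g * g') (h * h') = (pairAct g h).comp (pairAct g' h') := by
    apply MvPolynomial.algHom_ext
    rintro (j | j) <;>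
    · simp only [pairAct, aeval_X, Sum.elim_inl, Sum.elim_inr, AlgHom.comp_apply, map_sum, map_mul,
        Matrix.mul_apply, Finset.sum_mul, Finset.mul_sum, algHom_C, algebraMap_eq]
      rw [Finset.sum_comm]
      refine Finset.sum_congr rfl fun k _ => Finset.sum_congr rfl fun i _ => ?_
      ring
  rw [H]; rfl

lemma pairAct_one (v : Pol) : pairAct 1 1 v = v := by
  have h : pairAct 1 1 = AlgHom.id ℂ Pol := by
    apply MvPolynomial.algHom_ext
    rintro (j | j) <;> simp [pairAct, Matrix.one_apply, apply_ite (C : ℂ → Pol)]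
  rw [h]; rfl

/-- For unitary `g` the entrywise conjugate is the inverse transpose. The right-hand form makes
sense for all invertible matrices, so `g` can be factored into transvections that are not unitary.
-/
lemma grpAct_eq_pairAct (g : SU3) (v : Pol) :
    grpAct g v = pairAct (g : Mat3) ((g : Mat3)⁻¹).transpose v := by
  have h : ((g : Mat3)⁻¹).transpose = (g : Mat3).map star := by
    have h1 : (g : Mat3)⁻¹ = star (g : Mat3) :=
      Matrix.inv_eq_left_inv (Matrix.mem_unitaryGroup_iff'.1 g.2.1)
    rw [h1]
    ext i j
    simp [Matrix.star_apply]
  rw [h]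
  rfl

lemma lieAct_single_inl (i j k : Fin 3) (c : ℂ) :
    lieAct (Matrix.single i j c) (X (Sum.inl k)) = if j = k then C c * X (Sum.inl i) else 0 := by
  rw [lieAct_inl]
  split_ifs with h
  · subst h
    simp [Matrix.single_apply, apply_ite (C : ℂ → Pol)]
  · simp [h]

lemma lieAct_single_inr (i j k : Fin 3) (c : ℂ) :
    lieAct (Matrix.single i j c) (X (Sum.inr k)) = if i = k then -(C c * X (Sum.inr j)) else 0 := by
  rw [lieAct_inr]
  split_ifs with h
  · subst h
    simp [Matrix.single_apply, apply_ite (C : ℂ → Pol)]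
  · simp [h]

/-- The Taylor expansion of the one-parameter group generated by an elementary matrix. -/
def taylorHom (i j : Fin 3) : Pol →ₐ[ℂ] Polynomial Pol :=
  aeval fun k => Polynomial.C (X k) + Polynomial.X * Polynomial.C (lieAct (Matrix.single i j 1) (X k))

/-- An off-diagonal elementary matrix squares to zero on the variables, so the flow is affine in
time there. -/
lemma taylorHom_lieAct_X {i j : Fin 3} (hij : i ≠ j) (k : Fin 3 ⊕ Fin 3) :
    taylorHom i j (lieAct (Matrix.single i j 1) (X k)) =
      Polynomial.C (lieAct (Matrix.single i j 1) (X k)) := by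
  rcases k with k | k
  · rw [lieAct_single_inl]
    split_ifs
    · simp [taylorHom, lieAct_single_inl, hij.symm]
    · simp
  · rw [lieAct_single_inr]
    split_ifs
    · simp [taylorHom, lieAct_single_inr, hij]
    · simp

lemma derivative_taylorHom {i j : Fin 3} (hij : i ≠ j) (v : Pol) :
    Polynomial.derivative (taylorHom i j v) = taylorHom i j (lieAct (Matrix.single i j 1) v) := by
  induction v using MvPolynomial.induction_on with
  | C a =>
    rw [derivation_C, map_zero]
    have : taylorHom i j (C a) = Polynomial.C (C a) := by
      simp [taylorHom]
    rw [this, Polynomial.derivative_C]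
  | add v w hv hw => simp only [map_add, hv, hw]
  | mul_X v k hv =>
    rw [map_mul, Polynomial.derivative_mul, hv, Derivation.leibniz, map_add, smul_eq_mul,
      smul_eq_mul, map_mul, map_mul, taylorHom_lieAct_X hij]
    have : Polynomial.derivative (taylorHom i j (X k)) =
        Polynomial.C (lieAct (Matrix.single i j 1) (X k)) := by
      simp [taylorHom]
    rw [this]
    ring

/-- The coefficients are those of the exponential series, `D^n v / n!` for the derivation `D`; each
comes from the previous one by differentiating in time. -/
lemma coeff_taylorHom_mem {i j : Fin 3} (hij : i ≠ j) {N : Submodule ℂ Pol}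
    (hN : ∀ v ∈ N, lieAct (Matrix.single i j 1) v ∈ N) (n : ℕ) :
    ∀ v ∈ N, (taylorHom i j v).coeff n ∈ N := by
  induction n with
  | zero =>
    intro v hv
    have : (taylorHom i j v).coeff 0 = v := by
      have h : ((Polynomial.aeval (0 : Pol)).restrictScalars ℂ).comp (taylorHom i j) =
          AlgHom.id ℂ Pol := by
        apply MvPolynomial.algHom_ext
        intro k
        simp [taylorHom]
      have := congrArg (fun f : Pol →ₐ[ℂ] Pol => f v) h
      simpa [Polynomial.coeff_zero_eq_aeval_zero] using this
    rwa [this]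
  | succ n ih =>
    intro v hv
    have h := ih _ (hN v hv)
    rw [← derivative_taylorHom hij, Polynomial.coeff_derivative] at h
    have h0 : ((n : ℂ) + 1) ≠ 0 := by exact_mod_cast Nat.succ_ne_zero n
    have h2 : (taylorHom i j v).coeff (n + 1) =
        ((n : ℂ) + 1)⁻¹ • ((taylorHom i j v).coeff (n + 1) * ((n : Pol) + 1)) := by
      have : ((n : Pol) + 1) = C ((n : ℂ) + 1) := by simp
      rw [this, mul_comm, ← MvPolynomial.smul_eq_C_mul, smul_smul, inv_mul_cancel₀ h0, one_smul]
    rw [h2]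
    exact N.smul_mem _ h

/-- The transvection is the time `c` flow of the elementary matrix, and its Taylor polynomial has
coefficients in `N`. -/
lemma pairAct_transvection_mem {i j : Fin 3} (hij : i ≠ j) {N : Submodule ℂ Pol}
    (hN : ∀ v ∈ N, lieAct (Matrix.single i j 1) v ∈ N) (c : ℂ) {v : Pol} (hv : v ∈ N) :
    pairAct (Matrix.transvection i j c) ((Matrix.transvection i j c)⁻¹).transpose v ∈ N := by
  have hinv : (Matrix.transvection i j c)⁻¹ = Matrix.transvection i j (-c) :=
    Matrix.inv_eq_left_inv (by
      rw [Matrix.transvection_mul_transvection_same i j hij, neg_add_cancel,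
        Matrix.transvection_zero])
  have h : pairAct (Matrix.transvection i j c) ((Matrix.transvection i j c)⁻¹).transpose =
      ((Polynomial.aeval (C c : Pol)).restrictScalars ℂ).comp (taylorHom i j) := by
    rw [hinv]
    apply MvPolynomial.algHom_ext
    rintro (k | k)
    · simp [taylorHom, pairAct, Matrix.transvection, lieAct_single_inl, Matrix.one_apply,
        Matrix.single_apply, add_mul, Finset.sum_add_distrib, apply_ite (C : ℂ → Pol),
        ite_and]
      simp only [mul_comm]
    · simp [taylorHom, pairAct, Matrix.transvection, lieAct_single_inr, Matrix.one_apply,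
        Matrix.single_apply, add_mul, Finset.sum_add_distrib, apply_ite (C : ℂ → Pol),
        ite_and, eq_comm]
      simp only [mul_comm]
  rw [h]
  change Polynomial.aeval (C c : Pol) (taylorHom i j v) ∈ N
  rw [Polynomial.aeval_eq_sum_range]
  refine N.sum_mem fun n _ => ?_
  rw [smul_eq_mul, mul_comm, ← map_pow, ← MvPolynomial.smul_eq_C_mul]
  exact N.smul_mem _ (coeff_taylorHom_mem hij hN n v hv)

/-- The diagonal matrices of determinant one are products of transvections. -/
lemma diagonal_eq_prod_transvection (a b c : ℂ) (h : a * b * c = 1) :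
    Matrix.diagonal ![a, b, c] =
      (Matrix.transvection 0 1 a * Matrix.transvection 1 0 (-a⁻¹) * Matrix.transvection 0 1 a *
        (Matrix.transvection 0 1 (-1) * Matrix.transvection 1 0 1 *
          Matrix.transvection 0 1 (-1))) *
      (Matrix.transvection 1 2 (a * b) * Matrix.transvection 2 1 (-(a * b)⁻¹) *
        Matrix.transvection 1 2 (a * b) * (Matrix.transvection 1 2 (-1) *
          Matrix.transvection 2 1 1 * Matrix.transvection 1 2 (-1))) := by
  have ha : a ≠ 0 := by rintro rfl; simp at h
  have hb : b ≠ 0 := by rintro rfl; simp at h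
  have hc : c = (a * b)⁻¹ := eq_inv_of_mul_eq_one_right h
  -- In `SL(2)` the first three factors give the Weyl element `w(t)` and the last three give
  -- `w(-1)`; their product is `diag(t, t⁻¹)`. Then `diag(a, b, c) = diag(a, a⁻¹, 1) diag(1, ab,
  -- (ab)⁻¹)`.
  have h1 : ∀ t : ℂ, t ≠ 0 →
      Matrix.transvection (0 : Fin 3) 1 t * Matrix.transvection 1 0 (-t⁻¹) *
        Matrix.transvection 0 1 t * (Matrix.transvection 0 1 (-1) * Matrix.transvection 1 0 1 *
          Matrix.transvection 0 1 (-1)) = Matrix.diagonal ![t, t⁻¹, 1] := by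
    intro t ht
    ext i j
    fin_cases i <;> fin_cases j <;>
      simp [Matrix.transvection, Matrix.mul_apply, Fin.sum_univ_three, Matrix.single_apply,
        Matrix.one_apply, ht]
  have h2 : ∀ t : ℂ, t ≠ 0 →
      Matrix.transvection (1 : Fin 3) 2 t * Matrix.transvection 2 1 (-t⁻¹) *
        Matrix.transvection 1 2 t * (Matrix.transvection 1 2 (-1) * Matrix.transvection 2 1 1 *
          Matrix.transvection 1 2 (-1)) = Matrix.diagonal ![1, t, t⁻¹] := by
    intro t ht
    ext i j
    fin_cases i <;> fin_cases j <;>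
      simp [Matrix.transvection, Matrix.mul_apply, Fin.sum_univ_three, Matrix.single_apply,
        Matrix.one_apply, ht]
  rw [h1 a ha, h2 _ (mul_ne_zero ha hb), Matrix.diagonal_mul_diagonal, hc]
  congr 1
  ext i
  fin_cases i <;> simp [ha]

/-- A subspace of polynomials that is invariant under the root vectors of `sl(3)` is invariant under
`SU(3)`. -/
lemma grpAct_mem_of_lieAct_mem {N : Submodule ℂ Pol}
    (hN : ∀ i j, i ≠ j → ∀ v ∈ N, lieAct (Matrix.single i j 1) v ∈ N) (g : SU3) :
    ∀ v ∈ N, grpAct g v ∈ N := by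
  -- The determinant is carried along so that the diagonal factor in the Gaussian elimination of `g`
  -- has determinant one, hence is itself a product of transvections.
  let Good : Mat3 → Prop := fun M => M.det = 1 ∧ ∀ v ∈ N, pairAct M (M⁻¹).transpose v ∈ N
  have good_mul : ∀ M M', Good M → Good M' → Good (M * M') := by
    rintro M M' ⟨h1, h2⟩ ⟨h1', h2'⟩
    refine ⟨by rw [Matrix.det_mul, h1, h1', one_mul], fun v hv => ?_⟩
    rw [Matrix.mul_inv_rev, Matrix.transpose_mul, pairAct_mul]
    exact h2 _ (h2' v hv)
  have good_one : Good 1 := ⟨Matrix.det_one, fun v hv => by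
    rwa [inv_one, Matrix.transpose_one, pairAct_one]⟩
  have good_tr : ∀ i j, i ≠ j → ∀ c, Good (Matrix.transvection i j c) := fun i j hij c =>
    ⟨Matrix.det_transvection_of_ne i j hij c,
      fun v hv => pairAct_transvection_mem hij (hN i j hij) c hv⟩
  have good_list : ∀ L : List (Matrix.TransvectionStruct (Fin 3) ℂ),
      Good (L.map Matrix.TransvectionStruct.toMatrix).prod := by
    intro L
    induction L with
    | nil => exact good_one
    | cons t L ih =>
      rw [List.map_cons, List.prod_cons]
      exact good_mul _ _ (good_tr _ _ t.hij _) ih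
  obtain ⟨L, L', D, hD⟩ :=
    Matrix.Pivot.exists_list_transvec_mul_diagonal_mul_list_transvec (g : Mat3)
  have hdet : D 0 * D 1 * D 2 = 1 := by
    have h1 : (g : Mat3).det = 1 := g.2.2
    rw [hD, Matrix.det_mul, Matrix.det_mul, (good_list L).1, (good_list L').1,
      Matrix.det_diagonal, Fin.prod_univ_three] at h1
    simpa using h1
  have good_diag : Good (Matrix.diagonal D) := by
    have : D = ![D 0, D 1, D 2] := by ext i; fin_cases i <;> rfl
    rw [this, diagonal_eq_prod_transvection _ _ _ hdet]
    have t01 := good_tr 0 1 (by decide)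
    have t10 := good_tr 1 0 (by decide)
    have t12 := good_tr 1 2 (by decide)
    have t21 := good_tr 2 1 (by decide)
    have key : ∀ A B C A' B' C', Good A → Good B → Good C → Good A' → Good B' → Good C' →
        Good (A * B * C * (A' * B' * C')) := fun A B C A' B' C' a b c a' b' c' =>
      good_mul _ _ (good_mul _ _ (good_mul _ _ a b) c) (good_mul _ _ (good_mul _ _ a' b') c')
    exact good_mul _ _ (key _ _ _ _ _ _ (t01 _) (t10 _) (t01 _) (t01 _) (t10 _) (t01 _))
      (key _ _ _ _ _ _ (t12 _) (t21 _) (t12 _) (t12 _) (t21 _) (t12 _))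
  intro v hv
  rw [grpAct_eq_pairAct, hD]
  exact (good_mul _ _ (good_mul _ _ (good_list L) good_diag) (good_list L')).2 v hv

/-! ### The quark space is spanned by lowering words on the highest weight vector -/

/-- The vectors obtained from `x₁^p y₃^q` by lowering operators. -/
inductive LowWord (p q : ℕ) : Pol → Prop
  | base : LowWord p q (hwPol p q)
  | lower {w : Pol} (i j : Fin 3) (h : j < i) (hw : LowWord p q w) :
      LowWord p q (lieAct (Matrix.single i j 1) w)

lemma lieAct_single (i j : Fin 3) (v : Pol) : lieAct (Matrix.single i j 1) v =
    X (Sum.inl i) * pderiv (Sum.inl j) v - X (Sum.inr j) * pderiv (Sum.inr i) v := by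
  rw [lieAct_apply]
  simp [Matrix.single_apply, ite_and]

lemma lieAct_eq_sum_single (A : Mat3) (v : Pol) :
    lieAct A v = ∑ i, ∑ j, A i j • lieAct (Matrix.single i j 1) v := by
  simp only [lieAct_single, smul_sub, Finset.sum_sub_distrib]
  rw [lieAct_apply]

lemma lieAct_single_hwPol_of_lt (p q : ℕ) {i j : Fin 3} (h : i < j) :
    lieAct (Matrix.single i j 1) (hwPol p q) = 0 := by
  have hj : j ≠ 0 := (lt_of_le_of_lt (Fin.zero_le i) h).ne'
  have hi : i ≠ 2 := (lt_of_lt_of_le h (Fin.le_last j)).ne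
  rw [lieAct_single, hwPol, pderiv_monomial, pderiv_monomial]
  simp [hwExp, hj, hi]

lemma lieAct_single_hwPol_diag (p q : ℕ) (i : Fin 3) :
    ∃ c : ℂ, lieAct (Matrix.single i i 1) (hwPol p q) = c • hwPol p q := by
  refine ⟨(hwExp p q (Sum.inl i) : ℂ) - hwExp p q (Sum.inr i), ?_⟩
  rw [lieAct_single, hwPol, X_mul_pderiv_monomial, X_mul_pderiv_monomial, sub_smul,
    Nat.cast_smul_eq_nsmul, Nat.cast_smul_eq_nsmul]

lemma lieAct_mem_span {S : Set Pol} {A : Mat3}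
    (h : ∀ w ∈ S, lieAct A w ∈ Submodule.span ℂ S) {v : Pol} (hv : v ∈ Submodule.span ℂ S) :
    lieAct A v ∈ Submodule.span ℂ S := by
  induction hv using Submodule.span_induction with
  | mem w hw => exact h w hw
  | zero => rw [map_zero]; exact Submodule.zero_mem _
  | add v w _ _ hv hw => rw [map_add]; exact Submodule.add_mem _ hv hw
  | smul c v _ hv => rw [Derivation.map_smul]; exact Submodule.smul_mem _ _ hv

/-- Induction on the word, for all matrices at once: `A E w = [A, E] w + E A w` moves `A` towards
the highest weight vector, which raising operators kill and diagonal ones scale. -/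
lemma lieAct_lowWord_mem {p q : ℕ} {w : Pol} (hw : LowWord p q w) (A : Mat3) :
    lieAct A w ∈ Submodule.span ℂ {w | LowWord p q w} := by
  induction hw generalizing A with
  | base =>
    rw [lieAct_eq_sum_single]
    refine Submodule.sum_mem _ fun i _ => Submodule.sum_mem _ fun j _ => Submodule.smul_mem _ _ ?_
    rcases lt_trichotomy i j with h | rfl | h
    · rw [lieAct_single_hwPol_of_lt p q h]
      exact Submodule.zero_mem _
    · obtain ⟨c, hc⟩ := lieAct_single_hwPol_diag p q i
      rw [hc]
      exact Submodule.smul_mem _ _ (Submodule.subset_span LowWord.base)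
    · exact Submodule.subset_span (LowWord.lower i j h LowWord.base)
  | @lower w i j h hw ih =>
    have h1 := congrArg (fun D : Derivation ℂ Pol Pol => D w) (lieAct_comm A (Matrix.single i j 1))
    simp only [Derivation.commutator_apply] at h1
    have h2 : lieAct A (lieAct (Matrix.single i j 1) w) =
        lieAct (A * Matrix.single i j 1 - Matrix.single i j 1 * A) w +
          lieAct (Matrix.single i j 1) (lieAct A w) := by rw [h1]; abel
    rw [h2]
    refine Submodule.add_mem _ (ih _) ?_
    exact lieAct_mem_span (fun w hw => Submodule.subset_span (LowWord.lower i j h hw)) (ih A)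

/-- The span is Lie invariant, hence `SU(3)` invariant, so it is one of the spaces in the
intersection that defines the quark space. -/
lemma quarkSpace_le_span (p q : ℕ) :
    quarkSpace p q ≤ Submodule.span ℂ {w | LowWord p q w} := by
  have hL : ∀ A : Mat3, ∀ v ∈ Submodule.span ℂ {w | LowWord p q w},
      lieAct A v ∈ Submodule.span ℂ {w | LowWord p q w} := by
    intro A v hv
    exact lieAct_mem_span (fun w hw => lieAct_lowWord_mem hw A) hv
  refine sInf_le ⟨Submodule.subset_span LowWord.base, fun g => ?_, fun A => hL A⟩
  exact grpAct_mem_of_lieAct_mem (fun i j _ => hL _) g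

/-- The representation of a root vector. -/
def rootOp (p q : ℕ) (i j : Fin 3) (h : i ≠ j) : Module.End ℂ (quarkSpace p q) :=
  lieRep p q (LieAlgebra.SpecialLinear.single i j h 1)

lemma coe_lieRep (p q : ℕ) (A : sl3) (v : quarkSpace p q) :
    (lieRep p q A v : Pol) = lieAct (A : Mat3) v := rfl

lemma coe_grpRep (p q : ℕ) (g : SU3) (v : quarkSpace p q) :
    (grpRep p q g v : Pol) = grpAct g v := rfl

lemma coe_rootOp (p q : ℕ) (i j : Fin 3) (h : i ≠ j) (v : quarkSpace p q) :
    (rootOp p q i j h v : Pol) = lieAct (Matrix.single i j 1) v := rfl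

lemma inner_rootOp {p q : ℕ} {i j : Fin 3} (h : i ≠ j) (v w : quarkSpace p q) :
    inner ℂ (rootOp p q i j h v) w = inner ℂ v (rootOp p q j i h.symm w) := by
  rw [Submodule.coe_inner, Submodule.coe_inner, coe_rootOp, coe_rootOp, inner_lieAct,
    Matrix.conjTranspose_single, star_one]

/-- A subspace of the quark space that contains the highest weight vector and is stable under the
lowering operators is everything. -/
lemma eq_top_of_lowering {p q : ℕ} {S : Submodule ℂ (quarkSpace p q)} (h0 : hwVec p q ∈ S)
    (hS : ∀ i j, ∀ h : j < i, ∀ w ∈ S, rootOp p q i j h.ne' w ∈ S) : S = ⊤ := by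
  have h1 : ∀ w, LowWord p q w → ∃ h : w ∈ quarkSpace p q, (⟨w, h⟩ : quarkSpace p q) ∈ S := by
    intro w hw
    induction hw with
    | base => exact ⟨hwPol_mem p q, h0⟩
    | @lower w i j h hw ih =>
      obtain ⟨hw', hS'⟩ := ih
      refine ⟨lieAct_mem p q (LieAlgebra.SpecialLinear.single i j h.ne' 1) w hw', ?_⟩
      have e : (⟨_, lieAct_mem p q (LieAlgebra.SpecialLinear.single i j h.ne' 1) w hw'⟩ :
          quarkSpace p q) = rootOp p q i j h.ne' ⟨w, hw'⟩ := Subtype.ext rfl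
      exact e ▸ hS i j h _ hS'
  have h2 : Submodule.span ℂ {w | LowWord p q w} ≤ S.map (quarkSpace p q).subtype :=
    Submodule.span_le.2 fun w hword => by
      obtain ⟨h, hS⟩ := h1 w hword
      exact ⟨_, hS, rfl⟩
  rw [eq_top_iff]
  intro v _
  obtain ⟨w, hw, hwv⟩ := h2 (quarkSpace_le_span p q v.2)
  rwa [← Subtype.ext hwv]

/-! ### The enveloping algebra acts by all operators -/

/-- The diagonal matrix `diag(1, 0, -1)`. -/
def gradingElt : sl3 := ⟨Matrix.diagonal (![1, 0, -1] : Fin 3 → ℂ), by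
  change Matrix.trace (Matrix.diagonal (![1, 0, -1] : Fin 3 → ℂ)) = 0
  rw [Matrix.trace_diagonal, Fin.sum_univ_three]
  simp⟩

lemma lieAct_gradingElt_monomial (m : (Fin 3 ⊕ Fin 3) →₀ ℕ) (c : ℂ) :
    lieAct (gradingElt : Mat3) (monomial m c) =
      ((m (Sum.inl 0) : ℂ) - m (Sum.inl 2) - m (Sum.inr 0) + m (Sum.inr 2)) • monomial m c := by
  rw [lieAct_eq_sum_single]
  simp only [gradingElt, Fin.sum_univ_three, lieAct_single, X_mul_pderiv_monomial,
    ← Nat.cast_smul_eq_nsmul ℂ]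
  simp
  module

/-- The interpolation polynomial that vanishes at the integers in `[-n, n)` and is `1` at `n`. -/
def topPoly (n : ℕ) : Polynomial ℂ :=
  ∏ k ∈ Finset.Ico (-(n : ℤ)) n, (Polynomial.C ((n : ℂ) - k)⁻¹ * (Polynomial.X - Polynomial.C (k : ℂ)))

lemma topPoly_eval_self (n : ℕ) : (topPoly n).eval (n : ℂ) = 1 := by
  rw [topPoly, Polynomial.eval_prod]
  refine Finset.prod_eq_one fun k hk => ?_
  have : ((n : ℂ) - k) ≠ 0 := by
    rw [sub_ne_zero]
    have := (Finset.mem_Ico.1 hk).2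
    exact_mod_cast this.ne'
  simp [this]

lemma topPoly_eval_of_mem (n : ℕ) (k : ℤ) (hk : k ∈ Finset.Ico (-(n : ℤ)) n) :
    (topPoly n).eval (k : ℂ) = 0 := by
  rw [topPoly, Polynomial.eval_prod]
  exact Finset.prod_eq_zero hk (by simp)

lemma aeval_apply_of_eigen {V : Type*} [AddCommGroup V] [Module ℂ V] (f : Module.End ℂ V) {μ : ℂ}
    {v : V} (h : f v = μ • v) (P : Polynomial ℂ) : Polynomial.aeval f P v = P.eval μ • v := by
  by_cases hv : v = 0
  · simp [hv]
  · exact Module.End.aeval_apply_of_hasEigenvector ⟨Module.End.mem_eigenspace_iff.2 h, hv⟩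

/-- On bidegree `(p, q)` the eigenvalues of the grading element are integers in `[-(p+q), p+q]`, and
only `x₁^p y₃^q` attains the top one. The interpolation polynomial thus filters out every other
monomial. -/
lemma aeval_lieAct_gradingElt {p q : ℕ} {v : Pol} (hv : v ∈ Bideg p q) :
    Polynomial.aeval (R := ℂ) (A := Module.End ℂ Pol) (lieAct (gradingElt : Mat3)).toLinearMap
      (topPoly (p + q)) v = coeff (hwExp p q) v • hwPol p q := by
  refine bideg_induction (P := fun v => Polynomial.aeval (R := ℂ) (A := Module.End ℂ Pol)
    (lieAct (gradingElt : Mat3)).toLinearMap (topPoly (p + q)) v =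
      coeff (hwExp p q) v • hwPol p q) ?_ ?_ ?_ hv
  · simp
  · intro m h1 h2 c
    rw [aeval_apply_of_eigen _ (lieAct_gradingElt_monomial m c), coeff_monomial]
    rw [Fin.sum_univ_three] at h1 h2
    by_cases hm : m = hwExp p q
    · subst hm
      have : ((hwExp p q (Sum.inl 0) : ℂ) - hwExp p q (Sum.inl 2) - hwExp p q (Sum.inr 0) +
          hwExp p q (Sum.inr 2)) = ((p + q : ℕ) : ℂ) := by
        simp [hwExp]
      rw [this, topPoly_eval_self, if_pos rfl, one_smul, hwPol, smul_monomial, smul_eq_mul, mul_one]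
    · rw [if_neg hm, zero_smul]
      have hj : m (Sum.inl 0) < p ∨ m (Sum.inr 2) < q := by
        by_contra hcon
        push Not at hcon
        apply hm
        ext (i | i) <;> fin_cases i <;> simp [hwExp] <;> omega
      have : ((m (Sum.inl 0) : ℂ) - m (Sum.inl 2) - m (Sum.inr 0) + m (Sum.inr 2)) =
          (((m (Sum.inl 0) : ℤ) - m (Sum.inl 2) - m (Sum.inr 0) + m (Sum.inr 2) : ℤ) : ℂ) := by
        push_cast; ring
      rw [this, topPoly_eval_of_mem, zero_smul]
      rw [Finset.mem_Ico]
      push_cast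
      omega
  · intro v w hv hw
    rw [map_add, hv, hw, coeff_add, add_smul]

lemma coe_aeval_lieRep (p q : ℕ) (A : sl3) (P : Polynomial ℂ) (v : quarkSpace p q) :
    (Polynomial.aeval (lieRep p q A) P v : Pol) =
      Polynomial.aeval (R := ℂ) (A := Module.End ℂ Pol) (lieAct (A : Mat3)).toLinearMap P v := by
  induction P using Polynomial.induction_on generalizing v with
  | C a => simp [Module.algebraMap_end_apply]
  | add P Q hP hQ => simp [hP, hQ]
  | monomial n a ih =>
    have e : (Polynomial.C a * Polynomial.X ^ (n + 1) : Polynomial ℂ) =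
        Polynomial.C a * Polynomial.X ^ n * Polynomial.X := by ring
    rw [e, map_mul, map_mul _ _ Polynomial.X, Polynomial.aeval_X, Polynomial.aeval_X]
    exact ih _

lemma envRep_ι (p q : ℕ) (A : sl3) :
    envRep p q (UniversalEnvelopingAlgebra.ι ℂ A) = lieRep p q A :=
  UniversalEnvelopingAlgebra.lift_ι_apply ℂ _ _

lemma hwProj_mem_range (p q : ℕ) : hwProj p q ∈ (envRep p q).range := by
  refine ⟨Polynomial.aeval (UniversalEnvelopingAlgebra.ι ℂ gradingElt) (topPoly (p + q)), ?_⟩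
  change envRep p q _ = _
  rw [← Polynomial.aeval_algHom_apply, envRep_ι]
  ext v : 2
  rw [coe_aeval_lieRep, aeval_lieAct_gradingElt (quarkSpace_le p q v.2)]
  rfl

lemma multiFactorial_hwExp (p q : ℕ) :
    multiFactorial (hwExp p q) = ((p.factorial : ℂ) * q.factorial) := by
  simp [multiFactorial, hwExp, Fin.prod_univ_three]

lemma factorial_mul_ne_zero (p q : ℕ) : ((p.factorial : ℂ) * q.factorial) ≠ 0 :=
  mul_ne_zero (Nat.cast_ne_zero.2 (Nat.factorial_ne_zero _))
    (Nat.cast_ne_zero.2 (Nat.factorial_ne_zero _))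

lemma coeff_hwExp_eq_inner (p q : ℕ) (v : Pol) :
    coeff (hwExp p q) v = ((p.factorial : ℂ) * q.factorial)⁻¹ * inner ℂ (hwPol p q) v := by
  rw [hwPol, inner_monomial_left, multiFactorial_hwExp, inv_mul_cancel_left₀
    (factorial_mul_ne_zero p q)]

lemma rootOp_hwVec_of_lt (p q : ℕ) {i j : Fin 3} (h : i < j) :
    rootOp p q i j h.ne (hwVec p q) = 0 :=
  Subtype.ext (lieAct_single_hwPol_of_lt p q h)

/-- The operator `u ↦ ⟨w, u⟩ v`. -/
def ketBra {p q : ℕ} (v w : quarkSpace p q) : Module.End ℂ (quarkSpace p q) :=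
  (innerₛₗ ℂ w).smulRight v

lemma ketBra_apply {p q : ℕ} (v w u : quarkSpace p q) : ketBra v w u = inner ℂ w u • v := rfl

/-- The range contains the highest weight projection. Multiplying it by root vectors on the left
lowers the ket, and on the right, by the adjoints, lowers the bra; lowering words reach all vectors.
-/
lemma ketBra_mem_range {p q : ℕ} (v w : quarkSpace p q) : ketBra v w ∈ (envRep p q).range := by
  have hroot : ∀ i j (h : i ≠ j), rootOp p q i j h ∈ (envRep p q).range := fun i j h =>
    ⟨_, envRep_ι p q _⟩
  have h1 : ∀ v, ketBra v (hwVec p q) ∈ (envRep p q).range := by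
    let S : Submodule ℂ (quarkSpace p q) :=
      { carrier := {v | ketBra v (hwVec p q) ∈ (envRep p q).range}
        add_mem' := fun {a b} ha hb => by
          have : ketBra (a + b) (hwVec p q) = ketBra a (hwVec p q) + ketBra b (hwVec p q) := by
            ext u : 1; simp [ketBra_apply]
          rw [Set.mem_ofPred_eq, this]
          exact add_mem ha hb
        zero_mem' := by
          have : ketBra 0 (hwVec p q) = 0 := by ext u : 1; simp [ketBra_apply]
          rw [Set.mem_ofPred_eq, this]
          exact zero_mem _
        smul_mem' := fun c a ha => by
          have : ketBra (c • a) (hwVec p q) = c • ketBra a (hwVec p q) := by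
            ext u : 1; simp [ketBra_apply, smul_smul, mul_comm]
          rw [Set.mem_ofPred_eq, this]
          exact Subalgebra.smul_mem _ ha c }
    have hS : S = ⊤ := by
      refine eq_top_of_lowering ?_ fun i j h w hw => ?_
      -- The factor `p! q!` is the squared norm of the highest weight vector, which is not
      -- normalized.
      · have : ketBra (hwVec p q) (hwVec p q) = ((p.factorial : ℂ) * q.factorial) • hwProj p q := by
          ext u : 1
          change inner ℂ (hwPol p q) (u : Pol) • hwVec p q = ((p.factorial : ℂ) * q.factorial) •
            coeff (hwExp p q) (u : Pol) • hwVec p q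
          rw [coeff_hwExp_eq_inner, smul_smul, mul_inv_cancel_left₀ (factorial_mul_ne_zero p q)]
        change _ ∈ (envRep p q).range
        rw [this]
        exact Subalgebra.smul_mem _ (hwProj_mem_range p q) _
      · have : ketBra (rootOp p q i j h.ne' w) (hwVec p q) =
            rootOp p q i j h.ne' * ketBra w (hwVec p q) := by
          ext u : 1; simp [ketBra_apply]
        change _ ∈ (envRep p q).range
        rw [this]
        exact mul_mem (hroot i j h.ne') hw
    intro v
    have : v ∈ S := hS ▸ Submodule.mem_top
    exact this
  let S : Submodule ℂ (quarkSpace p q) :=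
    { carrier := {w | ∀ v, ketBra v w ∈ (envRep p q).range}
      add_mem' := fun {a b} ha hb v => by
        have : ketBra v (a + b) = ketBra v a + ketBra v b := by
          ext u : 1
          rw [LinearMap.add_apply, ketBra_apply, ketBra_apply, ketBra_apply, inner_add_left,
            add_smul]
        rw [this]
        exact add_mem (ha v) (hb v)
      zero_mem' := fun v => by
        have : ketBra v 0 = 0 := by ext u : 1; simp [ketBra_apply]
        rw [this]
        exact zero_mem _
      smul_mem' := fun c a ha v => by
        have : ketBra v (c • a) = star c • ketBra v a := by
          ext u : 1
          rw [LinearMap.smul_apply, ketBra_apply, ketBra_apply, Submodule.coe_inner,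
            Submodule.coe_inner, Submodule.coe_smul, inner_smul_left, smul_smul]
          rfl
        rw [this]
        exact Subalgebra.smul_mem _ (ha v) _ }
  have hS : S = ⊤ := by
    refine eq_top_of_lowering h1 fun i j h w hw v => ?_
    have : ketBra v (rootOp p q i j h.ne' w) = ketBra v w * rootOp p q j i h.ne := by
      ext u : 1
      rw [Module.End.mul_apply, ketBra_apply, ketBra_apply, inner_rootOp]
    rw [this]
    exact mul_mem (hw v) (hroot j i h.ne)
  have : w ∈ S := hS ▸ Submodule.mem_top
  exact this v

lemma envRep_surjective (p q : ℕ) : Function.Surjective (envRep p q) := by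
  intro A
  have h : A = ∑ k, ketBra (A (stdOrthonormalBasis ℂ (quarkSpace p q) k))
      (stdOrthonormalBasis ℂ (quarkSpace p q) k) := by
    ext u : 1
    conv_lhs => rw [← (stdOrthonormalBasis ℂ (quarkSpace p q)).sum_repr' u, map_sum]
    simp only [map_smul, LinearMap.sum_apply, ketBra_apply]
  rw [h]
  exact sum_mem (S := (envRep p q).range) fun k _ => ketBra_mem_range _ _

end

end QuarkSU3

namespace QuarkSU3

open MvPolynomial

noncomputable section

/-! ### The Berezin symbol determines the operator -/

/-- The rotation `1 + (cos t - 1) (E_ii + E_jj) + sin t (z E_ij - z̄ E_ji)`. -/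
def rotMat (i j : Fin 3) (z : ℂ) (t : ℝ) : Mat3 :=
  1 + ((Real.cos t : ℂ) - 1) • (Matrix.single i i 1 + Matrix.single j j 1) +
    (Real.sin t : ℂ) • (Matrix.single i j z - Matrix.single j i (star z))

lemma rotMat_mem {i j : Fin 3} (h : i ≠ j) {z : ℂ} (hz : z * star z = 1) (t : ℝ) :
    rotMat i j z t ∈ Matrix.specialUnitaryGroup (Fin 3) ℂ := by
  have hcs : (Real.cos t : ℂ) ^ 2 + (Real.sin t : ℂ) ^ 2 = 1 := by
    exact_mod_cast Real.cos_sq_add_sin_sq t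
  have hc : star (Real.cos t : ℂ) = (Real.cos t : ℂ) := Complex.conj_ofReal _
  have hs : star (Real.sin t : ℂ) = (Real.sin t : ℂ) := Complex.conj_ofReal _
  rw [Matrix.mem_specialUnitaryGroup_iff]
  rw [Matrix.mem_unitaryGroup_iff, Matrix.det_fin_three]
  unfold rotMat
  generalize (Real.cos t : ℂ) = c at *
  generalize (Real.sin t : ℂ) = s at *
  have hz' : z * (starRingEnd ℂ) z = 1 := hz
  have hc' : (starRingEnd ℂ) c = c := hc
  have hs' : (starRingEnd ℂ) s = s := hs
  constructor
  · ext k l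
    fin_cases i <;> fin_cases j <;> first | exact absurd rfl h | skip
    all_goals
      fin_cases k <;> fin_cases l <;>
      simp [Matrix.mul_apply, Fin.sum_univ_three, Matrix.single_apply, Matrix.one_apply, hc', hs'] <;>
      first
        | linear_combination hcs + s ^ 2 * hz'
        | ring
  · fin_cases i <;> fin_cases j <;> first | exact absurd rfl h | skip
    all_goals
      simp
      linear_combination hcs + s ^ 2 * hz'

lemma hasDerivAt_rotMat {i j : Fin 3} (z : ℂ) (k l : Fin 3) :
    HasDerivAt (fun t => rotMat i j z t k l)
      ((Matrix.single i j z - Matrix.single j i (star z) : Mat3) k l) 0 := by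
  have hc : HasDerivAt (fun t : ℝ => (Real.cos t : ℂ)) 0 0 := by
    simpa using (Real.hasDerivAt_cos 0).ofReal_comp
  have hs : HasDerivAt (fun t : ℝ => (Real.sin t : ℂ)) 1 0 := by
    simpa using (Real.hasDerivAt_sin 0).ofReal_comp
  have := (((hc.sub_const 1).mul_const
    ((Matrix.single i i 1 + Matrix.single j j 1 : Mat3) k l)).const_add ((1 : Mat3) k l)).add
    (hs.mul_const ((Matrix.single i j z - Matrix.single j i (star z) : Mat3) k l))
  simp only [zero_mul, one_mul, zero_add] at this
  exact this

/-- The derivative of the group action along a curve, coefficientwise. -/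
lemma hasDerivAt_coeff_grpAct {g : ℝ → SU3} {A : Mat3} (g0 : g 0 = 1)
    (hg : ∀ k l, HasDerivAt (fun t => (g t : Mat3) k l) (A k l) 0) (hA : A.conjTranspose = -A)
    (v : Pol) : ∀ m, HasDerivAt (fun t => coeff m (grpAct (g t) v)) (coeff m (lieAct A v)) 0 := by
  induction v using MvPolynomial.induction_on with
  | C a =>
    intro m
    simp only [algHom_C, algebraMap_eq, derivation_C, coeff_zero]
    exact hasDerivAt_const _ _
  | add v w hv hw =>
    intro m
    simp only [map_add, coeff_add]
    exact (hv m).add (hw m)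
  | mul_X v k hv =>
    have hX : ∀ m, HasDerivAt (fun t => coeff m (grpAct (g t) (X k)))
        (coeff m (lieAct A (X k))) 0 := by
      intro m
      rcases k with k | k
      · simp only [grpAct, aeval_X, Sum.elim_inl, lieAct_inl, coeff_sum, coeff_C_mul]
        exact HasDerivAt.fun_sum fun i _ => (hg i k).mul_const _
      · have h : ∀ i, HasDerivAt (fun t => star ((g t : Mat3) i k)) (-A k i) 0 := by
          intro i
          have := (hg i k).star
          have e : star (A i k) = -A k i := by
            have := congrFun (congrFun hA k) i
            rwa [Matrix.conjTranspose_apply, Matrix.neg_apply] at this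
          rwa [e] at this
        simp only [grpAct, aeval_X, Sum.elim_inr, lieAct_inr, coeff_sum, coeff_C_mul,
          ← Finset.sum_neg_distrib, ← neg_mul, ← map_neg]
        exact HasDerivAt.fun_sum fun i _ => (h i).mul_const _
    intro m
    simp only [map_mul, Derivation.leibniz, smul_eq_mul, coeff_add, coeff_mul]
    rw [← coeff_mul, ← coeff_mul, mul_comm (X k), add_comm, coeff_mul, coeff_mul,
      ← Finset.sum_add_distrib]
    refine HasDerivAt.fun_sum fun x _ => ?_
    have := (hv x.1).mul (hX x.2)
    rw [g0, grpAct_one, grpAct_one] at this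
    exact this

/-- The exponents that occur in polynomials of total degree at most `n`. -/
def exponentBox (n : ℕ) : Finset ((Fin 3 ⊕ Fin 3) →₀ ℕ) :=
  Finset.Iic (Finsupp.equivFunOnFinite.symm fun _ => n)

/-- The index set depends only on `p + q`, so the same finite sum serves along a whole curve of
polynomials and can be differentiated term by term. -/
lemma bideg_eq_sum {p q : ℕ} {w : Pol} (hw : w ∈ Bideg p q) :
    w = ∑ m ∈ exponentBox (p + q), coeff m w • (monomial m 1 : Pol) := by
  conv_lhs => rw [← support_sum_monomial_coeff w]
  simp only [smul_monomial, smul_eq_mul, mul_one]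
  refine Finset.sum_subset (fun m hm => ?_) fun m _ hm => by
    rw [notMem_support_iff.1 hm, monomial_zero]
  have h1 := hw (mem_support_iff.1 hm)
  rw [biWt_weight, Prod.ext_iff] at h1
  simp only [Fin.sum_univ_three] at h1
  rw [exponentBox, Finset.mem_Iic]
  rintro (i | i) <;> fin_cases i <;> simp <;> omega

lemma inner_apply_eq_sum {p q : ℕ} {v w : Pol} (hv : v ∈ Bideg p q) (hw : w ∈ Bideg p q)
    (B : Pol →ₗ[ℂ] Pol) : inner ℂ v (B w) =
      ∑ m ∈ exponentBox (p + q), ∑ m' ∈ exponentBox (p + q),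
        star (coeff m v) * coeff m' w * inner ℂ (monomial m 1 : Pol) (B (monomial m' 1)) := by
  conv_lhs => rw [bideg_eq_sum hv, bideg_eq_sum hw]
  simp only [map_sum, map_smul, sum_inner, inner_sum, inner_smul_left, inner_smul_right]
  simp only [Finset.mul_sum]
  rw [Finset.sum_comm]
  refine Finset.sum_congr rfl fun m _ => Finset.sum_congr rfl fun m' _ => ?_
  rw [starRingEnd_apply]
  ring

/-- The derivative of a diagonal matrix element along a curve in the group. -/
lemma hasDerivAt_inner_grpAct {g : ℝ → SU3} {A : Mat3} (g0 : g 0 = 1)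
    (hg : ∀ k l, HasDerivAt (fun t => (g t : Mat3) k l) (A k l) 0) (hA : A.conjTranspose = -A)
    {p q : ℕ} {v : Pol} (hv : v ∈ Bideg p q) (B : Pol →ₗ[ℂ] Pol) :
    HasDerivAt (fun t => inner ℂ (grpAct (g t) v) (B (grpAct (g t) v)))
      (inner ℂ (lieAct A v) (B v) + inner ℂ v (B (lieAct A v))) 0 := by
  rw [inner_apply_eq_sum (lieAct_bihom A hv) hv, inner_apply_eq_sum hv (lieAct_bihom A hv),
    ← Finset.sum_add_distrib]
  simp only [fun t => inner_apply_eq_sum (grpAct_bihom (g t) hv) (grpAct_bihom (g t) hv) B,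
    ← Finset.sum_add_distrib, ← add_mul]
  refine HasDerivAt.fun_sum fun m _ => HasDerivAt.fun_sum fun m' _ => HasDerivAt.mul_const ?_ _
  have := (hasDerivAt_coeff_grpAct g0 hg hA v m).star.mul (hasDerivAt_coeff_grpAct g0 hg hA v m')
  rw [g0, grpAct_one] at this
  exact this

/-- The operators all of whose diagonal matrix elements at coherent states vanish. -/
def symbolKer (p q : ℕ) : Submodule ℂ (Module.End ℂ (quarkSpace p q)) where
  carrier := {A | ∀ g, inner ℂ (grpRep p q g (hwVec p q)) (A (grpRep p q g (hwVec p q))) = 0}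
  add_mem' {A B} hA hB g := by
    rw [LinearMap.add_apply, inner_add_right, hA g, hB g, add_zero]
  zero_mem' g := by rw [LinearMap.zero_apply, inner_zero_right]
  smul_mem' c A hA g := by
    have := hA g
    rw [Submodule.coe_inner] at this
    rw [LinearMap.smul_apply, Submodule.coe_inner, Submodule.coe_smul, inner_smul_right, this,
      mul_zero]

/-- Differentiate `⟨g_t u, A g_t u⟩ = 0` at `t = 0` along a rotation with tangent `W = z E_ij - z̄
E_ji`. As `W† = -W`, the result is `⟨u, [W, A] u⟩ = 0`. -/
lemma commutator_mem_symbolKer_of_skew {p q : ℕ} {A : Module.End ℂ (quarkSpace p q)}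
    (hA : A ∈ symbolKer p q) {i j : Fin 3} (h : i ≠ j) {z : ℂ} (hz : z * star z = 1) :
    z • (rootOp p q i j h * A - A * rootOp p q i j h) -
      star z • (rootOp p q j i h.symm * A - A * rootOp p q j i h.symm) ∈ symbolKer p q := by
  intro k
  set u := grpRep p q k (hwVec p q) with hu
  set W : Mat3 := Matrix.single i j z - Matrix.single j i (star z) with hW
  let g : ℝ → SU3 := fun t => ⟨rotMat i j z t, rotMat_mem h hz t⟩
  have hWs : W.conjTranspose = -W := by
    rw [hW, Matrix.conjTranspose_sub, Matrix.conjTranspose_single, Matrix.conjTranspose_single,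
      star_star, neg_sub]
  have g0 : g 0 = 1 := by
    apply Subtype.ext
    simp [g, rotMat]
  -- `A` is extended by zero on the orthogonal complement, so that the curve can be differentiated
  -- in the monomial coordinates.
  let B : Pol →ₗ[ℂ] Pol := (quarkSpace p q).subtype ∘ₗ A ∘ₗ
    ((quarkSpace p q).orthogonalProjectionOnto : Pol →ₗ[ℂ] quarkSpace p q)
  have hB : ∀ w : quarkSpace p q, B (w : Pol) = (A w : Pol) := fun w => by
    simp [B]
  have hF : ∀ t, inner ℂ (grpAct (g t) u) (B (grpAct (g t) u)) = 0 := by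
    intro t
    have := hA (g t * k)
    rw [map_mul, Module.End.mul_apply, ← hu, Submodule.coe_inner] at this
    rw [← coe_grpRep, hB]
    exact this
  have hd := hasDerivAt_inner_grpAct g0 (fun k l => hasDerivAt_rotMat z k l) hWs
    (quarkSpace_le p q u.2) B
  simp only [hF] at hd
  have key := (hasDerivAt_const (0 : ℝ) (0 : ℂ)).unique hd
  have hWu : lieAct W (u : Pol) = ((z • rootOp p q i j h u - star z • rootOp p q j i h.symm u :
      quarkSpace p q) : Pol) := by
    have e : ∀ (a b : Fin 3) (c : ℂ), (Matrix.single a b c : Mat3) = c • Matrix.single a b 1 := by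
      intro a b c; simp
    have e2 : W = z • Matrix.single i j 1 + (-star z) • Matrix.single j i 1 := by
      rw [hW, e i j z, e j i (star z), neg_smul, sub_eq_add_neg]
    rw [e2, lieAct_add, lieAct_smul, lieAct_smul]
    simp [coe_rootOp, sub_eq_add_neg]
  rw [hWu, hB, hB, ← Submodule.coe_inner, ← Submodule.coe_inner] at key
  simp only [map_sub, map_smul, inner_sub_left, inner_sub_right, inner_smul_left, inner_smul_right,
    inner_rootOp, LinearMap.sub_apply, LinearMap.smul_apply, Module.End.mul_apply,
    starRingEnd_apply, star_star] at key ⊢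
  linear_combination key

lemma eq_half_combination {V : Type*} [AddCommGroup V] [Module ℂ V] (x y : V) :
    x = (1 / 2 : ℂ) • ((1 : ℂ) • x - (1 : ℂ) • y) +
      (-(1 / 2) * Complex.I) • (Complex.I • x - (-Complex.I) • y) := by
  have e : -(1 / 2 : ℂ) * Complex.I * Complex.I = 1 / 2 := by
    rw [mul_assoc, Complex.I_mul_I]; ring
  have e' : -(1 / 2 : ℂ) * Complex.I * -Complex.I = -(1 / 2) := by
    rw [mul_neg, mul_assoc, Complex.I_mul_I]; ring
  simp only [smul_sub, smul_smul]
  rw [e, e']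
  module

/-- The skew directions for `z = 1` and `z = i` span the root vectors over the complex numbers. -/
lemma commutator_mem_symbolKer {p q : ℕ} {A : Module.End ℂ (quarkSpace p q)}
    (hA : A ∈ symbolKer p q) {i j : Fin 3} (h : i ≠ j) :
    rootOp p q i j h * A - A * rootOp p q i j h ∈ symbolKer p q := by
  have h1 := commutator_mem_symbolKer_of_skew hA h (z := 1) (by simp)
  have h2 := commutator_mem_symbolKer_of_skew hA h (z := Complex.I) (by simp)
  have := (symbolKer p q).add_mem ((symbolKer p q).smul_mem (1 / 2 : ℂ) h1)
    ((symbolKer p q).smul_mem (-(1 / 2) * Complex.I) h2)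
  convert this using 1
  rw [star_one, Complex.star_def, Complex.conj_I]
  exact eq_half_combination (V := Module.End ℂ (quarkSpace p q)) _ _

/-- Induction on lowering words in `v`: in `⟨e, A E v⟩ = ⟨e, E A v⟩ - ⟨e, [E, A] v⟩` the first term
vanishes because the raising operator `E†` kills `e`, and `[E, A]` is again in the kernel. -/
lemma inner_hwVec_eq_zero_of_mem_symbolKer {p q : ℕ} (v : quarkSpace p q) :
    ∀ A ∈ symbolKer p q, inner ℂ (hwVec p q) (A v) = 0 := by
  let S : Submodule ℂ (quarkSpace p q) :=
    { carrier := {v | ∀ A ∈ symbolKer p q, inner ℂ (hwVec p q) (A v) = 0}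
      add_mem' := fun {a b} ha hb A hA => by
        rw [map_add, inner_add_right, ha A hA, hb A hA, add_zero]
      zero_mem' := fun A _ => by rw [map_zero, inner_zero_right]
      smul_mem' := fun c a ha A hA => by
        have := ha A hA
        rw [Submodule.coe_inner] at this
        rw [map_smul, Submodule.coe_inner, Submodule.coe_smul, inner_smul_right, this,
          mul_zero] }
  have hS : S = ⊤ := by
    refine eq_top_of_lowering (fun A hA => ?_) fun i j h w hw A hA => ?_
    · simpa using hA 1
    · have h1 := hw _ (commutator_mem_symbolKer hA h.ne')
      rw [LinearMap.sub_apply, inner_sub_right, Module.End.mul_apply, Module.End.mul_apply,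
        ← inner_rootOp h.ne, rootOp_hwVec_of_lt p q h, inner_zero_left, zero_sub,
        neg_eq_zero] at h1
      exact h1
  have : v ∈ S := hS ▸ Submodule.mem_top
  exact this

/-- Lowering now the left vector: `⟨E w, A v⟩ = ⟨w, [E†, A] v⟩ + ⟨w, A E† v⟩`, and both terms vanish
for all `v` by induction. So every matrix element of `A` vanishes. -/
lemma symbolKer_eq_bot (p q : ℕ) : symbolKer p q = ⊥ := by
  rw [Submodule.eq_bot_iff]
  let S : Submodule ℂ (quarkSpace p q) :=
    { carrier := {w | ∀ A ∈ symbolKer p q, ∀ v, inner ℂ w (A v) = 0}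
      add_mem' := fun {a b} ha hb A hA v => by
        rw [inner_add_left, ha A hA, hb A hA, add_zero]
      zero_mem' := fun A _ v => by rw [inner_zero_left]
      smul_mem' := fun c a ha A hA v => by rw [inner_smul_left, ha A hA, mul_zero] }
  have hS : S = ⊤ := by
    refine eq_top_of_lowering (fun A hA v => inner_hwVec_eq_zero_of_mem_symbolKer v A hA)
      fun i j h w hw A hA v => ?_
    have h1 := hw _ (commutator_mem_symbolKer hA h.ne) v
    rw [LinearMap.sub_apply, inner_sub_right, Module.End.mul_apply, Module.End.mul_apply,
      hw A hA, sub_zero, ← inner_rootOp h.ne'] at h1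
    exact h1
  intro A hA
  ext v : 1
  have : A v ∈ S := hS ▸ Submodule.mem_top
  rw [LinearMap.zero_apply]
  have := this A hA v
  rwa [inner_self_eq_zero] at this

/-! ### The symbol of an operator at a group element -/

/-- The symbol `⟨g e, A g e⟩ / ⟨e, e⟩` of an operator on the quark space, `e = x₁^p y₃^q`. -/
def opSymbol {p q : ℕ} (A : Module.End ℂ (quarkSpace p q)) (g : SU3) : ℂ :=
  ((p.factorial : ℂ) * q.factorial)⁻¹ *
    inner ℂ (grpRep p q g (hwVec p q)) (A (grpRep p q g (hwVec p q)))

lemma opSymbol_injective {p q : ℕ} {A B : Module.End ℂ (quarkSpace p q)}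
    (h : ∀ g, opSymbol A g = opSymbol B g) : A = B := by
  have : A - B ∈ symbolKer p q := fun g => by
    rw [LinearMap.sub_apply, inner_sub_right, sub_eq_zero]
    exact mul_left_cancel₀ (inv_ne_zero (factorial_mul_ne_zero p q)) (h g)
  rw [symbolKer_eq_bot, Submodule.mem_bot] at this
  exact sub_eq_zero.1 this

/-- The projection has rank one, so by cyclicity the trace is a single coefficient, which unitarity
turns into an expectation value in a coherent state. -/
lemma trace_hwProjConj {p q : ℕ} (A : Module.End ℂ (quarkSpace p q)) (g : SU3) :
    LinearMap.trace ℂ (quarkSpace p q) (A * hwProjConj p q g) = opSymbol A g := by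
  have h1 : A * hwProjConj p q g = (A * grpRep p q g * hwProj p q) * grpRep p q g⁻¹ := by
    rw [hwProjConj]; simp only [mul_assoc]
  have h2 : grpRep p q g⁻¹ * (A * grpRep p q g * hwProj p q) =
      ((MvPolynomial.lcoeff ℂ (hwExp p q)).comp (quarkSpace p q).subtype).smulRight
        (grpRep p q g⁻¹ (A (grpRep p q g (hwVec p q)))) := by
    ext v : 1
    simp [hwProj]
  rw [h1, LinearMap.trace_mul_comm, h2, LinearMap.trace_smulRight, opSymbol]
  change coeff (hwExp p q) (grpAct g⁻¹ (A (grpRep p q g (hwVec p q)) : Pol)) = _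
  rw [coeff_hwExp_eq_inner, Submodule.coe_inner, coe_grpRep]
  congr 1
  have := inner_grpAct_inv g⁻¹ (hwPol p q) (A (grpRep p q g (hwVec p q)) : Pol)
  rw [inv_inv] at this
  exact this.symm

end

end QuarkSU3

namespace QuarkSU3

open MvPolynomial

noncomputable section

/-! ### Normalized Wick ordered operators -/

/-- The action of a matrix on polynomials, as a linear operator. -/
def lieOp (A : Mat3) : Module.End ℂ Pol := (lieAct A).toLinearMap

lemma lieOp_apply (A : Mat3) (v : Pol) : lieOp A v = lieAct A v := rfl

/-- Families of operators indexed by the bidegree of the space on which they are considered. -/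
def Fam : Type := ℕ → ℕ → Module.End ℂ Pol

namespace Fam

instance : AddCommGroup Fam := inferInstanceAs (AddCommGroup (ℕ → ℕ → Module.End ℂ Pol))

instance : Module ℂ Fam := inferInstanceAs (Module ℂ (ℕ → ℕ → Module.End ℂ Pol))

/-- The family of identity operators. -/
def one : Fam := fun _ _ => 1

lemma ext {A B : Fam} (h : ∀ p q v, A p q v = B p q v) : A = B :=
  funext fun p => funext fun q => LinearMap.ext fun v => h p q v

variable (A B : Fam) (c : ℂ) (p q : ℕ) (v : Pol)

lemma one_apply : one p q = 1 := rfl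

lemma zero_apply : (0 : Fam) p q = 0 := rfl

lemma add_apply : (A + B) p q = A p q + B p q := rfl

lemma sub_apply : (A - B) p q = A p q - B p q := rfl

lemma neg_apply : (-A) p q = -A p q := rfl

lemma smul_apply : (c • A) p q = c • A p q := rfl

/-- Evaluation of a family of operators at a bidegree. -/
def eval : Fam →ₗ[ℂ] Module.End ℂ Pol where
  toFun A := A p q
  map_add' _ _ := rfl
  map_smul' _ _ := rfl

lemma sum_apply {κ : Type*} (s : Finset κ) (F : κ → Fam) : (∑ k ∈ s, F k) p q = ∑ k ∈ s, F k p q :=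
  map_sum (eval p q) F s

end Fam

/-- The first order operators `x_k ∂/∂x_l` and `y_k ∂/∂y_l`. -/
abbrev Letter : Type := (Fin 3 × Fin 3) ⊕ (Fin 3 × Fin 3)

namespace Letter

/-- The variable by which a letter multiplies. -/
def row : Letter → Fin 3 ⊕ Fin 3 := Sum.map Prod.fst Prod.fst

/-- The variable by which a letter differentiates. -/
def col : Letter → Fin 3 ⊕ Fin 3 := Sum.map Prod.snd Prod.snd

/-- The degree in the variables of the letter. -/
def deg : Letter → ℕ → ℕ → ℕ := Sum.elim (fun _ p _ => p) (fun _ _ q => q)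

/-- The first degree after differentiation. -/
def lowP : Letter → ℕ → ℕ := Sum.elim (fun _ p => p - 1) (fun _ p => p)

/-- The second degree after differentiation. -/
def lowQ : Letter → ℕ → ℕ := Sum.elim (fun _ q => q) (fun _ q => q - 1)

end Letter

/-- Insertion of a letter into a Wick ordered operator, `B ↦ p⁻¹ x_k B ∂/∂x_l` or
`B ↦ q⁻¹ y_k B ∂/∂y_l`. -/
def cons (ℓ : Letter) : Fam →ₗ[ℂ] Fam where
  toFun B := fun p q => ((ℓ.deg p q : ℂ)⁻¹) • (LinearMap.mulLeft ℂ (X ℓ.row : Pol) *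
    B (ℓ.lowP p) (ℓ.lowQ q) * (pderiv ℓ.col).toLinearMap)
  map_add' B B' := by
    refine funext fun p => funext fun q => ?_
    simp only [Fam.add_apply, mul_add, add_mul, smul_add]
    rfl
  map_smul' c B := by
    refine funext fun p => funext fun q => ?_
    simp only [Fam.smul_apply, mul_smul_comm, smul_mul_assoc, RingHom.id_apply]
    rw [smul_comm]
    rfl

lemma cons_apply (ℓ : Letter) (B : Fam) (p q : ℕ) (v : Pol) : cons ℓ B p q v =
    ((ℓ.deg p q : ℂ)⁻¹) • (X ℓ.row * B (ℓ.lowP p) (ℓ.lowQ q) (pderiv ℓ.col v)) := rfl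

/-- The normalized Wick ordered product of a list of letters. -/
def wick : List Letter → Fam
  | [] => Fam.one
  | ℓ :: w => cons ℓ (wick w)

lemma pderiv_comm (i j : Fin 3 ⊕ Fin 3) (v : Pol) :
    pderiv i (pderiv j v) = pderiv j (pderiv i v) := by
  have h : ⁅(pderiv (R := ℂ) i : Derivation ℂ Pol Pol), pderiv (R := ℂ) j⁆ = 0 := by
    apply MvPolynomial.derivation_ext
    intro k
    classical
    simp [Derivation.commutator_apply, pderiv_X, Pi.single_apply, apply_ite]
  have := congrArg (fun D : Derivation ℂ Pol Pol => D v) h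
  simp only [Derivation.commutator_apply] at this
  exact sub_eq_zero.1 this

/-- Wick ordering makes letters commute: variables commute with variables and derivatives with
derivatives, and the falling factorial in the normalization does not depend on the order. -/
lemma cons_comm (ℓ ℓ' : Letter) (B : Fam) : cons ℓ (cons ℓ' B) = cons ℓ' (cons ℓ B) := by
  refine Fam.ext fun p q v => ?_
  simp only [cons_apply, mul_smul_comm, smul_smul]
  rw [pderiv_comm, mul_left_comm]
  congr 1
  · rcases ℓ with ℓ | ℓ <;> rcases ℓ' with ℓ' | ℓ' <;>
      simp only [Letter.deg, Letter.lowP, Letter.lowQ, Sum.elim_inl, Sum.elim_inr] <;> ring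
  · rcases ℓ with ℓ | ℓ <;> rcases ℓ' with ℓ' | ℓ' <;> rfl

/-- The `x`-part of the principal symbol of the action of a matrix. -/
def leadX (A : Mat3) : Fam →ₗ[ℂ] Fam := ∑ i, ∑ j, A i j • cons (Sum.inl (i, j))

/-- The `y`-part of the principal symbol of the action of a matrix, up to sign. -/
def leadY (A : Mat3) : Fam →ₗ[ℂ] Fam := ∑ i, ∑ j, A i j • cons (Sum.inr (j, i))

lemma leadX_apply (A : Mat3) (B : Fam) :
    leadX A B = ∑ i, ∑ j, A i j • cons (Sum.inl (i, j)) B := by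
  simp [leadX]

lemma leadY_apply (A : Mat3) (B : Fam) :
    leadY A B = ∑ i, ∑ j, A i j • cons (Sum.inr (j, i)) B := by
  simp [leadY]

lemma cons_leadX (A : Mat3) (ℓ : Letter) (B : Fam) : cons ℓ (leadX A B) = leadX A (cons ℓ B) := by
  simp only [leadX_apply, map_sum, map_smul, cons_comm ℓ]

lemma cons_leadY (A : Mat3) (ℓ : Letter) (B : Fam) : cons ℓ (leadY A B) = leadY A (cons ℓ B) := by
  simp only [leadY_apply, map_sum, map_smul, cons_comm ℓ]

lemma pderiv_inl_lieAct (A : Mat3) (l : Fin 3) (v : Pol) :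
    pderiv (Sum.inl l) (lieAct A v) =
      lieAct A (pderiv (Sum.inl l) v) + ∑ j, A l j • pderiv (Sum.inl j) v := by
  rw [lieAct_apply, lieAct_apply]
  simp only [map_sub, map_sum, Derivation.map_smul, pderiv_mul, smul_add, Finset.sum_add_distrib,
    pderiv_comm (Sum.inl l)]
  simp [pderiv_X, Pi.single_apply]
  abel

lemma pderiv_inr_lieAct (A : Mat3) (l : Fin 3) (v : Pol) :
    pderiv (Sum.inr l) (lieAct A v) =
      lieAct A (pderiv (Sum.inr l) v) - ∑ i, A i l • pderiv (Sum.inr i) v := by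
  rw [lieAct_apply, lieAct_apply]
  simp only [map_sub, map_sum, Derivation.map_smul, pderiv_mul, smul_add, Finset.sum_add_distrib,
    pderiv_comm (Sum.inr l)]
  simp [pderiv_X, Pi.single_apply]
  abel

/-- Composition with the action of a matrix. -/
def lieMul (A : Mat3) (B : Fam) : Fam := fun p q => lieOp A * B p q

/-- Precomposition with the action of a matrix. -/
def mulLie (A : Mat3) (B : Fam) : Fam := fun p q => B p q * lieOp A

/-- The commutator with the action of a matrix. -/
def lieComm (A : Mat3) : Fam →ₗ[ℂ] Fam where
  toFun B := fun p q => lieOp A * B p q - B p q * lieOp A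
  map_add' B B' := by
    refine funext fun p => funext fun q => ?_
    simp only [Fam.add_apply, mul_add, add_mul, add_sub_add_comm]
    rfl
  map_smul' c B := by
    refine funext fun p => funext fun q => ?_
    simp only [Fam.smul_apply, mul_smul_comm, smul_mul_assoc, RingHom.id_apply]
    exact (smul_sub c (lieOp A * B p q) (B p q * lieOp A)).symm

lemma lieComm_apply (A : Mat3) (B : Fam) (p q : ℕ) :
    lieComm A B p q = lieOp A * B p q - B p q * lieOp A := rfl

/-- The action of a matrix on the row index of a letter. -/
def rowAct (A : Mat3) : Letter → Fam →ₗ[ℂ] Fam :=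
  Sum.elim (fun kl => ∑ i, A i kl.1 • cons (Sum.inl (i, kl.2)))
    (fun kl => -∑ i, A kl.1 i • cons (Sum.inr (i, kl.2)))

/-- The action of a matrix on the column index of a letter. -/
def colAct (A : Mat3) : Letter → Fam →ₗ[ℂ] Fam :=
  Sum.elim (fun kl => ∑ j, A kl.2 j • cons (Sum.inl (kl.1, j)))
    (fun kl => -∑ j, A j kl.2 • cons (Sum.inr (kl.1, j)))

lemma lieMul_cons (A : Mat3) (ℓ : Letter) (B : Fam) :
    lieMul A (cons ℓ B) = rowAct A ℓ B + cons ℓ (lieMul A B) := by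
  refine Fam.ext fun p q v => ?_
  rcases ℓ with ⟨k, l⟩ | ⟨k, l⟩
  · simp only [lieMul, Module.End.mul_apply, lieOp_apply, cons_apply, Derivation.map_smul,
      Derivation.leibniz, Fam.add_apply, LinearMap.add_apply, smul_eq_mul, rowAct, Sum.elim_inl,
      Letter.row, Sum.map_inl, lieAct_inl, LinearMap.sum_apply, LinearMap.smul_apply,
      Fam.sum_apply, Fam.smul_apply, Finset.mul_sum, Finset.smul_sum, smul_add]
    rw [add_comm]
    congr 1
    refine Finset.sum_congr rfl fun i _ => ?_
    simp only [Letter.deg, Letter.lowP, Letter.lowQ, Letter.col, Sum.elim_inl, Sum.map_inl,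
      MvPolynomial.smul_eq_C_mul]
    ring
  · simp only [lieMul, Module.End.mul_apply, lieOp_apply, cons_apply, Derivation.map_smul,
      Derivation.leibniz, Fam.add_apply, LinearMap.add_apply, smul_eq_mul, rowAct, Sum.elim_inr,
      Letter.row, Sum.map_inr, lieAct_inr, LinearMap.sum_apply, LinearMap.smul_apply,
      Fam.sum_apply, Fam.smul_apply, Finset.mul_sum, Finset.smul_sum, smul_add,
      LinearMap.neg_apply, Fam.neg_apply, mul_neg, smul_neg]
    rw [add_comm]
    congr 2
    refine Finset.sum_congr rfl fun i _ => ?_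
    simp only [Letter.deg, Letter.lowP, Letter.lowQ, Letter.col, Sum.elim_inr, Sum.map_inr,
      MvPolynomial.smul_eq_C_mul]
    ring

lemma cons_lieOp (A : Mat3) (ℓ : Letter) (B : Fam) (p q : ℕ) :
    cons ℓ B p q * lieOp A = cons ℓ (mulLie A B) p q + colAct A ℓ B p q := by
  refine LinearMap.ext fun v => ?_
  rcases ℓ with ⟨k, l⟩ | ⟨k, l⟩
  · simp only [Module.End.mul_apply, lieOp_apply, cons_apply, LinearMap.add_apply, colAct,
      Sum.elim_inl, Letter.col, Sum.map_inl, LinearMap.sum_apply, LinearMap.smul_apply,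
      Fam.sum_apply, Fam.smul_apply, pderiv_inl_lieAct, map_add, mul_add, smul_add, map_sum,
      Finset.mul_sum, Finset.smul_sum, map_smul]
    congr 1
    refine Finset.sum_congr rfl fun i _ => ?_
    simp only [Letter.deg, Letter.lowP, Letter.lowQ, Letter.row, Sum.elim_inl, Sum.map_inl,
      MvPolynomial.smul_eq_C_mul]
    ring
  · simp only [Module.End.mul_apply, lieOp_apply, cons_apply, colAct,
      Sum.elim_inr, Letter.col, Sum.map_inr, LinearMap.sum_apply, LinearMap.smul_apply,
      Fam.sum_apply, Fam.smul_apply, pderiv_inr_lieAct, LinearMap.sub_apply, map_sub, mul_sub, smul_sub, map_sum,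
      Finset.mul_sum, Finset.smul_sum, map_smul, LinearMap.neg_apply, Fam.neg_apply,
      ← sub_eq_add_neg]
    congr 1
    refine Finset.sum_congr rfl fun i _ => ?_
    simp only [Letter.deg, Letter.lowP, Letter.lowQ, Letter.row, Sum.elim_inr, Sum.map_inr,
      MvPolynomial.smul_eq_C_mul]
    ring

/-- The commutator acts as a derivation that only changes the row and column indices of letters. No
factor `p` or `q` appears, in contrast to the product with a matrix. -/
lemma lieComm_cons (A : Mat3) (ℓ : Letter) (B : Fam) :
    lieComm A (cons ℓ B) = rowAct A ℓ B + cons ℓ (lieComm A B) - colAct A ℓ B := by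
  have h : lieComm A B = lieMul A B - mulLie A B := rfl
  rw [h, map_sub, ← add_sub_assoc, ← lieMul_cons, sub_sub]
  refine funext fun p => funext fun q => ?_
  rw [lieComm_apply, cons_lieOp]
  rfl

/-! ### Bounded combinations of Wick ordered operators -/

/-- Combinations of normalized Wick ordered operators of length at most `n` with bounded
coefficients. -/
inductive Nice {ι : Type*} (n : ℕ) : (ι → Fam) → Prop
  | smul_wick (w : List Letter) (hw : w.length ≤ n) (c : ι → ℂ) (C : ℝ)
      (hc : ∀ i, ‖c i‖ ≤ C) : Nice n (fun i => c i • wick w)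
  | add {A B : ι → Fam} (hA : Nice n A) (hB : Nice n B) : Nice n (fun i => A i + B i)

namespace Nice

variable {ι : Type*} {n : ℕ} {A B : ι → Fam}

lemma mono {m : ℕ} (h : n ≤ m) (hA : Nice n A) : Nice m A := by
  induction hA with
  | smul_wick w hw c C hc => exact smul_wick w (hw.trans h) c C hc
  | add _ _ hA hB => exact hA.add hB

lemma zero : Nice n (fun _ : ι => 0) := by
  simpa using smul_wick (ι := ι) [] (Nat.zero_le n) (fun _ => 0) 0 (by simp)

lemma smul (hA : Nice n A) {c : ι → ℂ} {C : ℝ} (hc : ∀ i, ‖c i‖ ≤ C) :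
    Nice n (fun i => c i • A i) := by
  induction hA with
  | smul_wick w hw d D hd =>
    simp only [smul_smul]
    refine smul_wick w hw _ (C * D) fun i => ?_
    rw [norm_mul]
    exact mul_le_mul (hc i) (hd i) (norm_nonneg _) ((norm_nonneg _).trans (hc i))
  | add _ _ hA hB =>
    simp only [smul_add]
    exact hA.add hB

lemma const_smul (hA : Nice n A) (c : ℂ) : Nice n (fun i => c • A i) :=
  hA.smul (c := fun _ => c) (fun _ => le_rfl)

lemma neg (hA : Nice n A) : Nice n (fun i => -A i) := by
  simpa using hA.const_smul (-1)

lemma sub (hA : Nice n A) (hB : Nice n B) : Nice n (fun i => A i - B i) := by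
  simpa only [sub_eq_add_neg] using hA.add hB.neg

lemma sum {κ : Type*} (s : Finset κ) {F : κ → ι → Fam} (h : ∀ k ∈ s, Nice n (F k)) :
    Nice n (fun i => ∑ k ∈ s, F k i) := by
  classical
  induction s using Finset.induction_on with
  | empty => simpa using zero
  | insert a s ha ih =>
    simp only [Finset.sum_insert ha]
    exact (h a (Finset.mem_insert_self a s)).add
      (ih fun k hk => h k (Finset.mem_insert_of_mem hk))

lemma cons (hA : Nice n A) (ℓ : Letter) : Nice (n + 1) (fun i => QuarkSU3.cons ℓ (A i)) := by
  induction hA with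
  | smul_wick w hw c C hc =>
    simp only [map_smul]
    exact smul_wick (ℓ :: w) (Nat.succ_le_succ hw) c C hc
  | add _ _ hA hB =>
    simp only [map_add]
    exact hA.add hB

lemma leadX (hA : Nice n A) (M : Mat3) : Nice (n + 1) (fun i => QuarkSU3.leadX M (A i)) := by
  simp only [leadX_apply]
  exact sum _ fun i _ => sum _ fun j _ => (hA.cons _).const_smul _

lemma leadY (hA : Nice n A) (M : Mat3) : Nice (n + 1) (fun i => QuarkSU3.leadY M (A i)) := by
  simp only [leadY_apply]
  exact sum _ fun i _ => sum _ fun j _ => (hA.cons _).const_smul _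

lemma rowAct (hA : Nice n A) (M : Mat3) (ℓ : Letter) :
    Nice (n + 1) (fun i => QuarkSU3.rowAct M ℓ (A i)) := by
  rcases ℓ with ℓ | ℓ
  · simp only [QuarkSU3.rowAct, Sum.elim_inl, LinearMap.sum_apply, LinearMap.smul_apply]
    exact sum _ fun i _ => (hA.cons _).const_smul _
  · simp only [QuarkSU3.rowAct, Sum.elim_inr, LinearMap.sum_apply, LinearMap.smul_apply,
      LinearMap.neg_apply]
    exact (sum _ fun i _ => (hA.cons _).const_smul _).neg

lemma colAct (hA : Nice n A) (M : Mat3) (ℓ : Letter) :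
    Nice (n + 1) (fun i => QuarkSU3.colAct M ℓ (A i)) := by
  rcases ℓ with ℓ | ℓ
  · simp only [QuarkSU3.colAct, Sum.elim_inl, LinearMap.sum_apply, LinearMap.smul_apply]
    exact sum _ fun i _ => (hA.cons _).const_smul _
  · simp only [QuarkSU3.colAct, Sum.elim_inr, LinearMap.sum_apply, LinearMap.smul_apply,
      LinearMap.neg_apply]
    exact (sum _ fun i _ => (hA.cons _).const_smul _).neg

lemma wick (w : List Letter) (hw : w.length ≤ n) : Nice n (fun _ : ι => QuarkSU3.wick w) := by
  simpa using smul_wick (ι := ι) w hw (fun _ => 1) 1 (by simp)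

/-- The length is preserved and the coefficients do not grow with the degrees. This gains the power
of `T` that the commutator estimate needs. -/
lemma lieComm_wick (M : Mat3) (w : List Letter) :
    Nice w.length (fun _ : ι => lieComm M (QuarkSU3.wick w)) := by
  induction w with
  | nil =>
    have : lieComm M (QuarkSU3.wick []) = 0 := by
      refine funext fun p => funext fun q => ?_
      rw [lieComm_apply, QuarkSU3.wick, Fam.one_apply, mul_one, one_mul, sub_self, Fam.zero_apply]
    rw [this]
    exact zero
  | cons ℓ w ih =>
    have hw : Nice w.length (fun _ : ι => QuarkSU3.wick w) := wick w le_rfl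
    simp only [QuarkSU3.wick, lieComm_cons]
    exact ((hw.rowAct M ℓ).add (ih.cons ℓ)).sub (hw.colAct M ℓ)

lemma lieComm (hA : Nice n A) (M : Mat3) : Nice n (fun i => QuarkSU3.lieComm M (A i)) := by
  induction hA with
  | smul_wick w hw c C hc =>
    simp only [map_smul]
    exact ((lieComm_wick M w).mono hw).smul hc
  | add _ _ hA hB =>
    simp only [map_add]
    exact hA.add hB

/-- On bidegree `(p, q)` the matrix itself is exactly `p` times its normalized `x`-part minus `q`
times its normalized `y`-part. Moving it past a letter to its Wick ordered place costs terms without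
a factor `p` or `q`. The degrees exceed the length so that no normalization divides by zero. -/
lemma lieMul_wick (M : Mat3) (w : List Letter) :
    ∃ R : Fam, Nice (w.length + 1) (fun _ : ι => R) ∧ ∀ p q, w.length < p → w.length < q →
      lieMul M (QuarkSU3.wick w) p q = (p : ℂ) • QuarkSU3.leadX M (QuarkSU3.wick w) p q -
        (q : ℂ) • QuarkSU3.leadY M (QuarkSU3.wick w) p q + R p q := by
  induction w with
  | nil =>
    refine ⟨0, zero, fun p q hp hq => ?_⟩
    have hp' : (p : ℂ) ≠ 0 := Nat.cast_ne_zero.2 (Nat.pos_iff_ne_zero.1 hp)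
    have hq' : (q : ℂ) ≠ 0 := Nat.cast_ne_zero.2 (Nat.pos_iff_ne_zero.1 hq)
    refine LinearMap.ext fun v => ?_
    change lieAct M v = _
    rw [lieAct_apply]
    simp only [leadX_apply, leadY_apply, LinearMap.sub_apply,
      LinearMap.smul_apply, Fam.sum_apply, Fam.smul_apply, LinearMap.sum_apply, cons_apply,
      Fam.zero_apply, add_zero, Finset.smul_sum, Letter.deg, Sum.elim_inl,
      Sum.elim_inr]
    congr 1 <;> refine Finset.sum_congr rfl fun i _ => Finset.sum_congr rfl fun j _ => ?_
    · rw [smul_comm, smul_smul _ ((p : ℂ)⁻¹), mul_inv_cancel₀ hp', one_smul]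
      rfl
    · rw [smul_comm, smul_smul _ ((q : ℂ)⁻¹), mul_inv_cancel₀ hq', one_smul]
      rfl
  | cons ℓ w ih =>
    obtain ⟨R, hR, hRe⟩ := ih
    have hw : Nice w.length (fun _ : ι => QuarkSU3.wick w) := wick w le_rfl
    rcases ℓ with kl | kl
    · refine ⟨QuarkSU3.rowAct M (Sum.inl kl) (QuarkSU3.wick w) -
        QuarkSU3.leadX M (QuarkSU3.cons (Sum.inl kl) (QuarkSU3.wick w)) +
        QuarkSU3.cons (Sum.inl kl) R, ?_, fun p q hp hq => ?_⟩
      · exact (((hw.rowAct M _).mono (by simp)).sub ((hw.cons _).leadX M)).add (hR.cons _)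
      · simp only [List.length_cons] at hp hq
        -- Behind a letter in `x` the first degree is `p - 1`; replacing it by `p` leaves the
        -- `leadX` term of the remainder.
        have h1 := hRe (p - 1) q (by omega) (by omega)
        have h2 : QuarkSU3.cons (Sum.inl kl) (lieMul M (QuarkSU3.wick w)) p q =
            QuarkSU3.cons (Sum.inl kl) (((p - 1 : ℕ) : ℂ) • QuarkSU3.leadX M (QuarkSU3.wick w) -
              (q : ℂ) • QuarkSU3.leadY M (QuarkSU3.wick w) + R) p q := by
          refine LinearMap.ext fun v => ?_
          rw [cons_apply, cons_apply]
          simp only [Letter.lowP, Letter.lowQ, Sum.elim_inl]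
          rw [h1]
          rfl
        rw [QuarkSU3.wick, lieMul_cons, Fam.add_apply, Fam.add_apply, h2, map_add, map_sub, map_smul,
          map_smul, cons_leadX, cons_leadY, Nat.cast_sub (by omega), Nat.cast_one, sub_smul,
          one_smul]
        simp only [Fam.add_apply, Fam.sub_apply, Fam.smul_apply]
        abel
    · refine ⟨QuarkSU3.rowAct M (Sum.inr kl) (QuarkSU3.wick w) +
        QuarkSU3.leadY M (QuarkSU3.cons (Sum.inr kl) (QuarkSU3.wick w)) +
        QuarkSU3.cons (Sum.inr kl) R, ?_, fun p q hp hq => ?_⟩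
      · exact (((hw.rowAct M _).mono (by simp)).add ((hw.cons _).leadY M)).add (hR.cons _)
      · simp only [List.length_cons] at hp hq
        have h1 := hRe p (q - 1) (by omega) (by omega)
        have h2 : QuarkSU3.cons (Sum.inr kl) (lieMul M (QuarkSU3.wick w)) p q =
            QuarkSU3.cons (Sum.inr kl) ((p : ℂ) • QuarkSU3.leadX M (QuarkSU3.wick w) -
              ((q - 1 : ℕ) : ℂ) • QuarkSU3.leadY M (QuarkSU3.wick w) + R) p q := by
          refine LinearMap.ext fun v => ?_
          rw [cons_apply, cons_apply]
          simp only [Letter.lowP, Letter.lowQ, Sum.elim_inr]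
          rw [h1]
          rfl
        rw [QuarkSU3.wick, lieMul_cons, Fam.add_apply, Fam.add_apply, h2, map_add, map_sub, map_smul,
          map_smul, cons_leadX, cons_leadY, Nat.cast_sub (by omega), Nat.cast_one, sub_smul,
          one_smul]
        simp only [Fam.add_apply, Fam.sub_apply, Fam.smul_apply]
        abel

/-- The action of a matrix on a combination of Wick ordered operators, to leading order. -/
lemma lieMul (hA : Nice n A) (M : Mat3) :
    ∃ R : ι → Fam, Nice (n + 1) R ∧ ∀ i p q, n < p → n < q →
      QuarkSU3.lieMul M (A i) p q = (p : ℂ) • QuarkSU3.leadX M (A i) p q -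
        (q : ℂ) • QuarkSU3.leadY M (A i) p q + R i p q := by
  induction hA with
  | smul_wick w hw c C hc =>
    obtain ⟨R, hR, h⟩ := lieMul_wick (ι := ι) M w
    refine ⟨fun i => c i • R, (hR.mono (by omega)).smul hc, fun i p q hp hq => ?_⟩
    have h1 := h p q (by omega) (by omega)
    have h2 : QuarkSU3.lieMul M (c i • QuarkSU3.wick w) p q =
        c i • QuarkSU3.lieMul M (QuarkSU3.wick w) p q := by
      simp only [QuarkSU3.lieMul, Fam.smul_apply, mul_smul_comm]
    rw [h2, h1, map_smul, map_smul]
    simp only [Fam.smul_apply, smul_add, smul_sub, smul_comm (c i)]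
  | @add A B _ _ hA hB =>
    obtain ⟨R, hR, h⟩ := hA
    obtain ⟨R', hR', h'⟩ := hB
    refine ⟨fun i => R i + R' i, hR.add hR', fun i p q hp hq => ?_⟩
    have h2 : QuarkSU3.lieMul M (A i + B i) p q =
        QuarkSU3.lieMul M (A i) p q + QuarkSU3.lieMul M (B i) p q := by
      simp only [QuarkSU3.lieMul, Fam.add_apply, mul_add]
    rw [h2, h i p q hp hq, h' i p q hp hq, map_add, map_add]
    simp only [Fam.add_apply, smul_add]
    abel

end Nice

end

end QuarkSU3

namespace QuarkSU3

open MvPolynomial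

noncomputable section

/-! ### Norm bounds for Wick ordered operators -/

/-- A family of operators preserves bidegrees and is bounded by `C`. -/
def BoundedBy (C : ℝ) (B : Fam) : Prop :=
  ∀ p q, ∀ v ∈ Bideg p q, B p q v ∈ Bideg p q ∧ ‖B p q v‖ ≤ C * ‖v‖

namespace BoundedBy

variable {B B' : Fam} {C C' : ℝ}

/-- Differentiation and multiplication each cost a factor `√d`, and the normalization `d⁻¹` cancels
both. -/
lemma mul_sqrt_le {d : ℕ} (hd : d ≠ 0) (hC : 0 ≤ C) {a b x y : ℝ} (hb : 0 ≤ b)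
    (hab : a ^ 2 ≤ d * b ^ 2) (hbx : b ≤ C * x) (hxy : x ^ 2 ≤ d * y ^ 2) (hy : 0 ≤ y) :
    (d : ℝ)⁻¹ * a ≤ C * y := by
  have hd' : (0 : ℝ) < d := Nat.cast_pos.2 (Nat.pos_of_ne_zero hd)
  rw [inv_mul_le_iff₀ hd']
  refine abs_le_of_sq_le_sq' ?_ (by positivity) |>.2
  calc a ^ 2 ≤ d * b ^ 2 := hab
    _ ≤ d * (C * x) ^ 2 := by gcongr
    _ = d * C ^ 2 * x ^ 2 := by ring
    _ ≤ d * C ^ 2 * (d * y ^ 2) := by gcongr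
    _ = (d * (C * y)) ^ 2 := by ring

lemma cons (hB : BoundedBy C B) (hC : 0 ≤ C) (ℓ : Letter) : BoundedBy C (cons ℓ B) := by
  intro p q v hv
  rw [cons_apply]
  rcases ℓ with ⟨k, l⟩ | ⟨k, l⟩
  -- In degree zero the normalization is `0⁻¹ = 0`, so the operator vanishes.
  · rcases eq_or_ne p 0 with rfl | hp
    · simp only [Letter.deg, Sum.elim_inl, Nat.cast_zero, inv_zero, zero_smul, norm_zero]
      exact ⟨Submodule.zero_mem _, by positivity⟩
    · have hp1 : p - 1 + 1 = p := Nat.succ_pred_eq_of_ne_zero hp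
      obtain ⟨h1, h2⟩ := hB (p - 1) q _ (pderiv_inl_mem hv l)
      have h3 := X_inl_mul_mem h1 k
      have h4 := norm_X_inl_mul_sq_le h1 k
      have h5 : ((p - 1 : ℕ) : ℝ) + 1 = p := by exact_mod_cast hp1
      rw [hp1] at h3
      rw [h5] at h4
      refine ⟨Submodule.smul_mem _ _ h3, ?_⟩
      rw [norm_smul, norm_inv, Complex.norm_natCast]
      exact mul_sqrt_le hp hC (norm_nonneg _) h4 h2 (norm_pderiv_inl_sq_le hv l)
        (norm_nonneg _)
  · rcases eq_or_ne q 0 with rfl | hq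
    · simp only [Letter.deg, Sum.elim_inr, Nat.cast_zero, inv_zero, zero_smul, norm_zero]
      exact ⟨Submodule.zero_mem _, by positivity⟩
    · have hq1 : q - 1 + 1 = q := Nat.succ_pred_eq_of_ne_zero hq
      obtain ⟨h1, h2⟩ := hB p (q - 1) _ (pderiv_inr_mem hv l)
      have h3 := X_inr_mul_mem h1 k
      have h4 := norm_X_inr_mul_sq_le h1 k
      have h5 : ((q - 1 : ℕ) : ℝ) + 1 = q := by exact_mod_cast hq1
      rw [hq1] at h3
      rw [h5] at h4
      refine ⟨Submodule.smul_mem _ _ h3, ?_⟩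
      rw [norm_smul, norm_inv, Complex.norm_natCast]
      exact mul_sqrt_le hq hC (norm_nonneg _) h4 h2 (norm_pderiv_inr_sq_le hv l)
        (norm_nonneg _)

lemma wick (w : List Letter) : BoundedBy 1 (wick w) := by
  induction w with
  | nil => exact fun p q v hv => ⟨hv, by rw [one_mul]; rfl⟩
  | cons ℓ w ih => exact ih.cons zero_le_one ℓ

lemma smul (hB : BoundedBy C B) {c : ℂ} {D : ℝ} (hc : ‖c‖ ≤ D) : BoundedBy (D * C) (c • B) := by
  intro p q v hv
  obtain ⟨h1, h2⟩ := hB p q v hv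
  refine ⟨Submodule.smul_mem _ c h1, ?_⟩
  rw [Fam.smul_apply, LinearMap.smul_apply, norm_smul, mul_assoc]
  exact mul_le_mul hc h2 (norm_nonneg _) ((norm_nonneg _).trans hc)

lemma add (hB : BoundedBy C B) (hB' : BoundedBy C' B') : BoundedBy (C + C') (B + B') := by
  intro p q v hv
  obtain ⟨h1, h2⟩ := hB p q v hv
  obtain ⟨h3, h4⟩ := hB' p q v hv
  refine ⟨Submodule.add_mem _ h1 h3, ?_⟩
  rw [Fam.add_apply, LinearMap.add_apply, add_mul]
  exact (norm_add_le _ _).trans (add_le_add h2 h4)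

end BoundedBy

/-- Only the coefficients vary with the index, while the finitely many words are fixed and have norm
at most one. -/
lemma Nice.exists_boundedBy {ι : Type*} {n : ℕ} {A : ι → Fam} (hA : Nice n A) :
    ∃ C : ℝ, ∀ i, BoundedBy C (A i) := by
  induction hA with
  | smul_wick w hw c C hc => exact ⟨C * 1, fun i => (BoundedBy.wick w).smul (hc i)⟩
  | add _ _ hA hB =>
    obtain ⟨C, hC⟩ := hA
    obtain ⟨D, hD⟩ := hB
    exact ⟨C + D, fun i => (hC i).add (hD i)⟩

/-! ### Symbols of Wick ordered operators -/

/-- The family `B` has the expectation values `f` in the coherent states of `g`, for all bidegrees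
at least `n`. -/
def HasSymbol (g : SU3) (n : ℕ) (B : Fam) (f : ℂ) : Prop :=
  ∀ p q, n ≤ p → n ≤ q → inner ℂ (grpAct g (hwPol p q)) (B p q (grpAct g (hwPol p q))) =
    ((p.factorial : ℂ) * q.factorial) * f

lemma pderiv_inl_hwPol (p q : ℕ) (i : Fin 3) :
    pderiv (Sum.inl i) (hwPol p q) = if i = 0 then (p : ℂ) • hwPol (p - 1) q else 0 := by
  rw [hwPol, pderiv_monomial]
  split_ifs with h
  · subst h
    have e : hwExp p q - Finsupp.single (Sum.inl 0) 1 = hwExp (p - 1) q := by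
      refine Finsupp.ext ?_
      rintro (j | j) <;>
        simp only [hwExp, Finsupp.tsub_apply, Finsupp.add_apply, Finsupp.single_apply] <;>
        split_ifs <;> simp_all
    have e' : hwExp p q (Sum.inl 0) = p := by simp [hwExp]
    rw [e, e', hwPol, smul_monomial, smul_eq_mul, mul_one, one_mul]
  · have : hwExp p q (Sum.inl i) = 0 := by simp [hwExp, Ne.symm h]
    rw [this, Nat.cast_zero, mul_zero, monomial_zero]

lemma pderiv_inr_hwPol (p q : ℕ) (i : Fin 3) :
    pderiv (Sum.inr i) (hwPol p q) = if i = 2 then (q : ℂ) • hwPol p (q - 1) else 0 := by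
  rw [hwPol, pderiv_monomial]
  split_ifs with h
  · subst h
    have e : hwExp p q - Finsupp.single (Sum.inr 2) 1 = hwExp p (q - 1) := by
      refine Finsupp.ext ?_
      rintro (j | j) <;>
        simp only [hwExp, Finsupp.tsub_apply, Finsupp.add_apply, Finsupp.single_apply] <;>
        split_ifs <;> simp_all
    have e' : hwExp p q (Sum.inr 2) = q := by simp [hwExp]
    rw [e, e', hwPol, smul_monomial, smul_eq_mul, mul_one, one_mul]
  · have : hwExp p q (Sum.inr i) = 0 := by simp [hwExp, Ne.symm h]
    rw [this, Nat.cast_zero, mul_zero, monomial_zero]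

lemma pderiv_inl_grpAct_hwPol (g : SU3) (p q : ℕ) (k : Fin 3) :
    pderiv (Sum.inl k) (grpAct g (hwPol p q)) =
      ((g : Mat3) k 0 * p) • grpAct g (hwPol (p - 1) q) := by
  rw [pderiv_grpAct_inl, Finset.sum_eq_single 0]
  · rw [pderiv_inl_hwPol, if_pos rfl, map_smul, smul_smul]
  · intro i _ hi
    rw [pderiv_inl_hwPol, if_neg hi, map_zero, smul_zero]
  · exact fun h => absurd (Finset.mem_univ _) h

lemma pderiv_inr_grpAct_hwPol (g : SU3) (p q : ℕ) (k : Fin 3) :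
    pderiv (Sum.inr k) (grpAct g (hwPol p q)) =
      (star ((g : Mat3) k 2) * q) • grpAct g (hwPol p (q - 1)) := by
  rw [pderiv_grpAct_inr, Finset.sum_eq_single 2]
  · rw [pderiv_inr_hwPol, if_pos rfl, map_smul, smul_smul]
  · intro i _ hi
    rw [pderiv_inr_hwPol, if_neg hi, map_zero, smul_zero]
  · exact fun h => absurd (Finset.mem_univ _) h

namespace HasSymbol

variable {g : SU3} {n m : ℕ} {B B' : Fam} {f f' : ℂ}

lemma one (g : SU3) (n : ℕ) : HasSymbol g n Fam.one 1 := by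
  intro p q _ _
  rw [Fam.one_apply, Module.End.one_apply, inner_grpAct_grpAct, hwPol, inner_monomial_left,
    multiFactorial_hwExp, coeff_monomial, if_pos rfl]

lemma mono (h : n ≤ m) (hB : HasSymbol g n B f) : HasSymbol g m B f :=
  fun p q hp hq => hB p q (h.trans hp) (h.trans hq)

lemma add (hB : HasSymbol g n B f) (hB' : HasSymbol g n B' f') :
    HasSymbol g n (B + B') (f + f') := by
  intro p q hp hq
  rw [Fam.add_apply, LinearMap.add_apply, inner_add_right, hB p q hp hq, hB' p q hp hq, mul_add]

lemma smul (hB : HasSymbol g n B f) (c : ℂ) : HasSymbol g n (c • B) (c * f) := by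
  intro p q hp hq
  rw [Fam.smul_apply, LinearMap.smul_apply, inner_smul_right, hB p q hp hq]
  ring

lemma sub (hB : HasSymbol g n B f) (hB' : HasSymbol g n B' f') :
    HasSymbol g n (B - B') (f - f') := by
  intro p q hp hq
  rw [Fam.sub_apply, LinearMap.sub_apply, inner_sub_right, hB p q hp hq, hB' p q hp hq, mul_sub]

lemma zero : HasSymbol g n 0 0 := by
  intro p q hp hq
  rw [Fam.zero_apply, LinearMap.zero_apply, inner_zero_right, mul_zero]

lemma sum {κ : Type*} (s : Finset κ) {F : κ → Fam} {f : κ → ℂ}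
    (h : ∀ k ∈ s, HasSymbol g n (F k) (f k)) : HasSymbol g n (∑ k ∈ s, F k) (∑ k ∈ s, f k) := by
  classical
  induction s using Finset.induction_on with
  | empty => simpa using zero
  | insert a s ha ih =>
    simp only [Finset.sum_insert ha]
    exact (h a (Finset.mem_insert_self a s)).add
      (ih fun k hk => h k (Finset.mem_insert_of_mem hk))

/-- Moving `x_k` to the left slot as `∂_k`, both derivatives produce `p` times an entry of the first
column of `g` and the coherent state of degree `p - 1`. The factor `p² / p` is absorbed by `p! = p
(p-1)!`. -/
lemma cons_inl (hB : HasSymbol g n B f) (k l : Fin 3) :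
    HasSymbol g (n + 1) (cons (Sum.inl (k, l)) B)
      ((star ((g : Mat3) k 0) * (g : Mat3) l 0) * f) := by
  intro p q hp hq
  obtain ⟨p, rfl⟩ : ∃ r, p = r + 1 := ⟨p - 1, by omega⟩
  have h := hB p q (by omega) (by omega)
  have hp0 : ((p + 1 : ℕ) : ℂ) ≠ 0 := Nat.cast_ne_zero.2 (Nat.succ_ne_zero p)
  rw [cons_apply]
  simp only [Letter.deg, Letter.lowP, Letter.lowQ, Letter.row, Letter.col, Sum.elim_inl,
    Sum.map_inl, Nat.add_sub_cancel]
  rw [inner_smul_right, ← inner_pderiv, pderiv_inl_grpAct_hwPol, pderiv_inl_grpAct_hwPol,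
    Nat.add_sub_cancel, map_smul, inner_smul_left, inner_smul_right, h, Nat.factorial_succ,
    map_mul, Complex.conj_natCast, Nat.cast_mul]
  change _ * (star ((g : Mat3) k 0) * _ * _) = _
  field_simp

lemma cons_inr (hB : HasSymbol g n B f) (k l : Fin 3) :
    HasSymbol g (n + 1) (cons (Sum.inr (k, l)) B)
      ((star ((g : Mat3) l 2) * (g : Mat3) k 2) * f) := by
  intro p q hp hq
  obtain ⟨q, rfl⟩ : ∃ r, q = r + 1 := ⟨q - 1, by omega⟩
  have h := hB p q (by omega) (by omega)
  have hq0 : ((q + 1 : ℕ) : ℂ) ≠ 0 := Nat.cast_ne_zero.2 (Nat.succ_ne_zero q)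
  rw [cons_apply]
  simp only [Letter.deg, Letter.lowP, Letter.lowQ, Letter.row, Letter.col, Sum.elim_inr,
    Sum.map_inr, Nat.add_sub_cancel]
  rw [inner_smul_right, ← inner_pderiv, pderiv_inr_grpAct_hwPol, pderiv_inr_grpAct_hwPol,
    Nat.add_sub_cancel, map_smul, inner_smul_left, inner_smul_right, h, Nat.factorial_succ,
    map_mul, Complex.conj_natCast, Nat.cast_mul, Complex.star_def, Complex.conj_conj]
  field_simp

end HasSymbol

/-- The diagonal entry `(g† A g)_kk`. -/
def conjEntry (g : SU3) (A : Mat3) (k : Fin 3) : ℂ :=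
  ∑ i, ∑ j, A i j * (star ((g : Mat3) i k) * (g : Mat3) j k)

lemma HasSymbol.leadX {g : SU3} {n : ℕ} {B : Fam} {f : ℂ} (hB : HasSymbol g n B f) (A : Mat3) :
    HasSymbol g (n + 1) (leadX A B) (conjEntry g A 0 * f) := by
  rw [leadX_apply]
  simp only [conjEntry, Finset.sum_mul, mul_assoc]
  simp only [← mul_assoc (star _)]
  exact sum _ fun i _ => sum _ fun j _ => (hB.cons_inl i j).smul _

lemma HasSymbol.leadY {g : SU3} {n : ℕ} {B : Fam} {f : ℂ} (hB : HasSymbol g n B f) (A : Mat3) :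
    HasSymbol g (n + 1) (leadY A B) (conjEntry g A 2 * f) := by
  rw [leadY_apply]
  simp only [conjEntry, Finset.sum_mul, mul_assoc]
  simp only [← mul_assoc (star _)]
  exact sum _ fun i _ => sum _ fun j _ => (hB.cons_inr j i).smul _

/-! ### Quantization of noncommutative polynomials -/

/-- Noncommutative polynomials in the coordinates of `su(3)`. -/
abbrev FreePoly : Type := FreeAlgebra ℂ (Fin 8)

/-- The commutative image of a noncommutative polynomial. -/
def polyOf : FreePoly →ₐ[ℂ] PolySU3 := FreeAlgebra.lift ℂ X

lemma polyOf_ι (j : Fin 8) : polyOf (FreeAlgebra.ι ℂ j) = X j := FreeAlgebra.lift_ι_apply _ _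

lemma polyOf_surjective : Function.Surjective polyOf := by
  intro F
  induction F using MvPolynomial.induction_on with
  | C a => exact ⟨algebraMap ℂ _ a, by rw [AlgHom.commutes]; rfl⟩
  | add F G hF hG =>
    obtain ⟨v, rfl⟩ := hF
    obtain ⟨w, rfl⟩ := hG
    exact ⟨v + w, map_add _ _ _⟩
  | mul_X F j hF =>
    obtain ⟨v, rfl⟩ := hF
    exact ⟨v * FreeAlgebra.ι ℂ j, by rw [map_mul, polyOf_ι]⟩

/-- Insertion of the leading parts of the operators of the coordinates into Wick ordered
operators. -/
def quant (a b : ℂ) : FreePoly →ₐ[ℂ] Module.End ℂ Fam :=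
  FreeAlgebra.lift ℂ fun j => (-Complex.I) • (a • leadX (E j) - b • leadY (E j))

lemma quant_ι (a b : ℂ) (j : Fin 8) (B : Fam) : quant a b (FreeAlgebra.ι ℂ j) B =
    (-Complex.I) • (a • leadX (E j) B - b • leadY (E j) B) := by
  rw [quant, FreeAlgebra.lift_ι_apply]
  rfl

lemma quant_algebraMap (a b r : ℂ) (B : Fam) : quant a b (algebraMap ℂ FreePoly r) B = r • B := by
  rw [AlgHom.commutes]
  rfl

lemma quant_mul (a b : ℂ) (v w : FreePoly) (B : Fam) :
    quant a b (v * w) B = quant a b v (quant a b w B) := by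
  rw [map_mul]
  rfl

lemma quant_add (a b : ℂ) (v w : FreePoly) (B : Fam) :
    quant a b (v + w) B = quant a b v B + quant a b w B := by
  rw [map_add]
  rfl

/-- The coordinates of the point of the orbit above which the coherent state of `g` lies. -/
def momentCoord (a b : ℂ) (g : SU3) (j : Fin 8) : ℂ :=
  -Complex.I * (a * conjEntry g (E j) 0 - b * conjEntry g (E j) 2)

/-- Each insertion multiplies the symbol by a coordinate, so the map is multiplicative on symbols
with no error. The threshold `m` counts letters and does not depend on `a`, `b` or `g`. -/
lemma HasSymbol.quant (w : FreePoly) (n : ℕ) : ∃ m, ∀ (a b : ℂ) (g : SU3) (B : Fam) (f : ℂ),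
    HasSymbol g n B f →
      HasSymbol g m (quant a b w B) (MvPolynomial.eval (momentCoord a b g) (polyOf w) * f) := by
  induction w using FreeAlgebra.induction generalizing n with
  | grade0 r =>
    refine ⟨n, fun a b g B f hB => ?_⟩
    rw [quant_algebraMap, AlgHom.commutes, MvPolynomial.algebraMap_eq, eval_C]
    exact hB.smul r
  | grade1 j =>
    refine ⟨n + 1, fun a b g B f hB => ?_⟩
    rw [quant_ι, polyOf_ι, eval_X, momentCoord, mul_assoc, sub_mul, mul_assoc, mul_assoc]
    exact (((hB.leadX _).smul a).sub ((hB.leadY _).smul b)).smul _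
  | mul v w hv hw =>
    obtain ⟨m, hm⟩ := hw n
    obtain ⟨l, hl⟩ := hv m
    refine ⟨l, fun a b g B f hB => ?_⟩
    rw [quant_mul, map_mul, map_mul, mul_assoc]
    exact hl a b g _ _ (hm a b g B f hB)
  | add v w hv hw =>
    obtain ⟨m, hm⟩ := hw n
    obtain ⟨l, hl⟩ := hv n
    refine ⟨max l m, fun a b g B f hB => ?_⟩
    rw [quant_add, map_add, map_add, add_mul]
    exact ((hl a b g B f hB).mono (le_max_left _ _)).add ((hm a b g B f hB).mono (le_max_right _ _))

/-! ### Comparison with the action of the Lie algebra -/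

/-- A family of bidegrees with scales `T` that are bounded below and of at least their order. -/
structure Scaling (ι : Type*) where
  /-- the first degree -/
  p : ι → ℕ
  /-- the second degree -/
  q : ι → ℕ
  /-- the scale -/
  T : ι → ℂ
  /-- the bound -/
  bound : ℝ
  ne_zero : ∀ i, T i ≠ 0
  norm_inv_le : ∀ i, ‖(T i)⁻¹‖ ≤ bound
  norm_p_le : ∀ i, ‖(p i : ℂ) / T i‖ ≤ bound
  norm_q_le : ∀ i, ‖(q i : ℂ) / T i‖ ≤ bound

/-- The action of noncommutative polynomials in which the coordinates act by `E_j / (i T)`. -/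
def act (T : ℂ) : FreePoly →ₐ[ℂ] Module.End ℂ Pol :=
  FreeAlgebra.lift ℂ fun j => (Complex.I * T)⁻¹ • lieOp (E j)

lemma act_ι (T : ℂ) (j : Fin 8) :
    act T (FreeAlgebra.ι ℂ j) = (Complex.I * T)⁻¹ • lieOp (E j) :=
  FreeAlgebra.lift_ι_apply _ _

namespace Scaling

variable {ι : Type*} (S : Scaling ι)

/-- The quantization at the ratios of the degrees to the scale. -/
def quant (i : ι) : FreePoly →ₐ[ℂ] Module.End ℂ Fam :=
  QuarkSU3.quant ((S.p i : ℂ) / S.T i) ((S.q i : ℂ) / S.T i)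

lemma nice_quant (w : FreePoly) {n : ℕ} {A : ι → Fam} (hA : Nice n A) :
    ∃ m, Nice m (fun i => S.quant i w (A i)) := by
  induction w using FreeAlgebra.induction generalizing n A with
  | grade0 r =>
    refine ⟨n, ?_⟩
    simp only [quant, quant_algebraMap]
    exact hA.const_smul r
  | grade1 j =>
    refine ⟨n + 1, ?_⟩
    simp only [quant, quant_ι]
    exact (((hA.leadX _).smul S.norm_p_le).sub ((hA.leadY _).smul S.norm_q_le)).const_smul _
  | mul v w hv hw =>
    obtain ⟨m, hm⟩ := hw hA
    obtain ⟨l, hl⟩ := hv hm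
    refine ⟨l, ?_⟩
    simp only [quant, quant_mul]
    exact hl
  | add v w hv hw =>
    obtain ⟨m, hm⟩ := hw hA
    obtain ⟨l, hl⟩ := hv hA
    refine ⟨max l m, ?_⟩
    simp only [quant, quant_add]
    exact (hl.mono (le_max_left _ _)).add (hm.mono (le_max_right _ _))

/-- Dividing the leading order formula for one matrix by `i T` gives the case of a coordinate. The
statement is for all families `A`, so that in a product the second factor can be absorbed into the
family. -/
lemma exists_act_mul_eq (w : FreePoly) {n : ℕ} {A : ι → Fam} (hA : Nice n A) :
    ∃ m, ∃ R : ι → Fam, Nice m R ∧ ∀ i, m ≤ S.p i → m ≤ S.q i →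
      act (S.T i) w * A i (S.p i) (S.q i) =
        S.quant i w (A i) (S.p i) (S.q i) + (S.T i)⁻¹ • R i (S.p i) (S.q i) := by
  induction w using FreeAlgebra.induction generalizing n A with
  | grade0 r =>
    refine ⟨n, fun _ => 0, Nice.zero, fun i _ _ => ?_⟩
    change _ = S.quant i _ (A i) (S.p i) (S.q i) + (S.T i)⁻¹ • (0 : Fam) (S.p i) (S.q i)
    rw [quant, quant_algebraMap, AlgHom.commutes, Fam.zero_apply, smul_zero, add_zero]
    exact (Algebra.smul_def r _).symm
  | grade1 j =>
    obtain ⟨R, hR, h⟩ := hA.lieMul (E j)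
    refine ⟨n + 1, _, hR.const_smul (-Complex.I), fun i hp hq => ?_⟩
    have h1 := h i _ _ hp hq
    have hT := S.ne_zero i
    have h2 : act (S.T i) (FreeAlgebra.ι ℂ j) * A i (S.p i) (S.q i) =
        (Complex.I * S.T i)⁻¹ • lieMul (E j) (A i) (S.p i) (S.q i) := by
      rw [act_ι, smul_mul_assoc]
      rfl
    rw [h2, h1, quant, quant_ι]
    refine LinearMap.ext fun v => ?_
    simp only [Fam.smul_apply, Fam.sub_apply, LinearMap.smul_apply, LinearMap.add_apply,
      LinearMap.sub_apply, smul_add, smul_sub, smul_smul, mul_inv, Complex.inv_I, div_eq_mul_inv]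
    congr 1
    · congr 1 <;> congr 1 <;> ring
    · congr 1
      ring
  | mul v w hv hw =>
    obtain ⟨m, R, hR, h⟩ := hw hA
    obtain ⟨k, hk⟩ := S.nice_quant w hA
    -- The left factor is applied to the whole result for the right one, remainder included; the
    -- total remainder is then the quantization of `v` on `R` plus `R'`.
    obtain ⟨m', R', hR', h'⟩ := hv ((hk.mono (le_max_left k m)).add
      ((hR.smul S.norm_inv_le).mono (le_max_right k m)))
    obtain ⟨l, hl⟩ := S.nice_quant v hR
    refine ⟨max m (max l m'), _, ((hl.mono (le_max_left l m')).add
      (hR'.mono (le_max_right l m'))).mono (le_max_right m _), fun i hp hq => ?_⟩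
    simp only [max_le_iff] at hp hq
    have h1 := h i hp.1 hq.1
    have h2 := h' i hp.2.2 hq.2.2
    rw [map_mul, mul_assoc, h1]
    rw [Fam.add_apply, Fam.smul_apply] at h2
    rw [h2, map_add, map_smul, Fam.add_apply, Fam.smul_apply, Fam.add_apply, smul_add, add_assoc,
      quant, quant_mul]
  | add v w hv hw =>
    obtain ⟨m, R, hR, h⟩ := hw hA
    obtain ⟨l, R', hR', h'⟩ := hv hA
    refine ⟨max l m, _, (hR'.mono (le_max_left l m)).add (hR.mono (le_max_right l m)),
      fun i hp hq => ?_⟩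
    simp only [max_le_iff] at hp hq
    rw [map_add, add_mul, h' i hp.1 hq.1, h i hp.2 hq.2, quant, quant_add, Fam.add_apply,
      Fam.add_apply, smul_add]
    exact add_add_add_comm _ _ _ _

end Scaling

end

end QuarkSU3

namespace QuarkSU3

open MvPolynomial Filter

noncomputable section

/-! ### Compression of operators to the quark systems -/

/-- The orthogonal projection onto `H_(p,q)`. -/
def quarkProj (p q : ℕ) : Pol →ₗ[ℂ] quarkSpace p q :=
  ((quarkSpace p q).orthogonalProjectionOnto : Pol →L[ℂ] quarkSpace p q).toLinearMap

lemma inner_quarkProj {p q : ℕ} (u : quarkSpace p q) (v : Pol) :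
    inner ℂ u (quarkProj p q v) = inner ℂ (u : Pol) v := by
  rw [Submodule.coe_inner]
  exact Submodule.inner_orthogonalProjectionOnto_eq_of_mem_left u v

lemma norm_quarkProj_le {p q : ℕ} (v : Pol) : ‖(quarkProj p q v : Pol)‖ ≤ ‖v‖ :=
  Submodule.norm_orthogonalProjectionOnto_apply_le (quarkSpace p q) v

lemma quarkProj_coe {p q : ℕ} (v : quarkSpace p q) : quarkProj p q (v : Pol) = v :=
  Submodule.orthogonalProjectionOnto_mem_subspace_eq_self v

lemma conjTranspose_mem_sl (A : sl3) : (A : Mat3).conjTranspose ∈ LieAlgebra.SpecialLinear.sl (Fin 3) ℂ := by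
  have h : Matrix.trace (A : Mat3) = 0 := A.2
  change Matrix.trace (A : Mat3).conjTranspose = 0
  rw [Matrix.trace_conjTranspose, h, star_zero]

/-- The quark space is invariant under `A†` as well, since `sl(3)` is closed under adjoints, so the
orthogonal projection onto it intertwines the actions. -/
lemma quarkProj_lieAct {p q : ℕ} (A : sl3) (v : Pol) :
    quarkProj p q (lieAct (A : Mat3) v) = lieRep p q A (quarkProj p q v) := by
  refine ext_inner_left ℂ fun u => ?_
  have h : inner ℂ u (lieRep p q A (quarkProj p q v)) =
      inner ℂ (lieRep p q ⟨_, conjTranspose_mem_sl A⟩ u) (quarkProj p q v) := by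
    rw [Submodule.coe_inner, Submodule.coe_inner, coe_lieRep, coe_lieRep, inner_lieAct,
      Matrix.conjTranspose_conjTranspose]
  rw [h, inner_quarkProj, inner_quarkProj, coe_lieRep, inner_lieAct,
    Matrix.conjTranspose_conjTranspose]

/-- Compression of an operator on polynomials to `H_(p,q)`. -/
def compress (p q : ℕ) : Module.End ℂ Pol →ₗ[ℂ] Module.End ℂ (quarkSpace p q) where
  toFun A := (quarkProj p q).comp (A.comp (quarkSpace p q).subtype)
  map_add' A B := by
    refine LinearMap.ext fun v => ?_
    exact map_add (quarkProj p q) (A (v : Pol)) (B (v : Pol))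
  map_smul' c A := by
    refine LinearMap.ext fun v => ?_
    exact map_smul (quarkProj p q) c (A (v : Pol))

lemma compress_apply {p q : ℕ} (A : Module.End ℂ Pol) (v : quarkSpace p q) :
    compress p q A v = quarkProj p q (A (v : Pol)) := rfl

/-- Compression is not multiplicative in general, since Wick ordered operators need not preserve the
quark space; it is so when one factor is a Lie algebra element. -/
lemma compress_lieOp_mul {p q : ℕ} (A : sl3) (B : Module.End ℂ Pol) :
    compress p q (lieOp (A : Mat3) * B) = lieRep p q A * compress p q B :=
  LinearMap.ext fun v => quarkProj_lieAct A (B (v : Pol))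

lemma compress_mul_lieOp {p q : ℕ} (A : sl3) (B : Module.End ℂ Pol) :
    compress p q (B * lieOp (A : Mat3)) = compress p q B * lieRep p q A := rfl

/-! ### The action of the enveloping algebra -/

lemma trace_E (j : Fin 8) : Matrix.trace (E j) = 0 := by
  rw [E, Matrix.trace_smul]
  have : Matrix.trace (gellMann j) = 0 := by
    fin_cases j <;> simp [gellMann, Matrix.trace, Fin.sum_univ_three]
    ring
  rw [this, smul_zero]

/-- The basis element `E_j` as an element of `sl(3)`. -/
def slE (j : Fin 8) : sl3 := ⟨E j, trace_E j⟩

lemma coe_slE (j : Fin 8) : (slE j : Mat3) = E j := rfl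

/-- Completeness of the Gell-Mann matrices among traceless complex matrices, by expanding each
entry. -/
lemma eq_sum_coord {A : Mat3} (hA : Matrix.trace A = 0) : A = ∑ l, coord A l • E l := by
  have h3 : (1 / ((Real.sqrt 3 : ℝ) : ℂ)) * (1 / ((Real.sqrt 3 : ℝ) : ℂ)) = 1 / 3 := by
    rw [div_mul_div_comm, ← Complex.ofReal_mul, Real.mul_self_sqrt (by norm_num)]; norm_num
  have h2 : star (Complex.I / ((Real.sqrt 2 : ℝ) : ℂ)) * (Complex.I / ((Real.sqrt 2 : ℝ) : ℂ)) =
      1 / 2 := by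
    have : ((Real.sqrt 2 : ℝ) : ℂ) * ((Real.sqrt 2 : ℝ) : ℂ) = 2 := by
      rw [← Complex.ofReal_mul, Real.mul_self_sqrt (by norm_num)]; norm_num
    rw [Complex.star_def, map_div₀, Complex.conj_I, Complex.conj_ofReal, div_mul_div_comm, this,
      neg_mul, Complex.I_mul_I, neg_neg]
  have h : ∀ l, coord A l • E l = (1 / 2 : ℂ) • trInner (gellMann l) A • gellMann l := by
    intro l
    rw [coord, trInner, E, Matrix.conjTranspose_smul, Matrix.smul_mul, Matrix.trace_smul,
      smul_smul, smul_smul, ← h2, trInner, smul_eq_mul]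
    congr 1
    ring
  simp only [h]
  rw [← Finset.smul_sum]
  have hI := Complex.I_mul_I
  have hc : (starRingEnd ℂ) 2 = 2 := map_ofNat _ 2
  rw [Matrix.trace, Fin.sum_univ_three] at hA
  simp only [Matrix.diag_apply] at hA
  ext i j
  fin_cases i <;> fin_cases j <;>
    simp [Fin.sum_univ_eight, gellMann, trInner, Matrix.trace, Fin.sum_univ_three, Matrix.mul_apply,
      -one_div, hc]
  · linear_combination (1 / 3) * hA - 1 / 2 * (A 0 0 + A 1 1 - 2 * A 2 2) * h3
  · linear_combination 1 / 2 * (A 0 1 - A 1 0) * hI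
  · linear_combination 1 / 2 * (A 0 2 - A 2 0) * hI
  · linear_combination 1 / 2 * (A 1 0 - A 0 1) * hI
  · linear_combination (1 / 3) * hA - 1 / 2 * (A 0 0 + A 1 1 - 2 * A 2 2) * h3
  · linear_combination 1 / 2 * (A 1 2 - A 2 1) * hI
  · linear_combination 1 / 2 * (A 2 0 - A 0 2) * hI
  · linear_combination 1 / 2 * (A 2 1 - A 1 2) * hI
  · linear_combination (1 / 3) * hA + (A 0 0 + A 1 1 - 2 * A 2 2) * h3

lemma commutator_E (j k : Fin 8) : E j * E k - E k * E j = ∑ l, structConst j k l • E l :=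
  eq_sum_coord (by rw [Matrix.trace_sub, Matrix.trace_mul_comm, sub_self])

lemma slE_lie (j k : Fin 8) : ⁅slE j, slE k⁆ = ∑ l, structConst j k l • slE l := by
  apply Subtype.ext
  have h : ((∑ l, structConst j k l • slE l : sl3) : Mat3) = ∑ l, structConst j k l • E l := by
    rw [AddSubmonoidClass.coe_finsetSum]
    rfl
  rw [h, ← commutator_E]
  rfl

/-- The homomorphism to the enveloping algebra that takes the coordinates to `E_j / (i T)`. -/
def env (T : ℂ) : FreePoly →ₐ[ℂ] Usl3 :=
  FreeAlgebra.lift ℂ fun j => (Complex.I * T)⁻¹ • UniversalEnvelopingAlgebra.ι ℂ (slE j)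

lemma env_ι (T : ℂ) (j : Fin 8) : env T (FreeAlgebra.ι ℂ j) =
    (Complex.I * T)⁻¹ • UniversalEnvelopingAlgebra.ι ℂ (slE j) :=
  FreeAlgebra.lift_ι_apply _ _

lemma coe_envRep_env (p q : ℕ) (T : ℂ) (w : FreePoly) (v : quarkSpace p q) :
    (envRep p q (env T w) v : Pol) = act T w (v : Pol) := by
  induction w using FreeAlgebra.induction generalizing v with
  | grade0 r =>
    rw [AlgHom.commutes, AlgHom.commutes, AlgHom.commutes]
    rfl
  | grade1 j =>
    rw [env_ι, act_ι, map_smul, envRep_ι]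
    rfl
  | mul x y hx hy =>
    rw [map_mul, map_mul, map_mul, Module.End.mul_apply, Module.End.mul_apply, hx, hy]
  | add x y hx hy =>
    rw [map_add, map_add, map_add, LinearMap.add_apply, LinearMap.add_apply, Submodule.coe_add, hx,
      hy]

lemma envRep_env_ι (p q : ℕ) (T : ℂ) (j : Fin 8) :
    envRep p q (env T (FreeAlgebra.ι ℂ j)) = (Complex.I * T)⁻¹ • lieRep p q (slE j) := by
  rw [env_ι, map_smul, envRep_ι]

lemma envRep_env_eq_compress (p q : ℕ) (T : ℂ) (w : FreePoly) :
    envRep p q (env T w) = compress p q (act T w) := by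
  refine LinearMap.ext fun v => ?_
  rw [compress_apply, ← coe_envRep_env, quarkProj_coe]

/-! ### Commutators in the enveloping algebra -/

lemma poisson_mul_right (F G H : PolySU3) :
    poisson F (G * H) = poisson F G * H + G * poisson F H := by
  simp only [poisson, pderiv_mul, Finset.sum_mul, Finset.mul_sum, ← Finset.sum_add_distrib]
  refine Finset.sum_congr rfl fun j _ => Finset.sum_congr rfl fun k _ =>
    Finset.sum_congr rfl fun l _ => ?_
  ring

lemma poisson_mul_left (F G H : PolySU3) :
    poisson (F * G) H = F * poisson G H + poisson F H * G := by
  simp only [poisson, pderiv_mul, Finset.sum_mul, Finset.mul_sum, ← Finset.sum_add_distrib]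
  refine Finset.sum_congr rfl fun j _ => Finset.sum_congr rfl fun k _ =>
    Finset.sum_congr rfl fun l _ => ?_
  ring

lemma poisson_add_right (F G H : PolySU3) : poisson F (G + H) = poisson F G + poisson F H := by
  simp only [poisson, map_add, mul_add, Finset.sum_add_distrib]

lemma poisson_add_left (F G H : PolySU3) : poisson (F + G) H = poisson F H + poisson G H := by
  simp only [poisson, map_add, mul_add, add_mul, Finset.sum_add_distrib]

lemma poisson_C_right (F : PolySU3) (a : ℂ) : poisson F (C a) = 0 := by
  simp [poisson]

lemma poisson_C_left (F : PolySU3) (a : ℂ) : poisson (C a) F = 0 := by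
  simp [poisson]

lemma poisson_X_X (j k : Fin 8) :
    poisson (X j) (X k) = ∑ l, C (structConst k j l) * X l := by
  rw [poisson, Finset.sum_eq_single j, Finset.sum_eq_single k]
  · simp
  · intro i _ hi
    simp [pderiv_X_of_ne hi.symm]
  · simp
  · intro i _ hi
    simp [pderiv_X_of_ne hi.symm]
  · simp

lemma structConst_swap (j k l : Fin 8) : structConst k j l = -structConst j k l := by
  rw [structConst, structConst, trInner, trInner, ← neg_sub (E j * E k), Matrix.mul_neg,
    Matrix.trace_neg]

/-- Rescaled commutators in the enveloping algebra are given by noncommutative lifts of the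
Poisson bracket. -/
def IsBracket (u v w : FreePoly) : Prop :=
  polyOf u = C Complex.I * poisson (polyOf v) (polyOf w) ∧
    ∀ T : ℂ, T ≠ 0 → T • (env T v * env T w - env T w * env T v) = env T u

lemma smul_commutator_mul_right {A : Type*} [Ring A] [Algebra ℂ A] (t : ℂ) (x y z : A) :
    t • (x * (y * z) - y * z * x) = t • (x * y - y * x) * z + y * (t • (x * z - z * x)) := by
  rw [smul_mul_assoc, mul_smul_comm, ← smul_add]
  congr 1
  noncomm_ring

lemma smul_commutator_mul_left {A : Type*} [Ring A] [Algebra ℂ A] (t : ℂ) (x y z : A) :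
    t • (x * y * z - z * (x * y)) = x * (t • (y * z - z * y)) + t • (x * z - z * x) * y := by
  rw [smul_mul_assoc, mul_smul_comm, ← smul_add]
  congr 1
  noncomm_ring

lemma smul_commutator_add_right {A : Type*} [Ring A] [Algebra ℂ A] (t : ℂ) (x y z : A) :
    t • (x * (y + z) - (y + z) * x) = t • (x * y - y * x) + t • (x * z - z * x) := by
  rw [← smul_add]
  congr 1
  noncomm_ring

lemma smul_commutator_add_left {A : Type*} [Ring A] [Algebra ℂ A] (t : ℂ) (x y z : A) :
    t • ((x + y) * z - z * (x + y)) = t • (x * z - z * x) + t • (y * z - z * y) := by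
  rw [← smul_add]
  congr 1
  noncomm_ring

lemma exists_isBracket_ι_ι (j k : Fin 8) :
    ∃ u, IsBracket u (FreeAlgebra.ι ℂ j) (FreeAlgebra.ι ℂ k) := by
  -- The square of `1 / i` swaps the lower indices of the structure constants by its sign, and
  -- rewriting `E_l / T` as `i` times `E_l / (i T)` gives the factor `i`.
  refine ⟨∑ l, (Complex.I * structConst k j l) • FreeAlgebra.ι ℂ l, ?_, fun T hT => ?_⟩
  · rw [polyOf_ι, polyOf_ι, poisson_X_X, map_sum, Finset.mul_sum]
    refine Finset.sum_congr rfl fun l _ => ?_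
    rw [map_smul, polyOf_ι, MvPolynomial.smul_eq_C_mul, C_mul, mul_assoc]
  · have h : UniversalEnvelopingAlgebra.ι ℂ (slE j) * UniversalEnvelopingAlgebra.ι ℂ (slE k) -
        UniversalEnvelopingAlgebra.ι ℂ (slE k) * UniversalEnvelopingAlgebra.ι ℂ (slE j) =
        ∑ l, structConst j k l • UniversalEnvelopingAlgebra.ι ℂ (slE l) := by
      rw [← Ring.lie_def, ← LieHom.map_lie, slE_lie, map_sum]
      simp only [map_smul]
    rw [env_ι, env_ι, smul_mul_smul_comm, smul_mul_smul_comm, ← smul_sub, h, smul_smul, map_sum,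
      Finset.smul_sum]
    refine Finset.sum_congr rfl fun l _ => ?_
    rw [map_smul, env_ι, smul_smul, smul_smul, structConst_swap]
    congr 1
    have hI := Complex.I_ne_zero
    have hII := Complex.I_mul_I
    field_simp
    rw [Complex.I_sq]
    ring

lemma exists_isBracket_ι_left (j : Fin 8) (w : FreePoly) :
    ∃ u, IsBracket u (FreeAlgebra.ι ℂ j) w := by
  induction w using FreeAlgebra.induction with
  | grade0 r =>
    refine ⟨0, ?_, fun T _ => ?_⟩
    · rw [AlgHom.commutes, MvPolynomial.algebraMap_eq, poisson_C_right, mul_zero, map_zero]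
    · rw [AlgHom.commutes, Algebra.commutes r, sub_self, smul_zero, map_zero]
  | grade1 k => exact exists_isBracket_ι_ι j k
  | mul v w hv hw =>
    obtain ⟨a, ha, ha'⟩ := hv
    obtain ⟨b, hb, hb'⟩ := hw
    refine ⟨a * w + v * b, ?_, fun T hT => ?_⟩
    · rw [map_add, map_mul, map_mul, map_mul, ha, hb, poisson_mul_right]
      ring
    · rw [map_add, map_mul, map_mul, map_mul, ← ha' T hT, ← hb' T hT, smul_commutator_mul_right]
  | add v w hv hw =>
    obtain ⟨a, ha, ha'⟩ := hv
    obtain ⟨b, hb, hb'⟩ := hw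
    refine ⟨a + b, ?_, fun T hT => ?_⟩
    · rw [map_add, map_add, ha, hb, poisson_add_right, mul_add]
    · rw [map_add, map_add, ← ha' T hT, ← hb' T hT, smul_commutator_add_right]

/-- Commutator and Poisson bracket obey the same Leibniz rules in each argument, so the lift is
propagated from the generators, keeping the order of factors that the commutator dictates. -/
lemma exists_isBracket (v w : FreePoly) : ∃ u, IsBracket u v w := by
  induction v using FreeAlgebra.induction with
  | grade0 r =>
    refine ⟨0, ?_, fun T _ => ?_⟩
    · rw [AlgHom.commutes, MvPolynomial.algebraMap_eq, poisson_C_left, mul_zero, map_zero]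
    · rw [AlgHom.commutes, Algebra.commutes r, sub_self, smul_zero, map_zero]
  | grade1 j => exact exists_isBracket_ι_left j w
  | mul x y hx hy =>
    obtain ⟨a, ha, ha'⟩ := hx
    obtain ⟨b, hb, hb'⟩ := hy
    refine ⟨x * b + a * y, ?_, fun T hT => ?_⟩
    · rw [map_add, map_mul, map_mul, map_mul, ha, hb, poisson_mul_left]
      ring
    · rw [map_add, map_mul, map_mul, map_mul, ← ha' T hT, ← hb' T hT, smul_commutator_mul_left]
  | add x y hx hy =>
    obtain ⟨a, ha, ha'⟩ := hx
    obtain ⟨b, hb, hb'⟩ := hy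
    refine ⟨a + b, ?_, fun T hT => ?_⟩
    · rw [map_add, map_add, ha, hb, poisson_add_left, mul_add]
    · rw [map_add, map_add, ← ha' T hT, ← hb' T hT, smul_commutator_add_left]

end

end QuarkSU3

namespace QuarkSU3

open MvPolynomial Filter

noncomputable section

/-! ### Uniformly bounded families of operators on quark systems -/

/-- `A` is bounded by `C` for the Fischer norm. -/
def OpBound {p q : ℕ} (C : ℝ) (A : Module.End ℂ (quarkSpace p q)) : Prop :=
  ∀ v : quarkSpace p q, ‖(A v : Pol)‖ ≤ C * ‖(v : Pol)‖

lemma opBound_compress {p q : ℕ} {C : ℝ} {B : Fam} (hB : BoundedBy C B) :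
    OpBound C (compress p q (B p q)) := fun v =>
  (norm_quarkProj_le _).trans (hB p q v (quarkSpace_le p q v.2)).2

/-! ### Algebra of operators with corrections of order `1 / t` -/

section

variable {V : Type*} [AddCommGroup V] [Module ℂ V]

lemma smul_commutator_algebraMap (t r : ℂ) (x : Module.End ℂ V) :
    t • (algebraMap ℂ (Module.End ℂ V) r * x - x * algebraMap ℂ (Module.End ℂ V) r) = 0 := by
  rw [Algebra.commutes r, sub_self, smul_zero]

lemma smul_commutator_smul (t c : ℂ) (x y : Module.End ℂ V) :
    t • (c • x * y - y * c • x) = (t * c) • (x * y - y * x) := by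
  rw [smul_mul_assoc, mul_smul_comm, ← smul_sub, smul_smul]

variable {t : ℂ} {x x' r y y' r' z z' s : Module.End ℂ V}

lemma smul_product_defect (ht : t ≠ 0) (hx : x = x' + t⁻¹ • r) (hy : y = y' + t⁻¹ • r')
    (hz : z = z' + t⁻¹ • s) (h : z = x * y) :
    t • (x' * y' - z') = s - x * r' - r * y' := by
  have e : x' * y' - z' = t⁻¹ • (s - x * r' - r * y') := by
    have h1 : z' = x * y - t⁻¹ • s := by rw [← h, hz, add_sub_cancel_right]
    rw [h1, hx, hy]
    simp only [smul_sub, add_mul, mul_add, mul_smul_comm, smul_mul_assoc, smul_add]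
    abel
  rw [e, smul_inv_smul₀ ht]

/-- The right side isolates the terms `t [y, r]` and `t [x, r']`, the only ones that boundedness of
the operators alone does not control. -/
lemma smul_commutator_defect (ht : t ≠ 0) (hx : x = x' + t⁻¹ • r) (hy : y = y' + t⁻¹ • r')
    (hz : z = z' + t⁻¹ • s) (h : t • (x * y - y * x) = z) :
    t • (t • (x' * y' - y' * x') - z') =
      s + t • (y * r - r * y) - t • (x * r' - r' * x) + (r * r' - r' * r) := by
  have h1 : z' = t • (x * y - y * x) - t⁻¹ • s := by rw [h, hz, add_sub_cancel_right]
  have e : t • (x' * y' - y' * x') - z' =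
      t⁻¹ • (s + t • (y * r - r * y) - t • (x * r' - r' * x) + (r * r' - r' * r)) := by
    have hx' : x' = x - t⁻¹ • r := by rw [hx, add_sub_cancel_right]
    have hy' : y' = y - t⁻¹ • r' := by rw [hy, add_sub_cancel_right]
    rw [h1, hx', hy']
    simp only [smul_sub, sub_mul, mul_sub, mul_smul_comm, smul_mul_assoc, smul_add,
      smul_inv_smul₀ ht, inv_smul_smul₀ ht]
    abel
  rw [e, smul_inv_smul₀ ht]

end

/-! ### Asymptotics of products and commutators for large degrees -/

namespace Scaling

variable {ι : Type*} (S : Scaling ι)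

/-- The filter along which both degrees tend to infinity. -/
def largeDegrees : Filter ι := comap S.p atTop ⊓ comap S.q atTop

lemma eventually_iff {P : ι → Prop} :
    (∀ᶠ i in S.largeDegrees, P i) ↔ ∃ m, ∀ i, m ≤ S.p i → m ≤ S.q i → P i := by
  constructor
  · intro h
    rw [largeDegrees, Filter.eventually_inf] at h
    obtain ⟨s, hs, t, ht, h⟩ := h
    obtain ⟨s', hs', hss⟩ := mem_comap.1 hs
    obtain ⟨t', ht', htt⟩ := mem_comap.1 ht
    obtain ⟨a, ha⟩ := mem_atTop_sets.1 hs'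
    obtain ⟨b, hb⟩ := mem_atTop_sets.1 ht'
    exact ⟨max a b, fun i hp hq => h i ⟨hss (ha _ ((le_max_left _ _).trans hp)),
      htt (hb _ ((le_max_right _ _).trans hq))⟩⟩
  · rintro ⟨m, h⟩
    have h1 : ∀ᶠ i in S.largeDegrees, m ≤ S.p i :=
      (tendsto_comap.eventually_ge_atTop m).filter_mono inf_le_left
    have h2 : ∀ᶠ i in S.largeDegrees, m ≤ S.q i :=
      (tendsto_comap.eventually_ge_atTop m).filter_mono inf_le_right
    filter_upwards [h1, h2] with i h1 h2 using h i h1 h2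

/-- The operators on the quark space of the bidegree of the index `i`. -/
abbrev Op (i : ι) : Type := Module.End ℂ (quarkSpace (S.p i) (S.q i))

/-- A family of operators on quark spaces is uniformly bounded for large degrees. -/
def Bounded (A : ∀ i, S.Op i) : Prop := ∃ C : ℝ, ∀ᶠ i in S.largeDegrees, OpBound C (A i)

variable {S}

lemma Bounded.congr {A B : ∀ i, S.Op i} (hA : S.Bounded A)
    (h : ∀ᶠ i in S.largeDegrees, A i = B i) : S.Bounded B := by
  obtain ⟨C, hC⟩ := hA
  exact ⟨C, by filter_upwards [hC, h] with i hC h using h ▸ hC⟩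

lemma Bounded.add {A B : ∀ i, S.Op i} (hA : S.Bounded A) (hB : S.Bounded B) :
    S.Bounded (fun i => A i + B i) := by
  obtain ⟨C, hC⟩ := hA
  obtain ⟨D, hD⟩ := hB
  refine ⟨C + D, ?_⟩
  filter_upwards [hC, hD] with i hC hD v
  rw [LinearMap.add_apply, Submodule.coe_add, add_mul]
  exact (norm_add_le _ _).trans (add_le_add (hC v) (hD v))

lemma Bounded.smul {A : ∀ i, S.Op i} (hA : S.Bounded A) {c : ι → ℂ} {D : ℝ}
    (hc : ∀ i, ‖c i‖ ≤ D) : S.Bounded (fun i => c i • A i) := by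
  obtain ⟨C, hC⟩ := hA
  refine ⟨D * C, ?_⟩
  filter_upwards [hC] with i hC v
  rw [LinearMap.smul_apply, Submodule.coe_smul, norm_smul, mul_assoc]
  exact mul_le_mul (hc i) (hC v) (norm_nonneg _) ((norm_nonneg _).trans (hc i))

lemma Bounded.sub {A B : ∀ i, S.Op i} (hA : S.Bounded A) (hB : S.Bounded B) :
    S.Bounded (fun i => A i - B i) := by
  obtain ⟨C, hC⟩ := hA
  obtain ⟨D, hD⟩ := hB
  refine ⟨C + D, ?_⟩
  filter_upwards [hC, hD] with i hC hD v
  rw [LinearMap.sub_apply, AddSubgroupClass.coe_sub, add_mul]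
  exact (norm_sub_le _ _).trans (add_le_add (hC v) (hD v))

lemma Bounded.mul {A B : ∀ i, S.Op i} (hA : S.Bounded A) (hB : S.Bounded B) :
    S.Bounded (fun i => A i * B i) := by
  obtain ⟨C, hC⟩ := hA
  obtain ⟨D, hD⟩ := hB
  refine ⟨|C| * D, ?_⟩
  filter_upwards [hC, hD] with i hC hD v
  rw [Module.End.mul_apply, mul_assoc]
  calc ‖(A i (B i v) : Pol)‖ ≤ C * ‖(B i v : Pol)‖ := hC _
    _ ≤ |C| * ‖(B i v : Pol)‖ := by gcongr; exact le_abs_self C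
    _ ≤ |C| * (D * ‖(v : Pol)‖) := by gcongr; exact hD v

variable (S)

lemma bounded_compress {n : ℕ} {A : ι → Fam} (hA : Nice n A) :
    S.Bounded (fun i => compress (S.p i) (S.q i) (A i (S.p i) (S.q i))) := by
  obtain ⟨C, hC⟩ := hA.exists_boundedBy
  exact ⟨C, Eventually.of_forall fun i => opBound_compress (hC i)⟩

/-- The representation of noncommutative polynomials, in which the coordinates act by
`E_j / (i T)`. -/
def rep (i : ι) : FreePoly →ₐ[ℂ] S.Op i := (envRep (S.p i) (S.q i)).comp (env (S.T i))

/-- The compression of the leading part of the operator of a noncommutative polynomial. -/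
def op (i : ι) (w : FreePoly) : S.Op i :=
  compress (S.p i) (S.q i) (S.quant i w Fam.one (S.p i) (S.q i))

lemma nice_one : Nice 0 (fun _ : ι => Fam.one) := Nice.wick [] le_rfl

lemma exists_rep_eq (w : FreePoly) : ∃ n, ∃ R : ι → Fam, Nice n R ∧ ∀ᶠ i in S.largeDegrees,
    S.rep i w = S.op i w + (S.T i)⁻¹ • compress (S.p i) (S.q i) (R i (S.p i) (S.q i)) := by
  obtain ⟨m, R, hR, h⟩ := S.exists_act_mul_eq w nice_one
  refine ⟨m, R, hR, S.eventually_iff.2 ⟨m, fun i hp hq => ?_⟩⟩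
  have h1 := h i hp hq
  rw [Fam.one_apply, mul_one] at h1
  change envRep (S.p i) (S.q i) (env (S.T i) w) = _
  rw [envRep_env_eq_compress, h1, map_add, map_smul]
  rfl

lemma bounded_op (w : FreePoly) : S.Bounded (fun i => S.op i w) := by
  obtain ⟨m, hm⟩ := S.nice_quant w (nice_one (ι := ι))
  exact S.bounded_compress hm

lemma bounded_rep (w : FreePoly) : S.Bounded (fun i => S.rep i w) := by
  obtain ⟨n, R, hR, h⟩ := S.exists_rep_eq w
  refine ((S.bounded_op w).add ((S.bounded_compress hR).smul S.norm_inv_le)).congr ?_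
  filter_upwards [h] with i h using h.symm

/-- For a coordinate the factor `T` cancels against `1 / (i T)`, leaving the commutator with `E_j`,
which is again a bounded combination of Wick ordered operators. The Leibniz rule extends this to
products. -/
lemma bounded_commutator (w : FreePoly) {n : ℕ} {A : ι → Fam} (hA : Nice n A) :
    S.Bounded (fun i => S.T i • (S.rep i w * compress (S.p i) (S.q i) (A i (S.p i) (S.q i)) -
      compress (S.p i) (S.q i) (A i (S.p i) (S.q i)) * S.rep i w)) := by
  induction w using FreeAlgebra.induction with
  | grade0 r =>
    refine (S.bounded_compress (Nice.zero (ι := ι) (n := 0))).congr (Eventually.of_forall fun i => ?_)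
    rw [AlgHom.commutes]
    exact (map_zero (compress (S.p i) (S.q i))).trans
      (smul_commutator_algebraMap (V := quarkSpace (S.p i) (S.q i)) _ _ _).symm
  | grade1 j =>
    refine ((S.bounded_compress (hA.lieComm (E j))).smul (c := fun _ => -Complex.I)
      (fun _ => le_rfl)).congr (Eventually.of_forall fun i => ?_)
    have h1 : S.rep i (FreeAlgebra.ι ℂ j) =
        (Complex.I * S.T i)⁻¹ • lieRep (S.p i) (S.q i) (slE j) := envRep_env_ι _ _ _ _
    rw [h1, lieComm_apply, map_sub, ← coe_slE, compress_lieOp_mul, compress_mul_lieOp,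
      smul_commutator_smul (V := quarkSpace (S.p i) (S.q i))]
    congr 1
    have := S.ne_zero i
    rw [mul_inv, Complex.inv_I]
    field_simp
  | mul x y hx hy =>
    refine (((S.bounded_rep x).mul hy).add (hx.mul (S.bounded_rep y))).congr
      (Eventually.of_forall fun i => ?_)
    rw [map_mul]
    exact (smul_commutator_mul_left (A := Module.End ℂ (quarkSpace (S.p i) (S.q i))) _ _ _ _).symm
  | add x y hx hy =>
    refine (hx.add hy).congr (Eventually.of_forall fun i => ?_)
    rw [map_add]
    exact (smul_commutator_add_left (A := Module.End ℂ (quarkSpace (S.p i) (S.q i))) _ _ _ _).symm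

/-- Operator products are the quantizations of products, up to an error of order `1 / T`. -/
lemma bounded_product (v w : FreePoly) :
    S.Bounded (fun i => S.T i • (S.op i v * S.op i w - S.op i (v * w))) := by
  obtain ⟨_, R, hR, h⟩ := S.exists_rep_eq v
  obtain ⟨_, R', hR', h'⟩ := S.exists_rep_eq w
  obtain ⟨_, Q, hQ, hQe⟩ := S.exists_rep_eq (v * w)
  refine (((S.bounded_compress hQ).sub ((S.bounded_rep v).mul (S.bounded_compress hR'))).sub
    ((S.bounded_compress hR).mul (S.bounded_op w))).congr ?_
  filter_upwards [h, h', hQe] with i h h' hQe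
  exact (smul_product_defect (V := quarkSpace (S.p i) (S.q i)) (S.ne_zero i) h h' hQe (map_mul _ _ _)).symm

/-- Commutators are the quantizations of Poisson brackets, up to an error of order `1 / T`. -/
lemma bounded_bracket {u v w : FreePoly} (h : IsBracket u v w) :
    S.Bounded (fun i => S.T i • (S.T i • (S.op i v * S.op i w - S.op i w * S.op i v) -
      S.op i u)) := by
  obtain ⟨_, R, hR, hv⟩ := S.exists_rep_eq v
  obtain ⟨_, R', hR', hw⟩ := S.exists_rep_eq w
  obtain ⟨_, Q, hQ, hu⟩ := S.exists_rep_eq u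
  have hB := S.bounded_compress hR
  have hB' := S.bounded_compress hR'
  refine ((((S.bounded_compress hQ).add (S.bounded_commutator w hR)).sub
    (S.bounded_commutator v hR')).add ((hB.mul hB').sub (hB'.mul hB))).congr ?_
  filter_upwards [hv, hw, hu] with i hv hw hu
  refine (smul_commutator_defect (V := quarkSpace (S.p i) (S.q i)) (S.ne_zero i) hv hw hu ?_).symm
  have := congrArg (envRep (S.p i) (S.q i)) (h.2 (S.T i) (S.ne_zero i))
  rw [map_smul, map_sub, map_mul, map_mul] at this
  exact this

end Scaling

end

end QuarkSU3

namespace QuarkSU3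

open MvPolynomial Filter

noncomputable section

/-! ### Symbols of operators on quark systems -/

lemma opSymbol_sub {p q : ℕ} (A B : Module.End ℂ (quarkSpace p q)) (g : SU3) :
    opSymbol (A - B) g = opSymbol A g - opSymbol B g := by
  rw [opSymbol, LinearMap.sub_apply, inner_sub_right, mul_sub]
  rfl

lemma opSymbol_smul {p q : ℕ} (c : ℂ) (A : Module.End ℂ (quarkSpace p q)) (g : SU3) :
    opSymbol (c • A) g = c * opSymbol A g := by
  rw [opSymbol, opSymbol, LinearMap.smul_apply, Submodule.coe_inner, Submodule.coe_inner,
    Submodule.coe_smul, inner_smul_right]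
  ring

lemma norm_grpAct_hwPol_sq (p q : ℕ) (g : SU3) :
    ‖grpAct g (hwPol p q)‖ ^ 2 = (p.factorial : ℝ) * q.factorial := by
  have h := HasSymbol.one g 0 p q (Nat.zero_le p) (Nat.zero_le q)
  rw [Fam.one_apply, Module.End.one_apply, inner_self_eq_norm_sq_to_K, mul_one] at h
  refine Complex.ofReal_injective ?_
  push_cast
  exact h

lemma norm_opSymbol_le {p q : ℕ} {A : Module.End ℂ (quarkSpace p q)} {C : ℝ} (hA : OpBound C A)
    (g : SU3) : ‖opSymbol A g‖ ≤ C := by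
  have h0 : (0 : ℝ) < (p.factorial : ℝ) * q.factorial := by positivity
  have h1 : ‖inner ℂ (grpRep p q g (hwVec p q)) (A (grpRep p q g (hwVec p q)))‖ ≤
      (p.factorial : ℝ) * q.factorial * C := by
    rw [Submodule.coe_inner]
    refine (norm_inner_le_norm _ _).trans ?_
    have h2 := hA (grpRep p q g (hwVec p q))
    have h3 : ‖(grpRep p q g (hwVec p q) : Pol)‖ ^ 2 = (p.factorial : ℝ) * q.factorial :=
      norm_grpAct_hwPol_sq p q g
    rw [← h3]
    nlinarith [norm_nonneg (grpRep p q g (hwVec p q) : Pol)]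
  rw [opSymbol, norm_mul, norm_inv, norm_mul, Complex.norm_natCast, Complex.norm_natCast]
  rwa [inv_mul_le_iff₀ h0]

/-- Coherent states lie in the quark space, so the compression does not change expectation values,
and the symbol is exact rather than asymptotic. -/
lemma Scaling.eventually_opSymbol_op {ι : Type*} (S : Scaling ι) (w : FreePoly) :
    ∀ᶠ i in S.largeDegrees, ∀ g, opSymbol (S.op i w) g =
      MvPolynomial.eval (momentCoord ((S.p i : ℂ) / S.T i) ((S.q i : ℂ) / S.T i) g) (polyOf w) := by
  obtain ⟨m, hm⟩ := HasSymbol.quant w 0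
  refine S.eventually_iff.2 ⟨m, fun i hp hq g => ?_⟩
  have h := hm ((S.p i : ℂ) / S.T i) ((S.q i : ℂ) / S.T i) g _ _ (HasSymbol.one g 0) (S.p i) (S.q i) hp hq
  rw [opSymbol, op, compress_apply, inner_quarkProj]
  refine (congrArg _ h).trans ?_
  rw [inv_mul_cancel_left₀ (factorial_mul_ne_zero _ _), mul_one]

/-! ### The orbits of the rational points of the arc -/

lemma conjTranspose_E (j : Fin 8) : (E j).conjTranspose = -E j := by
  have h : (gellMann j).conjTranspose = gellMann j := by
    ext a b
    fin_cases j <;> fin_cases a <;> fin_cases b <;> simp [gellMann]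
  rw [E, Matrix.conjTranspose_smul, h, ← neg_smul, Complex.star_def, map_div₀, Complex.conj_I,
    Complex.conj_ofReal, neg_div]

lemma coe_inv_apply (g : SU3) (i j : Fin 3) : ((g⁻¹ : SU3) : Mat3) i j = star ((g : Mat3) j i) :=
  rfl

lemma conj_apply (g : SU3) (A : Mat3) (k : Fin 3) :
    (((g⁻¹ : SU3) : Mat3) * A * (g : Mat3)) k k = conjEntry g A k := by
  simp only [conjEntry, Matrix.mul_apply, Finset.sum_mul, coe_inv_apply]
  rw [Finset.sum_comm]
  refine Finset.sum_congr rfl fun i _ => Finset.sum_congr rfl fun j _ => ?_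
  ring

lemma coord_conj {ξ : Mat3} {T : ℂ} (hT : T ≠ 0) {p q : ℕ} (h : T • ξ = domWeight p q) (g : SU3) :
    coord ((g : Mat3) * ξ * ((g⁻¹ : SU3) : Mat3)) = momentCoord ((p : ℂ) / T) ((q : ℂ) / T) g := by
  funext j
  have hg : (g : Mat3) * ((g⁻¹ : SU3) : Mat3) = 1 := by
    rw [← Submonoid.coe_mul, mul_inv_cancel, Submonoid.coe_one]
  set B : Mat3 := ((g⁻¹ : SU3) : Mat3) * E j * (g : Mat3) with hB
  have htr : B 0 0 + B 1 1 + B 2 2 = 0 := by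
    have : Matrix.trace B = 0 := by
      rw [hB, Matrix.trace_mul_comm, ← Matrix.mul_assoc, hg, Matrix.one_mul, trace_E]
    rwa [Matrix.trace, Fin.sum_univ_three] at this
  have h1 : T * coord ((g : Mat3) * ξ * ((g⁻¹ : SU3) : Mat3)) j =
      -Matrix.trace (B * domWeight p q) := by
    rw [coord, trInner, conjTranspose_E, Matrix.neg_mul, Matrix.trace_neg, mul_neg, ← h, hB,
      Matrix.mul_smul, Matrix.trace_smul, smul_eq_mul]
    congr 2
    rw [← Matrix.mul_assoc, Matrix.trace_mul_comm]
    simp only [Matrix.mul_assoc]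
  -- The weight is `i diag(p, 0, -q)` plus a scalar matrix, and the scalar part does not contribute
  -- because `B` is traceless.
  have h2 : Matrix.trace (B * domWeight p q) = Complex.I * (p * B 0 0 - q * B 2 2) := by
    rw [domWeight_eq, Matrix.trace, Fin.sum_univ_three]
    simp only [Matrix.diag_apply, Matrix.mul_diagonal]
    simp
    linear_combination ((q : ℂ) - p) / 3 * Complex.I * htr
  rw [h2, hB, conj_apply, conj_apply] at h1
  rw [momentCoord]
  apply mul_left_cancel₀ hT
  rw [h1]
  field_simp

lemma intRadius_pos {ξ : Mat3} (hξ : ξ ∈ ratArc) : 0 < intRadius ξ := (isLeast_intRadius hξ).1.1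

/-- Differences of consecutive diagonal entries of a weight read off its labels. The factors are
`√(3/2)` times arc coordinates at most 1, hence at most 2. -/
lemma exists_firstWeight_eq {ξ : Mat3} (hξ : ξ ∈ ratArc) : ∃ x y : ℝ, (0 < x ∧ x ≤ 2) ∧
    (0 < y ∧ y ≤ 2) ∧ ((firstWeight ξ).1 : ℝ) = intRadius ξ * x ∧
      ((firstWeight ξ).2 : ℝ) = intRadius ξ * y := by
  have h := firstWeight_spec hξ
  obtain ⟨⟨x, y, hx, hy, hxy, hξ'⟩, -⟩ := hξ
  have hs0 : 0 < Real.sqrt (3 / 2) := Real.sqrt_pos.2 (by norm_num)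
  have hs : Real.sqrt (3 / 2) ≤ 2 := Real.sqrt_le_iff.2 ⟨by norm_num, by norm_num⟩
  have hx1 : x ≤ 1 := by nlinarith
  have hy1 : y ≤ 1 := by nlinarith
  refine ⟨Real.sqrt (3 / 2) * x, Real.sqrt (3 / 2) * y, ⟨by positivity, by nlinarith⟩,
    ⟨by positivity, by nlinarith⟩, ?_⟩
  generalize intRadius ξ = R at h ⊢
  generalize firstWeight ξ = w at h ⊢
  subst hξ'
  have h0 := congrFun (congrFun h 0) 0
  have h1 := congrFun (congrFun h 1) 1
  have h2 := congrFun (congrFun h 2) 2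
  rw [domWeight_eq] at h0 h1 h2
  simp only [xiPt, fundWeight₁_eq, fundWeight₂_eq, Matrix.smul_apply, Matrix.add_apply,
    Matrix.diagonal_apply_eq, smul_eq_mul] at h0 h1 h2
  clear h
  generalize Real.sqrt (3 / 2) = r at *
  simp at h0 h1 h2
  constructor
  · have : ((w.1 : ℂ) - R * (r * x)) * Complex.I = 0 := by linear_combination h1 - h0
    have := sub_eq_zero.1 ((mul_eq_zero.1 this).resolve_right Complex.I_ne_zero)
    exact_mod_cast this
  · have : ((w.2 : ℂ) - R * (r * y)) * Complex.I = 0 := by linear_combination h2 - h1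
    have := sub_eq_zero.1 ((mul_eq_zero.1 this).resolve_right Complex.I_ne_zero)
    exact_mod_cast this

lemma one_le_firstWeight {ξ : Mat3} (hξ : ξ ∈ ratArc) :
    1 ≤ (firstWeight ξ).1 ∧ 1 ≤ (firstWeight ξ).2 := by
  obtain ⟨x, y, hx, hy, h1, h2⟩ := exists_firstWeight_eq hξ
  have hR := intRadius_pos hξ
  have a : (0 : ℝ) < (firstWeight ξ).1 := h1 ▸ mul_pos hR hx.1
  have b : (0 : ℝ) < (firstWeight ξ).2 := h2 ▸ mul_pos hR hy.1
  exact ⟨Nat.cast_pos.1 a, Nat.cast_pos.1 b⟩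

/-- The first label is a positive integer and at most `2 r(ξ)`. -/
lemma inv_intRadius_le {ξ : Mat3} (hξ : ξ ∈ ratArc) : (intRadius ξ)⁻¹ ≤ 2 := by
  obtain ⟨x, y, hx, -, h1, -⟩ := exists_firstWeight_eq hξ
  have hR := intRadius_pos hξ
  have h2 : (1 : ℝ) ≤ (firstWeight ξ).1 := Nat.one_le_cast.2 (one_le_firstWeight hξ).1
  rw [inv_le_iff_one_le_mul₀ hR]
  nlinarith

lemma smul_eq_domWeight {ξ : Mat3} (hξ : ξ ∈ ratArc) (s : ℕ) :
    ((s : ℂ) * (intRadius ξ : ℂ)) • ξ =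
      domWeight (s * (firstWeight ξ).1) (s * (firstWeight ξ).2) := by
  rw [← smul_smul, firstWeight_spec hξ, domWeight, domWeight, smul_add, smul_smul, smul_smul,
    Nat.cast_mul, Nat.cast_mul]

/-- The rays of the rational points of the arc. -/
abbrev RayIndex : Type := {x : ℕ × Mat3 // 1 ≤ x.1 ∧ x.2 ∈ ratArc}

lemma RayIndex.scale_ne_zero (i : RayIndex) : (i.1.1 : ℂ) * (intRadius i.1.2 : ℂ) ≠ 0 :=
  mul_ne_zero (Nat.cast_ne_zero.2 (by have := i.2.1; omega))
    (Complex.ofReal_ne_zero.2 (intRadius_pos i.2.2).ne')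

lemma RayIndex.norm_inv_scale_le (i : RayIndex) :
    ‖((i.1.1 : ℂ) * (intRadius i.1.2 : ℂ))⁻¹‖ ≤ 2 / i.1.1 := by
  rw [norm_inv, norm_mul, Complex.norm_natCast, Complex.norm_real, Real.norm_eq_abs,
    abs_of_pos (intRadius_pos i.2.2), mul_inv, mul_comm, div_eq_mul_inv]
  gcongr
  exact inv_intRadius_le i.2.2

lemma norm_mul_div_mul_le {s n : ℕ} (hs : 1 ≤ s) {R x : ℝ} (hR : 0 < R) (hx : 0 < x ∧ x ≤ 2)
    (h : (n : ℝ) = R * x) : ‖((s * n : ℕ) : ℂ) / ((s : ℂ) * (R : ℂ))‖ ≤ 2 := by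
  have hs' : (0 : ℝ) < s := Nat.cast_pos.2 hs
  rw [norm_div, Complex.norm_natCast, norm_mul, Complex.norm_natCast, Complex.norm_real,
    Real.norm_eq_abs, abs_of_pos hR, Nat.cast_mul, h, div_le_iff₀ (by positivity)]
  nlinarith [mul_pos hs' hR]

/-- The highest weights of the Berezin rays of the rational points, with scale `s r(ξ)`. -/
def rayScaling : Scaling RayIndex where
  p i := i.1.1 * (firstWeight i.1.2).1
  q i := i.1.1 * (firstWeight i.1.2).2
  T i := (i.1.1 : ℂ) * (intRadius i.1.2 : ℂ)
  bound := 2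
  ne_zero := RayIndex.scale_ne_zero
  norm_inv_le i := i.norm_inv_scale_le.trans
    (div_le_self (by norm_num) (Nat.one_le_cast.2 i.2.1))
  norm_p_le i := by
    obtain ⟨x, y, hx, hy, h1, h2⟩ := exists_firstWeight_eq i.2.2
    exact norm_mul_div_mul_le i.2.1 (intRadius_pos i.2.2) hx h1
  norm_q_le i := by
    obtain ⟨x, y, hx, hy, h1, h2⟩ := exists_firstWeight_eq i.2.2
    exact norm_mul_div_mul_le i.2.1 (intRadius_pos i.2.2) hy h2

/-- Both labels of the first weight are at least 1, so both degrees are at least `s`, whatever the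
point `ξ`. -/
lemma rayScaling_eventually {P : RayIndex → Prop}
    (h : ∀ᶠ i in rayScaling.largeDegrees, P i) : ∃ N, ∀ i : RayIndex, N ≤ i.1.1 → P i := by
  obtain ⟨m, hm⟩ := rayScaling.eventually_iff.1 h
  refine ⟨m, fun i hi => hm i ?_ ?_⟩
  · exact hi.trans (Nat.le_mul_of_pos_right _ (one_le_firstWeight i.2.2).1)
  · exact hi.trans (Nat.le_mul_of_pos_right _ (one_le_firstWeight i.2.2).2)

lemma exists_norm_opSymbol_le {A : ∀ i, rayScaling.Op i}
    (hA : rayScaling.Bounded (fun i => rayScaling.T i • A i)) {ε : ℝ} (hε : 0 < ε) :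
    ∃ N, ∀ i : RayIndex, N ≤ i.1.1 → ∀ g, ‖opSymbol (A i) g‖ ≤ ε := by
  obtain ⟨C, hC⟩ := hA
  obtain ⟨N, hN⟩ := rayScaling_eventually hC
  -- Since `1 / T ≤ 2 / s`, the symbol is at most `2 C / s`.
  refine ⟨max N ⌈2 * C / ε⌉₊, fun i hi g => ?_⟩
  have h1 := norm_opSymbol_le (hN i ((le_max_left _ _).trans hi)) g
  have hs : (0 : ℝ) < i.1.1 := Nat.cast_pos.2 i.2.1
  have h2 : 2 * C / ε ≤ i.1.1 := Nat.ceil_le.1 ((le_max_right _ _).trans hi)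
  have h3 : opSymbol (A i) g = (rayScaling.T i)⁻¹ * opSymbol (rayScaling.T i • A i) g := by
    rw [opSymbol_smul, inv_mul_cancel_left₀ (rayScaling.ne_zero i)]
  have h4 : ‖(rayScaling.T i)⁻¹‖ ≤ 2 / i.1.1 := i.norm_inv_scale_le
  rw [h3, norm_mul]
  calc ‖(rayScaling.T i)⁻¹‖ * ‖opSymbol (rayScaling.T i • A i) g‖ ≤ 2 / i.1.1 * C :=
        mul_le_mul h4 h1 (norm_nonneg _) (by positivity)
    _ ≤ ε := by
        rw [div_mul_eq_mul_div, div_le_iff₀ hs]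
        rwa [div_le_iff₀ hε, mul_comm (i.1.1 : ℝ)] at h2

/-! ### Berezin rays and their twisted products -/

lemma berezinRay_apply {ξ : Mat3} (hξ : ξ ∈ ratArc) (s : ℕ) (u : Usl3) (g : SU3) :
    berezinRay s ξ u ⟨_, conj_mem_orbit ξ g⟩ =
      opSymbol (envRep (s * (firstWeight ξ).1) (s * (firstWeight ξ).2) u) g := by
  have h := smul_eq_domWeight hξ s
  rw [← Complex.ofReal_natCast, ← Complex.ofReal_mul] at h
  rw [berezinRay, berezinSymbol_apply h, trace_hwProjConj]

lemma berezinRay_eq {ξ : Mat3} (hξ : ξ ∈ ratArc) {s : ℕ} {u : Usl3} {f : orbit ξ → ℂ}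
    (h : ∀ g, opSymbol (envRep (s * (firstWeight ξ).1) (s * (firstWeight ξ).2) u) g =
      f ⟨_, conj_mem_orbit ξ g⟩) : berezinRay s ξ u = f := by
  funext ⟨Y, g, hg⟩
  subst hg
  exact (berezinRay_apply hξ s u g).trans (h g)

lemma envRep_eq_of_berezinRay_eq {ξ : Mat3} (hξ : ξ ∈ ratArc) {s : ℕ} {u v : Usl3}
    (h : berezinRay s ξ u = berezinRay s ξ v) :
    envRep (s * (firstWeight ξ).1) (s * (firstWeight ξ).2) u =
      envRep (s * (firstWeight ξ).1) (s * (firstWeight ξ).2) v :=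
  opSymbol_injective fun g => by rw [← berezinRay_apply hξ, ← berezinRay_apply hξ, h]

/-- The twisted products are well defined. -/
lemma berezinStar_berezinRay {ξ : Mat3} (hξ : ξ ∈ ratArc) (s : ℕ) (u v : Usl3) :
    berezinStar s ξ (berezinRay s ξ u) (berezinRay s ξ v) = berezinRay s ξ (u * v) := by
  have h : (∃ u', berezinRay s ξ u' = berezinRay s ξ u) ∧
      (∃ v', berezinRay s ξ v' = berezinRay s ξ v) := ⟨⟨u, rfl⟩, ⟨v, rfl⟩⟩
  rw [berezinStar, dif_pos h]
  have h1 := envRep_eq_of_berezinRay_eq hξ h.1.choose_spec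
  have h2 := envRep_eq_of_berezinRay_eq hξ h.2.choose_spec
  rw [berezinRay, map_mul, h1, h2, ← map_mul]
  rfl

/-- The operator with this exact symbol is already at hand; surjectivity of the representation
supplies the element of the enveloping algebra. -/
lemma exists_berezinRay_eq_restr (w : FreePoly) : ∃ N, ∀ i : RayIndex, N ≤ i.1.1 →
    (∀ g, opSymbol (rayScaling.op i w) g =
      restr (polyOf w) i.1.2 ⟨_, conj_mem_orbit i.1.2 g⟩) ∧
    ∃ u, envRep (rayScaling.p i) (rayScaling.q i) u = rayScaling.op i w ∧
      berezinRay i.1.1 i.1.2 u = restr (polyOf w) i.1.2 := by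
  obtain ⟨N, hN⟩ := rayScaling_eventually (rayScaling.eventually_opSymbol_op w)
  refine ⟨N, fun i hi => ?_⟩
  have h : ∀ g, opSymbol (rayScaling.op i w) g =
      restr (polyOf w) i.1.2 ⟨_, conj_mem_orbit i.1.2 g⟩ := by
    intro g
    rw [hN i hi g, restr, evalAt, coord_conj i.scale_ne_zero (smul_eq_domWeight i.2.2 _)]
    rfl
  obtain ⟨u, hu⟩ := envRep_surjective (rayScaling.p i) (rayScaling.q i) (rayScaling.op i w)
  refine ⟨h, u, hu, berezinRay_eq i.2.2 fun g => ?_⟩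
  rw [← h g, ← hu]
  rfl

/-- The twisted products of restrictions of polynomials are symbols of products of operators. -/
lemma exists_berezinStar_restr (v w : FreePoly) : ∃ N, ∀ i : RayIndex, N ≤ i.1.1 → ∀ g,
    berezinStar i.1.1 i.1.2 (restr (polyOf v) i.1.2) (restr (polyOf w) i.1.2)
        ⟨_, conj_mem_orbit i.1.2 g⟩ =
      opSymbol (rayScaling.op i v * rayScaling.op i w) g := by
  obtain ⟨N, hN⟩ := exists_berezinRay_eq_restr v
  obtain ⟨M, hM⟩ := exists_berezinRay_eq_restr w
  refine ⟨max N M, fun i hi g => ?_⟩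
  obtain ⟨-, a, ha, ha'⟩ := hN i ((le_max_left _ _).trans hi)
  obtain ⟨-, b, hb, hb'⟩ := hM i ((le_max_right _ _).trans hi)
  rw [← ha', ← hb', berezinStar_berezinRay i.2.2, berezinRay_apply i.2.2, map_mul, ← ha, ← hb]
  rfl

lemma supNorm_lt {ξ : Mat3} {f : orbit ξ → ℂ} {ε : ℝ} (hε : 0 < ε)
    (h : ∀ g : SU3, ‖f ⟨_, conj_mem_orbit ξ g⟩‖ ≤ ε / 2) : supNorm f < ENNReal.ofReal ε := by
  -- A supremum inherits only weak inequalities, so half of `ε` is kept in reserve.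
  have h1 : supNorm f ≤ ENNReal.ofReal (ε / 2) := by
    refine iSup_le ?_
    rintro ⟨Y, g, rfl⟩
    rw [← ofReal_norm]
    exact ENNReal.ofReal_le_ofReal (h g)
  exact h1.trans_lt ((ENNReal.ofReal_lt_ofReal_iff hε).2 (half_lt_self hε))

lemma restr_mul (F G : PolySU3) (ξ : Mat3) : restr (F * G) ξ = restr F ξ * restr G ξ :=
  funext fun _ => map_mul (MvPolynomial.eval _) F G

lemma restr_C_mul (c : ℂ) (F : PolySU3) (ξ : Mat3) : restr (C c * F) ξ = c • restr F ξ :=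
  funext fun Y => by simp [restr, evalAt]

/-! ### Uniform convergence of products and commutators -/

lemma exists_supNorm_product_lt (v w : FreePoly) {ε : ℝ} (hε : 0 < ε) :
    ∃ N, ∀ i : RayIndex, N ≤ i.1.1 →
      supNorm (berezinStar i.1.1 i.1.2 (restr (polyOf v) i.1.2) (restr (polyOf w) i.1.2) -
        restr (polyOf v) i.1.2 * restr (polyOf w) i.1.2) < ENNReal.ofReal ε := by
  obtain ⟨N₁, h₁⟩ := exists_berezinStar_restr v w
  obtain ⟨N₂, h₂⟩ := exists_berezinRay_eq_restr (v * w)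
  obtain ⟨N₃, h₃⟩ := exists_norm_opSymbol_le (rayScaling.bounded_product v w) (half_pos hε)
  refine ⟨max N₁ (max N₂ N₃), fun i hi => supNorm_lt hε fun g => ?_⟩
  simp only [max_le_iff] at hi
  have h := h₃ i hi.2.2 g
  rw [opSymbol_sub, ← h₁ i hi.1, (h₂ i hi.2.1).1 g, map_mul, restr_mul] at h
  exact h

lemma exists_supNorm_bracket_lt (v w : FreePoly) {ε : ℝ} (hε : 0 < ε) :
    ∃ N, ∀ i : RayIndex, N ≤ i.1.1 →
      supNorm (((i.1.1 : ℂ) * (intRadius i.1.2 : ℂ)) •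
          (berezinStar i.1.1 i.1.2 (restr (polyOf v) i.1.2) (restr (polyOf w) i.1.2) -
            berezinStar i.1.1 i.1.2 (restr (polyOf w) i.1.2) (restr (polyOf v) i.1.2)) -
        Complex.I • restr (poisson (polyOf v) (polyOf w)) i.1.2) < ENNReal.ofReal ε := by
  obtain ⟨u, hu⟩ := exists_isBracket v w
  obtain ⟨N₁, h₁⟩ := exists_berezinStar_restr v w
  obtain ⟨N₂, h₂⟩ := exists_berezinStar_restr w v
  obtain ⟨N₃, h₃⟩ := exists_berezinRay_eq_restr u
  obtain ⟨N₄, h₄⟩ := exists_norm_opSymbol_le (rayScaling.bounded_bracket hu) (half_pos hε)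
  refine ⟨max N₁ (max N₂ (max N₃ N₄)), fun i hi => supNorm_lt hε fun g => ?_⟩
  simp only [max_le_iff] at hi
  have h := h₄ i hi.2.2.2 g
  rw [opSymbol_sub, opSymbol_smul, opSymbol_sub, ← h₁ i hi.1, ← h₂ i hi.2.1, (h₃ i hi.2.2.1).1 g,
    hu.1, restr_C_mul] at h
  exact h

end

end QuarkSU3

theorem theorem4p21 (K : Set Mat3) (hK : IsCompact K) (hKF : K ⊆ openArc) (F₁ F₂ : PolySU3) :
    -- the twisted products are well defined on the images of the Berezin correspondences
    (∀ s : ℕ, 1 ≤ s → ∀ ξ ∈ ratArc, ∀ u v : Usl3,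
      berezinStar s ξ (berezinRay s ξ u) (berezinRay s ξ v) = berezinRay s ξ (u * v)) ∧
    -- for large `s` the restrictions of the two polynomials lie in these images
    (∃ s₀ : ℕ, ∀ s ≥ s₀, ∀ ξ ∈ ratArc ∩ K,
      restr F₁ ξ ∈ Set.range (berezinRay s ξ) ∧ restr F₂ ξ ∈ Set.range (berezinRay s ξ)) ∧
    -- uniform convergence of the twisted product to the pointwise product
    (∀ ε : ℝ, 0 < ε → ∃ N : ℕ, ∀ s ≥ N, ∀ ξ ∈ ratArc ∩ K,
      supNorm (berezinStar s ξ (restr F₁ ξ) (restr F₂ ξ) - restr F₁ ξ * restr F₂ ξ)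
        < ENNReal.ofReal ε) ∧
    -- uniform convergence of the weighted commutator to the Poisson bracket
    (∀ ε : ℝ, 0 < ε → ∃ N : ℕ, ∀ s ≥ N, ∀ ξ ∈ ratArc ∩ K,
      supNorm (((s : ℂ) * (intRadius ξ : ℂ)) •
          (berezinStar s ξ (restr F₁ ξ) (restr F₂ ξ) - berezinStar s ξ (restr F₂ ξ) (restr F₁ ξ))
        - Complex.I • restr (poisson F₁ F₂) ξ)
        < ENNReal.ofReal ε) := by
  -- Any noncommutative lifts will do: the symbols depend only on the commutative images, the choice
  -- of lift affects only the constants.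
  obtain ⟨v, rfl⟩ := polyOf_surjective F₁
  obtain ⟨w, rfl⟩ := polyOf_surjective F₂
  refine ⟨fun s _ ξ hξ u v => berezinStar_berezinRay hξ s u v, ?_, fun ε hε => ?_, fun ε hε => ?_⟩
  · obtain ⟨N, hN⟩ := exists_berezinRay_eq_restr v
    obtain ⟨M, hM⟩ := exists_berezinRay_eq_restr w
    -- The estimates are indexed by rays with `s ≥ 1`, hence the maximum with 1.
    refine ⟨max 1 (max N M), fun s hs ξ hξ => ?_⟩
    simp only [ge_iff_le, max_le_iff] at hs
    obtain ⟨-, a, -, ha⟩ := hN ⟨(s, ξ), hs.1, hξ.1⟩ hs.2.1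
    obtain ⟨-, b, -, hb⟩ := hM ⟨(s, ξ), hs.1, hξ.1⟩ hs.2.2
    exact ⟨⟨a, ha⟩, ⟨b, hb⟩⟩
  · obtain ⟨N, hN⟩ := exists_supNorm_product_lt v w hε
    exact ⟨max 1 N, fun s hs ξ hξ =>
      hN ⟨(s, ξ), (le_max_left _ _).trans hs, hξ.1⟩ ((le_max_right _ _).trans hs)⟩
  · obtain ⟨N, hN⟩ := exists_supNorm_bracket_lt v w hε
    exact ⟨max 1 N, fun s hs ξ hξ =>
      hN ⟨(s, ξ), (le_max_left _ _).trans hs, hξ.1⟩ ((le_max_right _ _).trans hs)⟩
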